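/- Let $n\ge 3$ be an integer and let $\Lambda>0$. There is a constant $c_0=c_0(n,\Lambda)>0$ such that the following holds for every connected, noncompact, complete smooth Riemannian $n$-manifold $(M,g)$ (without boundary). Write $R_{ijkl}$, $R_{ij}$ and $R$ for the Riemann, Ricci and scalar curvature, $E_{ij}=R_{ij}-\frac{R}{n}g_{ij}$ for the traceless Ricci tensor, $W$ for the Weyl tensor, $|\cdot|$ for the pointwise tensor norms (so $|E|^2=E_{ij}E^{ij}$ and $|W|^2=W_{ijkl}W^{ijkl}$), $dV_g$ for the Riemannian volume measure, and $$Q(M,g)=\inf_{0\ne u\in C_0^\infty(M)}\frac{\int_M |\nabla u|^2+\frac{n-2}{4(n-1)}R\,u^2\,dV_g}{\left(\int_M|u|^{2n/(n-2)}\,dV_g\right)^{(n-2)/n}} .$$ Assume that 1. $(M,g)$ has harmonic curvature, i.e. $\nabla^iR_{ijkl}=0$; 2. $Q(M,g)\ge\Lambda$; 3. $\int_M |W|^2+|E|^2\,dV_g<\infty$; 4. either (A) $R\ge0$ on $M$, or (B) $R<0$ on $M$ and $n\ge5$; 5. $\int_M |W|^{n/2}+|E|^{n/2}\,dV_g\le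 c_0$. Then $(M,g)$ is Einstein, i.e. $R_{ij}=c\,g_{ij}$ on $M$ for some constant $c$. -/

import Mathlib

open Bundle Manifold MeasureTheory
open scoped ContDiff ENNReal

universe u

/-! Riemannian geometry in local coordinates.  `M` is a boundaryless manifold modelled on `ℝⁿ`
whose tangent spaces carry the inner products `g` given by the class `RiemannianBundle`. -/

noncomputable section

namespace RiemGeom

/-- The model space `ℝⁿ`. -/
abbrev Coord (n : ℕ) : Type := EuclideanSpace ℝ (Fin n)

/-- The partial derivative `∂f / ∂yⁱ` at `y`. -/
def pd {n : ℕ} (i : Fin n) (f : Coord n → ℝ) (y : Coord n) : ℝ :=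
  fderiv ℝ f y (EuclideanSpace.single i (1 : ℝ))

section Tensors

variable {n : ℕ} {M : Type*} [TopologicalSpace M] [ChartedSpace (Coord n) M]

/-- The point of `M` with coordinates `y` in the preferred chart around `x₀`. -/
def chartPt (x₀ : M) (y : Coord n) : M := (extChartAt (𝓡 n) x₀).symm y

/-- The coordinate vector field `∂ᵢ` of the preferred chart around `x₀`, at the point with
coordinates `y`. -/
def coordVec (x₀ : M) (i : Fin n) (y : Coord n) : TangentSpace (𝓡 n) (chartPt x₀ y) :=
  mfderiv 𝓘(ℝ, Coord n) (𝓡 n) (chartPt x₀) y (EuclideanSpace.single i (1 : ℝ))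

variable [RiemannianBundle (fun x : M => TangentSpace (𝓡 n) x)]

/-- The components `g_{ij}` of the metric in the preferred chart around `x₀`. -/
def gLow (x₀ : M) (y : Coord n) : Matrix (Fin n) (Fin n) ℝ :=
  Matrix.of fun i j => inner ℝ (coordVec x₀ i y) (coordVec x₀ j y)

/-- The components `g^{ij}` of the inverse metric. -/
def gUp (x₀ : M) (y : Coord n) : Matrix (Fin n) (Fin n) ℝ := (gLow x₀ y)⁻¹

/-- The Christoffel symbols `Γᵏ_{ij}` of the Levi-Civita connection. -/
def christoffel (x₀ : M) (k i j : Fin n) (y : Coord n) : ℝ :=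
  (1 / 2) * ∑ l, gUp x₀ y k l *
    (pd i (fun z => gLow x₀ z j l) y + pd j (fun z => gLow x₀ z i l) y
      - pd l (fun z => gLow x₀ z i j) y)

/-- The `∂ₗ`-component of `R(∂ᵢ, ∂ⱼ)∂ₖ = ∇ᵢ∇ⱼ∂ₖ - ∇ⱼ∇ᵢ∂ₖ`. -/
def curvOp (x₀ : M) (l i j k : Fin n) (y : Coord n) : ℝ :=
  pd i (christoffel x₀ l j k) y - pd j (christoffel x₀ l i k) y
    + ∑ m, (christoffel x₀ m j k y * christoffel x₀ l i m y
      - christoffel x₀ m i k y * christoffel x₀ l j m y)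

/-- The curvature tensor `R_{ijkl} = g(R(∂ₖ, ∂ₗ)∂ⱼ, ∂ᵢ)`, with the sign for which
`R_{ijkl} = K (g_{ik} g_{jl} - g_{il} g_{jk})` in constant curvature `K`. -/
def riem (x₀ : M) (i j k l : Fin n) (y : Coord n) : ℝ :=
  ∑ p, gLow x₀ y i p * curvOp x₀ p k l j y

/-- The Ricci tensor `R_{jl} = g^{ik} R_{ijkl}`. -/
def ric (x₀ : M) (j l : Fin n) (y : Coord n) : ℝ :=
  ∑ i, ∑ k, gUp x₀ y i k * riem x₀ i j k l y

/-- The scalar curvature `R = g^{jl} R_{jl}` in the preferred chart around `x₀`. -/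
def scalCoord (x₀ : M) (y : Coord n) : ℝ :=
  ∑ j, ∑ l, gUp x₀ y j l * ric x₀ j l y

/-- The traceless Ricci tensor `E_{ij} = R_{ij} - (R / n) g_{ij}`. -/
def tracelessRic (x₀ : M) (i j : Fin n) (y : Coord n) : ℝ :=
  ric x₀ i j y - scalCoord x₀ y / n * gLow x₀ y i j

/-- The Weyl tensor (for `n ≥ 3`). -/
def weyl (x₀ : M) (i j k l : Fin n) (y : Coord n) : ℝ :=
  let g := gLow x₀ y
  let E := fun a b => tracelessRic x₀ a b y
  riem x₀ i j k l y
    - scalCoord x₀ y / ((n : ℝ) * ((n : ℝ) - 1)) * (g i k * g j l - g i l * g j k)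
    - 1 / ((n : ℝ) - 2) * (E i k * g j l + E j l * g i k - E i l * g j k - E j k * g i l)

/-- The covariant derivative `∇ₘ R_{ijkl}` of the curvature tensor. -/
def covRiem (x₀ : M) (m i j k l : Fin n) (y : Coord n) : ℝ :=
  pd m (riem x₀ i j k l) y
    - ∑ p, (christoffel x₀ p m i y * riem x₀ p j k l y
      + christoffel x₀ p m j y * riem x₀ i p k l y
      + christoffel x₀ p m k y * riem x₀ i j p l y
      + christoffel x₀ p m l y * riem x₀ i j k p y)

/-- The divergence `∇ⁱ R_{ijkl}` of the curvature tensor. -/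
def divRiem (x₀ : M) (j k l : Fin n) (y : Coord n) : ℝ :=
  ∑ m, ∑ i, gUp x₀ y m i * covRiem x₀ m i j k l y

/-- The coordinates of `x` in the preferred chart around `x` itself. -/
def ownCoord (x : M) : Coord n := extChartAt (𝓡 n) x x

/-- The scalar curvature as a function on `M`. -/
def scal (x : M) : ℝ := scalCoord (n := n) x (ownCoord x)

/-- `|E|`, the pointwise norm of the traceless Ricci tensor. -/
def normE (x : M) : ℝ :=
  let y : Coord n := ownCoord x
  √(∑ i, ∑ j, ∑ a, ∑ b, gUp x y i a * gUp x y j b *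
    (tracelessRic x i j y * tracelessRic x a b y))

/-- `|W|`, the pointwise norm of the Weyl tensor, `|W|² = W_{ijkl} W^{ijkl}`. -/
def normW (x : M) : ℝ :=
  let y : Coord n := ownCoord x
  √(∑ i, ∑ j, ∑ k, ∑ l, ∑ a, ∑ b, ∑ c, ∑ d,
    gUp x y i a * gUp x y j b * gUp x y k c * gUp x y l d *
      (weyl x i j k l y * weyl x a b c d y))

/-- `|∇u|²` for a function `u` on `M`. -/
def gradSq (u : M → ℝ) (x : M) : ℝ :=
  let y : Coord n := ownCoord x
  ∑ i, ∑ j, gUp x y i j * (pd i (fun z => u (chartPt x z)) y * pd j (fun z => u (chartPt x z)) y)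

variable (n M)

/-- Harmonic curvature: the divergence of the curvature tensor vanishes. -/
def HasHarmonicCurvature : Prop :=
  ∀ x₀ : M, ∀ y ∈ (extChartAt (𝓡 n) x₀).target, ∀ j k l : Fin n, divRiem x₀ j k l y = 0

/-- Einstein: `Ric = c g` for a constant `c`. -/
def IsEinstein : Prop :=
  ∃ c : ℝ, ∀ x₀ : M, ∀ y ∈ (extChartAt (𝓡 n) x₀).target, ∀ i j : Fin n,
    ric x₀ i j y = c * gLow x₀ y i j

variable {M}
variable [MeasurableSpace M]

/-- The measure `√(det g) dy¹ ⋯ dyⁿ` of the preferred chart around `x₀`, carried by its domain. -/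
def chartVolume (x₀ : M) : Measure M :=
  Measure.map (chartPt x₀)
    ((volume.restrict (extChartAt (𝓡 n) x₀).target).withDensity
      (fun y : Coord n => ENNReal.ofReal √((gLow x₀ y).det)))

variable (M)

/-- The Riemannian volume measure.  The measures of two charts agree on the intersection of their
domains, so that the supremum is the measure that restricts to each of them. -/
def riemVolume : Measure M := ⨆ x₀ : M, chartVolume n x₀

/-- The quotient in the definition of the Sobolev constant. -/
def sobolevQuotient (u : M → ℝ) : ℝ :=
  (∫ x, (gradSq (n := n) u x
      + ((n : ℝ) - 2) / (4 * ((n : ℝ) - 1)) * scal (n := n) x * u x ^ 2) ∂riemVolume n M) /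
    (∫ x, |u x| ^ (2 * (n : ℝ) / ((n : ℝ) - 2)) ∂riemVolume n M) ^ (((n : ℝ) - 2) / (n : ℝ))

/-- The Sobolev constant `Q(M, g)`: the infimum of the quotient over the nonzero smooth functions
with compact support. -/
def sobolevConst : EReal :=
  ⨅ (u : M → ℝ) (_ : ContMDiff (𝓡 n) 𝓘(ℝ) ∞ u) (_ : HasCompactSupport u) (_ : u ≠ 0),
    ((sobolevQuotient n M u : ℝ) : EReal)

end Tensors

end RiemGeom

end

/-!
Harmonic curvature makes the Ricci tensor a Codazzi tensor (the second Bianchi identity) without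
divergence, so that the scalar curvature `R` is constant and the traceless Ricci tensor `E` is a
divergence-free Codazzi tensor.  Commuting derivatives in `∇ⁱ∇ᵢE` then gives the Bochner formula
`½ Δ|E|² = |∇E|² + R / (n - 1) |E|² + n / (n - 2) tr E³ - W(E, E)`
(`lap_normSq_tfRic`, `bochner_curvature_term`, `exists_bochner`).  Since `∇E` is totally symmetric
and traceless, the refined Kato inequality `|∇E|² ≥ (1 + 2 / n) |∇|E||²` holds (`refined_kato`).
With `u = √(|E|² + ε²)` in the place of `|E|` this is smooth, and integrated against `φ²` it becomes
the weak inequality of `integral_gradIn_le` and `lapLower_le`.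

The Sobolev inequality for `φ u`, multiplied by a weight `κ < 1 + 2 / n`, is added to the weak
inequality.  Hölder's inequality and the smallness of the `L^{n/2}` norms absorb the curvature
terms of the Bochner formula in half of the Sobolev term, and the scalar curvature terms have a
good sign as soon as `κ (n - 2) / (4 (n - 1)) R ≤ R / (n - 1)`.  Such a `κ` exists for `R ≥ 0`, and
for `R < 0` if `n ≥ 5`, where `κ = 4 / (n - 2)` (`exists_weight`).  What remains is the bound
`sobolev_norm_le` of `‖φ u‖²` in `L^{2n/(n-2)}` by `∫ u² |∇φ|²` and terms of order `ε²`.  For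
cutoff functions `φ` with small gradient, and then small `ε`, the right-hand side tends to zero
because `|E|²` is integrable.  Hence `E = 0` (`normE_eq_zero`).

The cutoff functions (`exists_cutoff`) are smoothings of functions of the distance to a compact
set; their supports are compact by the Hopf-Rinow theorem (`isCompact_cthickening`), and they are
smoothed by mollification in charts and a partition of unity (`exists_smooth_approx`).

The curvature is computed in coordinates through the connection matrices `Γᵢ`: in this form the
Bianchi identities and the behaviour under a change of coordinates (`IsPullback`) are those of a
connection and its gauge transformations, and norms of tensors are read off in orthonormal frames
(`IsFrame`).  The Riemannian volume, a supremum of the measures of all charts, restricts to the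
measure of each chart (`restrict_riemVolume`), which turns integration by parts on the manifold
into the divergence form of the Laplacian in coordinates (`sum_pd_flux`).
-/

noncomputable section

namespace RiemGeom

/-! ### Partial derivatives and matrix-valued functions -/

section Calculus

variable {n : ℕ} {U : Set (Coord n)} {f g : Coord n → ℝ} {y : Coord n}

lemma differentiableAt_of_contDiffOn (hU : IsOpen U) (hf : ContDiffOn ℝ ∞ f U) (hy : y ∈ U) :
    DifferentiableAt ℝ f y :=
  (hf.differentiableOn (by simp)).differentiableAt (hU.mem_nhds hy)

lemma contDiffOn_pd (hU : IsOpen U) (hf : ContDiffOn ℝ ∞ f U) (i : Fin n) :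
    ContDiffOn ℝ ∞ (pd i f) U :=
  (hf.fderiv_of_isOpen hU (m := ∞) (by simp)).clm_apply contDiffOn_const

lemma pd_add (hf : DifferentiableAt ℝ f y) (hg : DifferentiableAt ℝ g y) (i : Fin n) :
    pd i (fun z => f z + g z) y = pd i f y + pd i g y := by
  simp [pd, fderiv_fun_add hf hg]

lemma pd_sub (hf : DifferentiableAt ℝ f y) (hg : DifferentiableAt ℝ g y) (i : Fin n) :
    pd i (fun z => f z - g z) y = pd i f y - pd i g y := by
  simp [pd, fderiv_fun_sub hf hg]

lemma pd_mul (hf : DifferentiableAt ℝ f y) (hg : DifferentiableAt ℝ g y) (i : Fin n) :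
    pd i (fun z => f z * g z) y = pd i f y * g y + f y * pd i g y := by
  simp only [pd, fderiv_fun_mul hf hg]
  simp
  ring

@[simp] lemma pd_const (c : ℝ) (i : Fin n) (y : Coord n) : pd i (fun _ => c) y = 0 := by
  simp [pd]

lemma pd_const_mul (hf : DifferentiableAt ℝ f y) (c : ℝ) (i : Fin n) :
    pd i (fun z => c * f z) y = c * pd i f y := by
  rw [pd_mul (differentiableAt_const c) hf]; simp

lemma pd_sum {ι : Type*} {s : Finset ι} {F : ι → Coord n → ℝ}
    (hF : ∀ a ∈ s, DifferentiableAt ℝ (F a) y) (i : Fin n) :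
    pd i (fun z => ∑ a ∈ s, F a z) y = ∑ a ∈ s, pd i (F a) y := by
  simp [pd, fderiv_fun_sum hF]

lemma pd_congr (hU : IsOpen U) (h : ∀ z ∈ U, f z = g z) (hy : y ∈ U) (i : Fin n) :
    pd i f y = pd i g y := by
  have : f =ᶠ[nhds y] g := by
    filter_upwards [hU.mem_nhds hy] with z hz using h z hz
  simp [pd, this.fderiv_eq]

lemma pd_eq_zero_of_const (hU : IsOpen U) {c : ℝ} (h : ∀ z ∈ U, f z = c) (hy : y ∈ U)
    (i : Fin n) : pd i f y = 0 := by
  rw [pd_congr hU h hy, pd_const]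

lemma pd_comm (hU : IsOpen U) (hf : ContDiffOn ℝ ∞ f U) (hy : y ∈ U) (i j : Fin n) :
    pd i (pd j f) y = pd j (pd i f) y := by
  have hd : DifferentiableAt ℝ (fderiv ℝ f) y :=
    ((hf.fderiv_of_isOpen hU (m := ∞) (by simp)).differentiableOn (by simp)).differentiableAt
      (hU.mem_nhds hy)
  have hs : IsSymmSndFDerivAt ℝ f y :=
    (hf.contDiffAt (hU.mem_nhds hy)).isSymmSndFDerivAt (by simpa using WithTop.coe_le_coe.2 (le_top : (2 : ℕ∞) ≤ ⊤))
  have key : ∀ a b : Fin n, pd a (pd b f) y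
      = fderiv ℝ (fderiv ℝ f) y (EuclideanSpace.single a 1) (EuclideanSpace.single b 1) := by
    intro a b
    unfold pd
    rw [fderiv_clm_apply hd (differentiableAt_const _)]
    simp
  rw [key, key]
  exact hs.eq _ _

/-- The derivative of `f` in an arbitrary direction is a combination of partial derivatives. -/
lemma fderiv_eq_sum_pd (f : Coord n → ℝ) (y v : Coord n) :
    fderiv ℝ f y v = ∑ i, v i * pd i f y := by
  have : v = ∑ i, v i • EuclideanSpace.single i (1 : ℝ) := by
    ext j; simp [EuclideanSpace.single, Pi.single_apply]
  conv_lhs => rw [this]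
  simp [pd]

/-- The chain rule for partial derivatives. -/
lemma pd_comp {τ : Coord n → Coord n} (hf : DifferentiableAt ℝ f (τ y))
    (hτ : ∀ a, DifferentiableAt ℝ (fun z => τ z a) y) (i : Fin n) :
    pd i (fun z => f (τ z)) y = ∑ a, pd i (fun z => τ z a) y * pd a f (τ y) := by
  have hd : DifferentiableAt ℝ τ y := differentiableAt_euclidean.2 hτ
  have : fderiv ℝ (fun z => f (τ z)) y = (fderiv ℝ f (τ y)).comp (fderiv ℝ τ y) :=
    fderiv_comp y hf hd
  rw [pd, this, ContinuousLinearMap.comp_apply, fderiv_eq_sum_pd]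
  refine Finset.sum_congr rfl fun a _ => ?_
  congr 1
  have h2 : fderiv ℝ (fun z => τ z a) y
      = (EuclideanSpace.proj a : Coord n →L[ℝ] ℝ).comp (fderiv ℝ τ y) :=
    ((EuclideanSpace.proj a : Coord n →L[ℝ] ℝ).hasFDerivAt.comp y
      hd.hasFDerivAt).fderiv
  rw [pd, h2]; rfl

/-- The chain rule for a function of one real variable. -/
lemma pd_comp_real {φ : ℝ → ℝ} {φ' : ℝ} (hφ : HasDerivAt φ φ' (f y))
    (hf : DifferentiableAt ℝ f y) (i : Fin n) : pd i (fun z => φ (f z)) y = φ' * pd i f y := by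
  have := (hφ.comp_hasFDerivAt y hf.hasFDerivAt).fderiv
  simp only [Function.comp_def] at this
  rw [pd, this]; simp [pd]

/-- A square matrix of functions. -/
abbrev MatFun (n : ℕ) : Type := Coord n → Matrix (Fin n) (Fin n) ℝ

/-- Entrywise partial derivative of a matrix of functions. -/
def pdM (i : Fin n) (A : MatFun n) (y : Coord n) : Matrix (Fin n) (Fin n) ℝ :=
  Matrix.of fun a b => pd i (fun z => A z a b) y

/-- Smoothness on `U` of all entries. -/
def SmoothMat (U : Set (Coord n)) (A : MatFun n) : Prop :=
  ∀ a b, ContDiffOn ℝ ∞ (fun z => A z a b) U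

variable {A B : MatFun n}

lemma pdM_apply (i : Fin n) (A : MatFun n) (y : Coord n) (a b : Fin n) :
    pdM i A y a b = pd i (fun z => A z a b) y := rfl

lemma SmoothMat.pdM (hU : IsOpen U) (hA : SmoothMat U A) (i : Fin n) : SmoothMat U (pdM i A) :=
  fun a b => contDiffOn_pd hU (hA a b) i

lemma SmoothMat.add (hA : SmoothMat U A) (hB : SmoothMat U B) :
    SmoothMat U (fun z => A z + B z) := fun a b => (hA a b).add (hB a b)

lemma SmoothMat.sub (hA : SmoothMat U A) (hB : SmoothMat U B) :
    SmoothMat U (fun z => A z - B z) := fun a b => (hA a b).sub (hB a b)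

lemma SmoothMat.mul (hA : SmoothMat U A) (hB : SmoothMat U B) :
    SmoothMat U (fun z => A z * B z) := fun a b => by
  simp only [Matrix.mul_apply]
  exact ContDiffOn.sum fun c _ => (hA a c).mul (hB c b)

lemma SmoothMat.transpose (hA : SmoothMat U A) : SmoothMat U (fun z => (A z).transpose) :=
  fun a b => hA b a

lemma SmoothMat.const (C : Matrix (Fin n) (Fin n) ℝ) : SmoothMat U (fun _ => C) :=
  fun _ _ => contDiffOn_const

lemma SmoothMat.smul (hf : ContDiffOn ℝ ∞ f U) (hA : SmoothMat U A) :
    SmoothMat U (fun z => f z • A z) := fun a b => hf.mul (hA a b)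

lemma SmoothMat.sum {ι : Type*} {s : Finset ι} {F : ι → MatFun n}
    (hF : ∀ a ∈ s, SmoothMat U (F a)) : SmoothMat U (fun z => ∑ a ∈ s, F a z) := fun a b => by
  simp only [Matrix.sum_apply]
  exact ContDiffOn.sum fun c hc => hF c hc a b

lemma SmoothMat.trace (hA : SmoothMat U A) : ContDiffOn ℝ ∞ (fun z => (A z).trace) U := by
  simp only [Matrix.trace, Matrix.diag]
  exact ContDiffOn.sum fun a _ => hA a a

lemma SmoothMat.det (hA : SmoothMat U A) : ContDiffOn ℝ ∞ (fun z => (A z).det) U := by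
  simp only [Matrix.det_apply']
  exact ContDiffOn.sum fun σ _ => contDiffOn_const.mul (contDiffOn_prod fun i _ => hA _ _)

lemma SmoothMat.adjugate (hA : SmoothMat U A) : SmoothMat U (fun z => (A z).adjugate) :=
  fun a b => by
  simp only [Matrix.adjugate_apply]
  refine SmoothMat.det (A := fun z => (A z).updateRow b (Pi.single a 1)) fun c d => ?_
  by_cases h : c = b
  · subst h; simp only [Matrix.updateRow_self]; exact contDiffOn_const
  · simp only [Matrix.updateRow_ne h]; exact hA c d

lemma SmoothMat.inv (hA : SmoothMat U A) (h0 : ∀ z ∈ U, (A z).det ≠ 0) :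
    SmoothMat U (fun z => (A z)⁻¹) := fun a b => by
  simp only [Matrix.inv_def, Ring.inverse_eq_inv']
  exact (hA.det.inv h0).mul (hA.adjugate a b)

section PdM

variable (hU : IsOpen U) (hA : SmoothMat U A) (hB : SmoothMat U B) (hy : y ∈ U) (i : Fin n)

include hU hA hy

lemma SmoothMat.differentiableAt (a b : Fin n) : DifferentiableAt ℝ (fun z => A z a b) y :=
  differentiableAt_of_contDiffOn hU (hA a b) hy

omit hU hA hy in
lemma pdM_transpose : pdM i (fun z => (A z).transpose) y = (pdM i A y).transpose := rfl

lemma pd_trace : pd i (fun z => (A z).trace) y = (pdM i A y).trace := by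
  simp only [Matrix.trace, Matrix.diag]
  exact pd_sum (fun a _ => hA.differentiableAt hU hy a a) i

lemma pdM_comm (j : Fin n) : pdM i (pdM j A) y = pdM j (pdM i A) y := by
  ext a b; exact pd_comm hU (hA a b) hy i j

include hB

lemma pdM_add : pdM i (fun z => A z + B z) y = pdM i A y + pdM i B y := by
  ext a b; exact pd_add (hA.differentiableAt hU hy a b) (hB.differentiableAt hU hy a b) i

lemma pdM_sub : pdM i (fun z => A z - B z) y = pdM i A y - pdM i B y := by
  ext a b; exact pd_sub (hA.differentiableAt hU hy a b) (hB.differentiableAt hU hy a b) i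

lemma pdM_mul : pdM i (fun z => A z * B z) y = pdM i A y * B y + A y * pdM i B y := by
  ext a b
  simp only [pdM_apply, Matrix.mul_apply, Matrix.add_apply]
  rw [← Finset.sum_add_distrib]
  refine (pd_sum (F := fun c z => A z a c * B z c b) (fun c _ =>
    (hA.differentiableAt hU hy a c).fun_mul (hB.differentiableAt hU hy c b)) i).trans ?_
  exact Finset.sum_congr rfl fun c _ =>
    pd_mul (hA.differentiableAt hU hy a c) (hB.differentiableAt hU hy c b) i

end PdM

lemma pdM_congr (hU : IsOpen U) (h : ∀ z ∈ U, A z = B z) (hy : y ∈ U) (i : Fin n) :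
    pdM i A y = pdM i B y := by
  ext a b; exact pd_congr hU (fun z hz => by rw [h z hz]) hy i

lemma pdM_const (C : Matrix (Fin n) (Fin n) ℝ) (i : Fin n) (y : Coord n) :
    pdM i (fun _ => C) y = 0 := by
  ext a b; exact pd_const _ i y

lemma pdM_smul (hU : IsOpen U) (hf : ContDiffOn ℝ ∞ f U) (hA : SmoothMat U A) (hy : y ∈ U)
    (i : Fin n) : pdM i (fun z => f z • A z) y = pd i f y • A y + f y • pdM i A y := by
  ext a b
  exact pd_mul (differentiableAt_of_contDiffOn hU hf hy) (hA.differentiableAt hU hy a b) i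

lemma pdM_sum {ι : Type*} {s : Finset ι} {F : ι → MatFun n} (hU : IsOpen U)
    (hF : ∀ a ∈ s, SmoothMat U (F a)) (hy : y ∈ U) (i : Fin n) :
    pdM i (fun z => ∑ a ∈ s, F a z) y = ∑ a ∈ s, pdM i (F a) y := by
  ext c d
  simp only [pdM_apply, Matrix.sum_apply]
  exact pd_sum (fun a ha => (hF a ha).differentiableAt hU hy c d) i

/-- Jacobi's formula. -/
lemma pd_det (hU : IsOpen U) (hA : SmoothMat U A) (hy : y ∈ U) (i : Fin n) :
    pd i (fun z => (A z).det) y = ((A y).adjugate * pdM i A y).trace := by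
  have hd : ∀ a b, DifferentiableAt ℝ (fun z => A z a b) y := hA.differentiableAt hU hy
  have h1 : pd i (fun z => (A z).det) y = ∑ σ : Equiv.Perm (Fin n), ∑ k,
      ((Equiv.Perm.sign σ : ℤ) : ℝ) * (pdM i A y (σ k) k * ∏ l ∈ Finset.univ.erase k, A y (σ l) l) := by
    have hp : ∀ σ : Equiv.Perm (Fin n), DifferentiableAt ℝ (fun z => ∏ l, A z (σ l) l) y :=
      fun σ => (HasFDerivAt.finsetProd (u := Finset.univ) (g := fun l z => A z (σ l) l)
        (fun l _ => (hd (σ l) l).hasFDerivAt)).differentiableAt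
    simp only [Matrix.det_apply']
    rw [pd_sum (fun σ _ => (hp σ).const_mul _)]
    refine Finset.sum_congr rfl fun σ _ => ?_
    rw [pd_const_mul (hp σ), ← Finset.mul_sum]
    congr 1
    rw [pd, (HasFDerivAt.finsetProd (u := Finset.univ) (g := fun l z => A z (σ l) l)
      (fun l _ => (hd (σ l) l).hasFDerivAt)).fderiv]
    simp [pdM, pd, mul_comm]
  have h2 : ∀ k, ((A y).updateCol k (fun r => pdM i A y r k)).det
      = ∑ σ : Equiv.Perm (Fin n), ((Equiv.Perm.sign σ : ℤ) : ℝ) *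
        (pdM i A y (σ k) k * ∏ l ∈ Finset.univ.erase k, A y (σ l) l) := by
    intro k
    rw [Matrix.det_apply']
    refine Finset.sum_congr rfl fun σ _ => ?_
    congr 1
    rw [← Finset.mul_prod_erase _ _ (Finset.mem_univ k), Matrix.updateCol_self]
    congr 1
    exact Finset.prod_congr rfl fun l hl => Matrix.updateCol_ne (Finset.ne_of_mem_erase hl)
  rw [h1, Finset.sum_comm, Matrix.trace]
  refine Finset.sum_congr rfl fun k _ => ?_
  rw [← h2, ← Matrix.cramer_apply, Matrix.cramer_eq_adjugate_mulVec]
  rfl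

end Calculus

/-! ### The Levi-Civita connection and its curvature in coordinates -/

section LocalGeometry

open Matrix

variable {n : ℕ}

/-- A smooth Riemannian metric on the open set `U`, given by its matrix of components. -/
structure IsLocalMetric (U : Set (Coord n)) (G : MatFun n) : Prop where
  isOpen : IsOpen U
  smooth : SmoothMat U G
  posDef : ∀ y ∈ U, (G y).PosDef

/-- The connection matrices `(Γᵢ)ᵏⱼ = Γᵏᵢⱼ`. -/
def chrM (G : MatFun n) (i : Fin n) : MatFun n := fun y => Matrix.of fun k j =>
  (1 / 2) * ∑ l, (G y)⁻¹ k l *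
    (pd i (fun z => G z j l) y + pd j (fun z => G z i l) y - pd l (fun z => G z i j) y)

/-- The curvature matrices `F_{kl} = ∂ₖΓₗ - ∂ₗΓₖ + [Γₖ, Γₗ]`. -/
def curvM (G : MatFun n) (k l : Fin n) : MatFun n := fun y =>
  pdM k (chrM G l) y - pdM l (chrM G k) y + (chrM G k y * chrM G l y - chrM G l y * chrM G k y)

/-- The covariant derivative `∇ₘ F_{kl}` of the curvature as an endomorphism-valued two-form. -/
def covCurvM (G : MatFun n) (m k l : Fin n) : MatFun n := fun y =>
  pdM m (curvM G k l) y + (chrM G m y * curvM G k l y - curvM G k l y * chrM G m y)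
    - ∑ p, chrM G m y p k • curvM G p l y - ∑ p, chrM G m y p l • curvM G k p y

/-- The matrix of the Ricci tensor. -/
def ricM (G : MatFun n) : MatFun n := fun y => Matrix.of fun j l => ∑ k, curvM G k l y k j

/-- The scalar curvature. -/
def scalM (G : MatFun n) (y : Coord n) : ℝ := ((G y)⁻¹ * ricM G y).trace

/-- The covariant derivative `∇ₘ T` of a symmetric covariant two-tensor `T`. -/
def covTwo (G T : MatFun n) (m : Fin n) : MatFun n := fun y =>
  pdM m T y - (chrM G m y)ᵀ * T y - T y * chrM G m y

/-- The covariant derivative `∇ₘ A` of a field of endomorphisms `A`. -/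
def covEnd (G A : MatFun n) (m : Fin n) : MatFun n := fun y =>
  pdM m A y + (chrM G m y * A y - A y * chrM G m y)

variable {U : Set (Coord n)} {G : MatFun n} {y : Coord n}

namespace IsLocalMetric

variable (H : IsLocalMetric U G)
include H

lemma transpose_eq (hy : y ∈ U) : (G y)ᵀ = G y := by
  simpa using (H.posDef y hy).isHermitian.eq

lemma symm (hy : y ∈ U) (i j : Fin n) : G y i j = G y j i := by
  conv_lhs => rw [← H.transpose_eq hy]
  rfl

lemma det_ne_zero (hy : y ∈ U) : (G y).det ≠ 0 := (H.posDef y hy).det_pos.ne'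

lemma inv_mul (hy : y ∈ U) : (G y)⁻¹ * G y = 1 :=
  Matrix.nonsing_inv_mul _ (isUnit_iff_ne_zero.2 (H.det_ne_zero hy))

lemma mul_inv (hy : y ∈ U) : G y * (G y)⁻¹ = 1 :=
  Matrix.mul_nonsing_inv _ (isUnit_iff_ne_zero.2 (H.det_ne_zero hy))

lemma inv_transpose (hy : y ∈ U) : ((G y)⁻¹)ᵀ = (G y)⁻¹ := by
  rw [Matrix.transpose_nonsing_inv, H.transpose_eq hy]

lemma pd_symm (hy : y ∈ U) (i a b : Fin n) :
    pd i (fun z => G z a b) y = pd i (fun z => G z b a) y :=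
  pd_congr H.isOpen (fun _ hz => H.symm hz a b) hy i

lemma smooth_inv : SmoothMat U (fun y => (G y)⁻¹) :=
  H.smooth.inv fun _ hz => H.det_ne_zero hz

lemma smooth_chrM (i : Fin n) : SmoothMat U (chrM G i) := fun k j => by
  simp only [chrM, Matrix.of_apply]
  refine contDiffOn_const.mul (ContDiffOn.sum fun l _ => (H.smooth_inv k l).mul ?_)
  exact ((contDiffOn_pd H.isOpen (H.smooth _ _) _).add
    (contDiffOn_pd H.isOpen (H.smooth _ _) _)).sub (contDiffOn_pd H.isOpen (H.smooth _ _) _)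

lemma smooth_curvM (k l : Fin n) : SmoothMat U (curvM G k l) :=
  (((H.smooth_chrM l).pdM H.isOpen k).sub ((H.smooth_chrM k).pdM H.isOpen l)).add
    (((H.smooth_chrM k).mul (H.smooth_chrM l)).sub ((H.smooth_chrM l).mul (H.smooth_chrM k)))

lemma smooth_ricM : SmoothMat U (ricM G) := fun j l => by
  simp only [ricM, Matrix.of_apply]
  exact ContDiffOn.sum fun k _ => H.smooth_curvM k l k j

lemma smooth_scalM : ContDiffOn ℝ ∞ (scalM G) U := (H.smooth_inv.mul H.smooth_ricM).trace

lemma smooth_covEnd {A : MatFun n} (hA : SmoothMat U A) (m : Fin n) :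
    SmoothMat U (covEnd G A m) :=
  (hA.pdM H.isOpen m).add (((H.smooth_chrM m).mul hA).sub (hA.mul (H.smooth_chrM m)))

/-- The connection has no torsion. -/
lemma chrM_symm (hy : y ∈ U) (i j k : Fin n) : chrM G i y k j = chrM G j y k i := by
  simp only [chrM, Matrix.of_apply]
  congr 1
  refine Finset.sum_congr rfl fun l _ => ?_
  rw [H.pd_symm hy l i j]
  ring

lemma mul_chrM_apply (hy : y ∈ U) (i j l : Fin n) : (G y * chrM G i y) l j =
    (1 / 2) * (pd i (fun z => G z j l) y + pd j (fun z => G z i l) y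
      - pd l (fun z => G z i j) y) := by
  set v : Fin n → ℝ := fun l => (1 / 2) * (pd i (fun z => G z j l) y + pd j (fun z => G z i l) y
      - pd l (fun z => G z i j) y) with hv
  have h1 : ∀ k, chrM G i y k j = ((G y)⁻¹ *ᵥ v) k := by
    intro k
    simp only [chrM, Matrix.of_apply, Matrix.mulVec, dotProduct, hv, Finset.mul_sum]
    exact Finset.sum_congr rfl fun l _ => by ring
  have h2 : (G y * chrM G i y) l j = (G y *ᵥ ((G y)⁻¹ *ᵥ v)) l := by
    simp only [Matrix.mul_apply, Matrix.mulVec, dotProduct] at h1 ⊢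
    exact Finset.sum_congr rfl fun k _ => by rw [h1]
  rw [h2, Matrix.mulVec_mulVec, H.mul_inv hy, Matrix.one_mulVec]

/-- The connection is compatible with the metric. -/
lemma pdM_metric (hy : y ∈ U) (i : Fin n) :
    pdM i G y = (chrM G i y)ᵀ * G y + G y * chrM G i y := by
  have : (chrM G i y)ᵀ * G y = (G y * chrM G i y)ᵀ := by
    rw [Matrix.transpose_mul, H.transpose_eq hy]
  rw [this]
  ext a b
  rw [Matrix.add_apply, Matrix.transpose_apply, H.mul_chrM_apply hy, H.mul_chrM_apply hy,
    pdM_apply, H.pd_symm hy i b a, H.pd_symm hy b i a, H.pd_symm hy a i b]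
  ring

/-- The Levi-Civita connection is the only torsion-free connection compatible with the metric. -/
lemma eq_chrM_of_compatible (hy : y ∈ U) {C : Fin n → Matrix (Fin n) (Fin n) ℝ}
    (hs : ∀ i j k, C i k j = C j k i) (hc : ∀ i, pdM i G y = (C i)ᵀ * G y + G y * C i)
    (i : Fin n) : C i = chrM G i y := by
  have key : ∀ i a b, pd i (fun z => G z a b) y = (G y * C i) b a + (G y * C i) a b := by
    intro i a b
    rw [← pdM_apply, hc i, Matrix.add_apply,
      show (C i)ᵀ * G y = (G y * C i)ᵀ by rw [Matrix.transpose_mul, H.transpose_eq hy]]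
    rfl
  have hs' : ∀ i j l, (G y * C i) l j = (G y * C j) l i := by
    intro i j l
    simp only [Matrix.mul_apply]
    exact Finset.sum_congr rfl fun k _ => by rw [hs]
  have h1 : G y * C i = G y * chrM G i y := by
    ext l j
    rw [H.mul_chrM_apply hy, key, key, key, hs' l j i, hs' j i l, hs' i l j]
    ring
  calc C i = (G y)⁻¹ * (G y * C i) := by rw [← Matrix.mul_assoc, H.inv_mul hy, Matrix.one_mul]
    _ = _ := by rw [h1, ← Matrix.mul_assoc, H.inv_mul hy, Matrix.one_mul]

lemma pdM_inv (hy : y ∈ U) (i : Fin n) : pdM i (fun z => (G z)⁻¹) y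
    = -(chrM G i y * (G y)⁻¹ + (G y)⁻¹ * (chrM G i y)ᵀ) := by
  have h0 : pdM i (fun z => (G z)⁻¹ * G z) y = 0 := by
    rw [pdM_congr (B := fun _ => 1) H.isOpen (fun z hz => H.inv_mul hz) hy, pdM_const]
  rw [pdM_mul H.isOpen H.smooth_inv H.smooth hy, H.pdM_metric hy] at h0
  have h1 := congrArg (· * (G y)⁻¹) h0
  simp only [Matrix.add_mul, Matrix.mul_assoc, Matrix.mul_add, H.mul_inv hy, Matrix.mul_one,
    Matrix.zero_mul] at h1
  rw [← Matrix.mul_assoc (G y)⁻¹ (G y), H.inv_mul hy, Matrix.one_mul] at h1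
  rw [eq_neg_iff_add_eq_zero, ← h1]
  abel

/-- The curvature matrices are skew-symmetric with respect to the metric. -/
lemma curvM_skew (hy : y ∈ U) (k l : Fin n) :
    (curvM G k l y)ᵀ * G y + G y * curvM G k l y = 0 := by
  have key : ∀ k l, pdM k (pdM l G) y = (pdM k (chrM G l) y)ᵀ * G y
      + (chrM G l y)ᵀ * ((chrM G k y)ᵀ * G y + G y * chrM G k y)
      + (((chrM G k y)ᵀ * G y + G y * chrM G k y) * chrM G l y + G y * pdM k (chrM G l) y) := by
    intro k l
    rw [pdM_congr H.isOpen (fun z hz => H.pdM_metric hz l) hy,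
      pdM_add H.isOpen ((H.smooth_chrM l).transpose.mul H.smooth) (H.smooth.mul (H.smooth_chrM l))
        hy, pdM_mul H.isOpen (H.smooth_chrM l).transpose H.smooth hy,
      pdM_mul H.isOpen H.smooth (H.smooth_chrM l) hy, H.pdM_metric hy, pdM_transpose]
  have h := pdM_comm H.isOpen H.smooth hy k l
  rw [key, key, ← sub_eq_zero] at h
  rw [← h]
  simp only [curvM, Matrix.transpose_add, Matrix.transpose_sub, Matrix.transpose_mul]
  noncomm_ring

omit H in
lemma curvM_swap (k l : Fin n) : curvM G l k y = -curvM G k l y := by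
  simp only [curvM]; abel

/-- The first Bianchi identity. -/
lemma bianchi_one (hy : y ∈ U) (i j k l : Fin n) :
    curvM G k l y i j + curvM G l j y i k + curvM G j k y i l = 0 := by
  have h1 : ∀ k l j, pdM k (chrM G l) y i j = pdM k (chrM G j) y i l := fun k l j =>
    pd_congr H.isOpen (fun z hz => H.chrM_symm hz l j i) hy k
  have h2 : ∀ k l j, (chrM G k y * chrM G l y) i j = (chrM G k y * chrM G j y) i l := by
    intro k l j
    simp only [Matrix.mul_apply]
    exact Finset.sum_congr rfl fun p _ => by rw [H.chrM_symm hy l j p]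
  simp only [curvM, Matrix.add_apply, Matrix.sub_apply]
  rw [h1 k l j, h1 l k j, h1 j k l, h2 k l j, h2 l k j, h2 j k l]
  ring

/-- The second Bianchi identity. -/
lemma bianchi_two (hy : y ∈ U) (m k l : Fin n) :
    covCurvM G m k l y + covCurvM G k l m y + covCurvM G l m k y = 0 := by
  have key : ∀ m k l, pdM m (curvM G k l) y = pdM m (pdM k (chrM G l)) y
      - pdM m (pdM l (chrM G k)) y + ((pdM m (chrM G k) y * chrM G l y
        + chrM G k y * pdM m (chrM G l) y) - (pdM m (chrM G l) y * chrM G k y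
        + chrM G l y * pdM m (chrM G k) y)) := by
    intro m k l
    have s := H.smooth_chrM
    have e : pdM m (curvM G k l) y = pdM m (fun z => (pdM k (chrM G l) z - pdM l (chrM G k) z)
      + (chrM G k z * chrM G l z - chrM G l z * chrM G k z)) y := rfl
    rw [e, pdM_add H.isOpen (((s l).pdM H.isOpen k).sub ((s k).pdM H.isOpen l))
        (((s k).mul (s l)).sub ((s l).mul (s k))) hy,
      pdM_sub H.isOpen ((s l).pdM H.isOpen k) ((s k).pdM H.isOpen l) hy,
      pdM_sub H.isOpen ((s k).mul (s l)) ((s l).mul (s k)) hy,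
      pdM_mul H.isOpen (s k) (s l) hy, pdM_mul H.isOpen (s l) (s k) hy]
  have c1 : ∀ m k l, ∑ p, chrM G m y p l • curvM G k p y
      = -∑ p, chrM G l y p m • curvM G p k y := by
    intro m k l
    rw [← Finset.sum_neg_distrib]
    refine Finset.sum_congr rfl fun p _ => ?_
    rw [curvM_swap p k, smul_neg, H.chrM_symm hy m l p]
  simp only [covCurvM]
  rw [key, key, key, c1 m k l, c1 k l m, c1 l m k, pdM_comm H.isOpen (H.smooth_chrM l) hy m k,
    pdM_comm H.isOpen (H.smooth_chrM m) hy k l, pdM_comm H.isOpen (H.smooth_chrM k) hy m l]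
  simp only [curvM]
  noncomm_ring

end IsLocalMetric

end LocalGeometry

/-! ### Harmonic curvature: the Codazzi equation and the Bochner formula -/

section Bochner

open Matrix

variable {n : ℕ}

/-- The Laplacian `g^{ij} (∂ᵢ∂ⱼf - Γᵏᵢⱼ ∂ₖf)`. -/
def lap (G : MatFun n) (f : Coord n → ℝ) (y : Coord n) : ℝ :=
  ∑ i, ∑ j, (G y)⁻¹ i j * (pd i (pd j f) y - ∑ p, chrM G i y p j * pd p f y)

/-- The traceless Ricci endomorphism `g^{ik} R_{kj} - (R / n) δⁱⱼ`. -/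
def tfRicEnd (G : MatFun n) : MatFun n := fun y =>
  (G y)⁻¹ * ricM G y - (scalM G y / n) • (1 : Matrix (Fin n) (Fin n) ℝ)

/-- The second covariant derivative `∇ᵢ∇ⱼ A` of a field of endomorphisms. -/
def covEndTwo (G A : MatFun n) (i j : Fin n) : MatFun n := fun y =>
  covEnd G (covEnd G A j) i y - ∑ p, chrM G i y p j • covEnd G A p y

variable {U : Set (Coord n)} {G : MatFun n} {y : Coord n}

/-- Harmonic curvature in coordinates, `∇_m F_{kl}{}^m{}_j = 0`. -/
def IsHarmonicOn (U : Set (Coord n)) (G : MatFun n) : Prop :=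
  ∀ y ∈ U, ∀ j k l, ∑ m, covCurvM G m k l y m j = 0

namespace IsLocalMetric

variable (H : IsLocalMetric U G)
include H

lemma curvM_trace (hy : y ∈ U) (k l : Fin n) : (curvM G k l y).trace = 0 := by
  have h := congrArg (fun X => ((G y)⁻¹ * X).trace) (H.curvM_skew hy k l)
  simp only [Matrix.mul_add, Matrix.trace_add, Matrix.mul_zero, Matrix.trace_zero] at h
  rw [← Matrix.mul_assoc _ (G y), H.inv_mul hy, Matrix.one_mul, ← Matrix.mul_assoc,
    Matrix.trace_mul_comm, ← Matrix.mul_assoc, H.mul_inv hy, Matrix.one_mul,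
    Matrix.trace_transpose] at h
  linarith

lemma ricM_symm (hy : y ∈ U) (j l : Fin n) : ricM G y j l = ricM G y l j := by
  have h : ∑ k, (curvM G k l y k j + curvM G l j y k k + curvM G j k y k l) = 0 :=
    Finset.sum_eq_zero fun k _ => H.bianchi_one hy k j k l
  have h2 : ∑ k, curvM G l j y k k = 0 := H.curvM_trace hy l j
  have h3 : ∀ k, curvM G j k y k l = -curvM G k j y k l := fun k => by
    rw [curvM_swap k j]; rfl
  simp only [h3, Finset.sum_add_distrib, h2, Finset.sum_neg_distrib] at h
  simp only [ricM, Matrix.of_apply]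
  linarith

lemma ricM_transpose (hy : y ∈ U) : (ricM G y)ᵀ = ricM G y := by
  ext a b; exact H.ricM_symm hy b a

lemma covTwo_symm {T : MatFun n} (hT : ∀ z ∈ U, (T z)ᵀ = T z) (hy : y ∈ U) (m : Fin n) :
    (covTwo G T m y)ᵀ = covTwo G T m y := by
  have h1 : (pdM m T y)ᵀ = pdM m T y := by
    rw [← pdM_transpose, pdM_congr H.isOpen hT hy]
  simp only [covTwo, Matrix.transpose_sub, Matrix.transpose_mul, Matrix.transpose_transpose,
    hT y hy, h1]
  abel

omit H in
lemma covCurvM_swap (m k l : Fin n) : covCurvM G m l k y = -covCurvM G m k l y := by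
  have h : pdM m (curvM G l k) y = -pdM m (curvM G k l) y := by
    ext a b
    have : (fun z => curvM G l k z a b) = fun z => -curvM G k l z a b := by
      funext z; rw [curvM_swap k l]; rfl
    simp [pdM_apply, this, pd, fderiv_fun_neg]
  have h2 : ∀ a b : Fin n, ∑ p, chrM G m y p a • curvM G p b y
      = -∑ p, chrM G m y p a • curvM G b p y := by
    intro a b
    rw [← Finset.sum_neg_distrib]
    exact Finset.sum_congr rfl fun p _ => by rw [curvM_swap b p, smul_neg]
  simp only [covCurvM]
  rw [h, curvM_swap k l, h2 l k, h2 k l]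
  noncomm_ring

/-- Contracting the covariant derivative of the curvature gives that of the Ricci tensor, since the
connection terms of the contracted pair of indices cancel. -/
lemma covTwo_ricM (hy : y ∈ U) (m j l : Fin n) :
    covTwo G (ricM G) m y j l = ∑ k, covCurvM G m k l y k j := by
  have h1 : pd m (fun z => ricM G z j l) y = ∑ k, pdM m (curvM G k l) y k j :=
    pd_sum (s := Finset.univ) (F := fun k z => curvM G k l z k j) (fun k _ => (H.smooth_curvM k l).differentiableAt H.isOpen hy k j) m
  simp only [covTwo, covCurvM, Matrix.sub_apply, Matrix.add_apply, Matrix.sum_apply,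
    Matrix.smul_apply, smul_eq_mul, Finset.sum_sub_distrib, Finset.sum_add_distrib, pdM_apply,
    Matrix.mul_apply, Matrix.transpose_apply] at h1 ⊢
  rw [h1]
  have e1 : ∑ k, ∑ q, chrM G m y k q * curvM G k l y q j = ∑ k, ∑ q, chrM G m y q k * curvM G q l y k j :=
    Finset.sum_comm
  have e2 : ∑ q, chrM G m y q j * ricM G y q l = ∑ k, ∑ q, curvM G k l y k q * chrM G m y q j := by
    rw [Finset.sum_comm]
    refine Finset.sum_congr rfl fun q _ => ?_
    simp only [ricM, Matrix.of_apply, Finset.mul_sum]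
    exact Finset.sum_congr rfl fun k _ => mul_comm _ _
  have e3 : ∑ q, ricM G y j q * chrM G m y q l = ∑ k, ∑ q, chrM G m y q l * curvM G k q y k j := by
    rw [Finset.sum_comm]
    refine Finset.sum_congr rfl fun q _ => ?_
    simp only [ricM, Matrix.of_apply, Finset.sum_mul]
    exact Finset.sum_congr rfl fun k _ => mul_comm _ _
  have e4 : ∑ k, ∑ q, chrM G m y k q * curvM G k l y q j
      = ∑ k, ∑ q, chrM G m y q k * curvM G q l y k j := e1
  rw [e2, e3, e4]
  ring

/-- For harmonic curvature the Ricci tensor satisfies the Codazzi equation. -/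
lemma codazzi (hH : IsHarmonicOn U G) (hy : y ∈ U) (j k l : Fin n) :
    covTwo G (ricM G) l y j k = covTwo G (ricM G) k y j l := by
  have h : ∑ m, (covCurvM G m k l y m j + covCurvM G k l m y m j + covCurvM G l m k y m j) = 0 :=
    Finset.sum_eq_zero fun m _ => by
      rw [← Matrix.add_apply, ← Matrix.add_apply, H.bianchi_two hy]; rfl
  have h3 : ∀ m, covCurvM G k l m y m j = -covCurvM G k m l y m j := fun m => by
    rw [covCurvM_swap k m l]; rfl
  simp only [h3, Finset.sum_add_distrib, hH y hy, Finset.sum_neg_distrib] at h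
  rw [H.covTwo_ricM hy, H.covTwo_ricM hy]
  linarith

lemma covCurvM_skew (hy : y ∈ U) (m k l : Fin n) :
    (covCurvM G m k l y)ᵀ * G y + G y * covCurvM G m k l y = 0 := by
  have s := H.smooth_curvM k l
  have h0 : pdM m (fun z => (curvM G k l z)ᵀ * G z + G z * curvM G k l z) y = 0 := by
    rw [pdM_congr (B := fun _ => 0) H.isOpen (fun z hz => H.curvM_skew hz k l) hy, pdM_const]
  rw [pdM_add H.isOpen (s.transpose.mul H.smooth) (H.smooth.mul s) hy,
    pdM_mul H.isOpen s.transpose H.smooth hy, pdM_mul H.isOpen H.smooth s hy, H.pdM_metric hy,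
    pdM_transpose] at h0
  have h1 : ∀ k l, (curvM G k l y)ᵀ * G y = -(G y * curvM G k l y) := fun k l =>
    eq_neg_of_add_eq_zero_left (H.curvM_skew hy k l)
  have hsum : ∀ (F : Fin n → Matrix (Fin n) (Fin n) ℝ), (∀ p, (F p)ᵀ * G y + G y * F p = 0) →
      ∀ c : Fin n → ℝ, (∑ p, c p • F p)ᵀ * G y + G y * ∑ p, c p • F p = 0 := by
    intro F hF c
    rw [Matrix.transpose_sum, Finset.sum_mul, Finset.mul_sum, ← Finset.sum_add_distrib]
    refine Finset.sum_eq_zero fun p _ => ?_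
    rw [Matrix.transpose_smul, Matrix.smul_mul, Matrix.mul_smul, ← smul_add, hF, smul_zero]
  have s1 := hsum (fun p => curvM G p l y) (fun p => H.curvM_skew hy p l)
    (fun p => chrM G m y p k)
  have s2 := hsum (fun p => curvM G k p y) (fun p => H.curvM_skew hy k p)
    (fun p => chrM G m y p l)
  have main : (pdM m (curvM G k l) y + (chrM G m y * curvM G k l y
      - curvM G k l y * chrM G m y))ᵀ * G y + G y * (pdM m (curvM G k l) y
      + (chrM G m y * curvM G k l y - curvM G k l y * chrM G m y)) = 0 := by
    rw [← h0]
    simp only [Matrix.transpose_add, Matrix.transpose_sub, Matrix.transpose_mul]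
    have e1 : (curvM G k l y)ᵀ * (G y * chrM G m y) = -(G y * curvM G k l y * chrM G m y) := by
      rw [← Matrix.mul_assoc, h1]; noncomm_ring
    have e2 : (chrM G m y)ᵀ * (curvM G k l y)ᵀ * G y
        = -((chrM G m y)ᵀ * G y * curvM G k l y) := by
      rw [Matrix.mul_assoc, h1]; noncomm_ring
    simp only [Matrix.mul_add, Matrix.add_mul, Matrix.mul_sub, Matrix.sub_mul, e1, e2]
    noncomm_ring
  simp only [covCurvM, Matrix.transpose_sub, Matrix.sub_mul, Matrix.mul_sub] at main s1 s2 ⊢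
  have : ∀ a b c a' b' c' : Matrix (Fin n) (Fin n) ℝ, a + a' = 0 → b + b' = 0 → c + c' = 0 →
      (a - b - c) + (a' - b' - c') = 0 := by
    intro a b c a' b' c' h1 h2 h3
    rw [show (a - b - c) + (a' - b' - c') = (a + a') - (b + b') - (c + c') by abel, h1, h2, h3]
    simp
  exact this _ _ _ _ _ _ main s1 s2

/-- For harmonic curvature the Ricci tensor has no divergence: contract the harmonicity
equation once more and use the skew-symmetries of the curvature. -/
lemma div_ricM (hH : IsHarmonicOn U G) (hy : y ∈ U) (k : Fin n) :
    ∑ m, ∑ j, (G y)⁻¹ j m * covTwo G (ricM G) m y j k = 0 := by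
  have hsk : ∀ m l, (covCurvM G m k l y * (G y)⁻¹)ᵀ = -(covCurvM G m k l y * (G y)⁻¹) := by
    intro m l
    have h := congrArg (fun X => (G y)⁻¹ * X * (G y)⁻¹) (H.covCurvM_skew hy m k l)
    simp only [Matrix.mul_add, Matrix.add_mul, Matrix.mul_zero, Matrix.zero_mul] at h
    rw [← Matrix.mul_assoc _ (G y), H.inv_mul hy, Matrix.one_mul, ← Matrix.mul_assoc,
      Matrix.mul_assoc _ (G y), H.mul_inv hy, Matrix.mul_one] at h
    rw [Matrix.transpose_mul, H.inv_transpose hy]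
    exact eq_neg_of_add_eq_zero_left h
  have h0 : ∑ m, ∑ l, (covCurvM G m k l y * (G y)⁻¹) m l = 0 := by
    simp only [Matrix.mul_apply]
    have : ∑ l, ∑ j, (∑ m, covCurvM G m k l y m j) * (G y)⁻¹ j l = 0 := by
      simp [hH y hy]
    rw [← this]
    simp only [Finset.sum_mul]
    rw [Finset.sum_comm]
    exact Finset.sum_congr rfl fun l _ => Finset.sum_comm
  have h1 : ∀ m l, (covCurvM G m k l y * (G y)⁻¹) m l
      = ∑ j, (G y)⁻¹ j m * covCurvM G m l k y l j := by
    intro m l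
    have := congrFun (congrFun (hsk m l) l) m
    rw [Matrix.transpose_apply, Matrix.neg_apply] at this
    rw [this, Matrix.mul_apply, ← Finset.sum_neg_distrib]
    refine Finset.sum_congr rfl fun j _ => ?_
    rw [covCurvM_swap m k l, Matrix.neg_apply]
    ring
  simp only [h1] at h0
  rw [← h0]
  refine Finset.sum_congr rfl fun m _ => ?_
  rw [Finset.sum_comm]
  exact Finset.sum_congr rfl fun j _ => by rw [H.covTwo_ricM hy, Finset.mul_sum]

lemma pd_scalM (hy : y ∈ U) (k : Fin n) :
    pd k (scalM G) y = ((G y)⁻¹ * covTwo G (ricM G) k y).trace := by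
  have e : pd k (scalM G) y = pd k (fun z => ((G z)⁻¹ * ricM G z).trace) y := rfl
  rw [e, pd_trace H.isOpen (H.smooth_inv.mul H.smooth_ricM) hy,
    pdM_mul H.isOpen H.smooth_inv H.smooth_ricM hy, H.pdM_inv hy]
  simp only [covTwo, Matrix.mul_sub, Matrix.neg_mul, Matrix.add_mul, Matrix.trace_add,
    Matrix.trace_sub, Matrix.trace_neg]
  rw [Matrix.mul_assoc (chrM G k y), Matrix.trace_mul_comm (chrM G k y)]
  simp only [Matrix.mul_assoc]
  ring

/-- Harmonic curvature forces the scalar curvature to be locally constant. -/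
lemma pd_scalM_eq_zero (hH : IsHarmonicOn U G) (hy : y ∈ U) (k : Fin n) :
    pd k (scalM G) y = 0 := by
  rw [H.pd_scalM hy, ← H.div_ricM hH hy k, Matrix.trace]
  refine Finset.sum_congr rfl fun m _ => ?_
  rw [Matrix.diag_apply, Matrix.mul_apply]
  refine Finset.sum_congr rfl fun j _ => ?_
  have h1 : (G y)⁻¹ m j = (G y)⁻¹ j m := congrFun (congrFun (H.inv_transpose hy) j) m
  rw [h1, H.codazzi hH hy]

lemma smooth_tfRicEnd : SmoothMat U (tfRicEnd G) :=
  (H.smooth_inv.mul H.smooth_ricM).sub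
    (SmoothMat.smul (H.smooth_scalM.div_const _) (SmoothMat.const 1))

lemma mul_covEnd_tfRicEnd (hH : IsHarmonicOn U G) (hy : y ∈ U) (m : Fin n) :
    G y * covEnd G (tfRicEnd G) m y = covTwo G (ricM G) m y := by
  have e : pdM m (tfRicEnd G) y = pdM m (fun z => (G z)⁻¹ * ricM G z
      - (scalM G z / n) • (1 : Matrix (Fin n) (Fin n) ℝ)) y := rfl
  have hs : ContDiffOn ℝ ∞ (fun z => scalM G z / n) U := H.smooth_scalM.div_const _
  have h0 : pd m (fun z => scalM G z / n) y = 0 := by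
    have : (fun z => scalM G z / n) = fun z => (n : ℝ)⁻¹ * scalM G z := by
      funext z; rw [div_eq_inv_mul]
    rw [this, pd_const_mul (differentiableAt_of_contDiffOn H.isOpen H.smooth_scalM hy),
      H.pd_scalM_eq_zero hH hy, mul_zero]
  rw [covEnd, e, pdM_sub H.isOpen (H.smooth_inv.mul H.smooth_ricM) (SmoothMat.smul hs
      (SmoothMat.const 1)) hy, pdM_mul H.isOpen H.smooth_inv H.smooth_ricM hy, H.pdM_inv hy,
    pdM_smul H.isOpen hs (SmoothMat.const 1) hy, h0, pdM_const]
  simp only [tfRicEnd, covTwo, zero_smul, smul_zero, Matrix.mul_sub, Matrix.sub_mul,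
    Matrix.mul_smul, Matrix.smul_mul, Matrix.mul_one, Matrix.one_mul, Matrix.neg_mul,
    Matrix.add_mul, Matrix.mul_add, Matrix.mul_neg, add_zero]
  have c : ∀ X : Matrix (Fin n) (Fin n) ℝ, G y * ((G y)⁻¹ * X) = X := fun X => by
    rw [← Matrix.mul_assoc, H.mul_inv hy, Matrix.one_mul]
  simp only [Matrix.mul_assoc, c, Matrix.mul_zero]
  abel

/-- The Ricci identity for fields of endomorphisms. -/
lemma covEndTwo_sub_swap {A : MatFun n} (hA : SmoothMat U A) (hy : y ∈ U) (i j : Fin n) :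
    covEndTwo G A i j y - covEndTwo G A j i y
      = curvM G i j y * A y - A y * curvM G i j y := by
  have s := H.smooth_chrM
  have key : ∀ i j, pdM i (covEnd G A j) y = pdM i (pdM j A) y
      + ((pdM i (chrM G j) y * A y + chrM G j y * pdM i A y)
        - (pdM i A y * chrM G j y + A y * pdM i (chrM G j) y)) := by
    intro i j
    have e : pdM i (covEnd G A j) y = pdM i (fun z => pdM j A z
      + (chrM G j z * A z - A z * chrM G j z)) y := rfl
    rw [e, pdM_add H.isOpen (hA.pdM H.isOpen j) (((s j).mul hA).sub (hA.mul (s j))) hy,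
      pdM_sub H.isOpen ((s j).mul hA) (hA.mul (s j)) hy, pdM_mul H.isOpen (s j) hA hy,
      pdM_mul H.isOpen hA (s j) hy]
  have hsum : ∑ p, chrM G j y p i • covEnd G A p y = ∑ p, chrM G i y p j • covEnd G A p y :=
    Finset.sum_congr rfl fun p _ => by rw [H.chrM_symm hy]
  have e : ∀ i j, covEnd G (covEnd G A j) i y = pdM i (covEnd G A j) y
      + (chrM G i y * covEnd G A j y - covEnd G A j y * chrM G i y) := fun _ _ => rfl
  simp only [covEndTwo]
  rw [hsum, e, e, key, key, pdM_comm H.isOpen hA hy j i]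
  simp only [covEnd, curvM]
  noncomm_ring

/-- The second covariant derivative of a Codazzi tensor is symmetric in its middle indices. -/
lemma mul_covEndTwo_symm {A : MatFun n} (hA : SmoothMat U A)
    (hC : ∀ z ∈ U, ∀ j k l, (G z * covEnd G A j z) k l = (G z * covEnd G A k z) j l)
    (hy : y ∈ U) (i j k l : Fin n) :
    (G y * covEndTwo G A i j y) k l = (G y * covEndTwo G A i k y) j l := by
  set T : Fin n → MatFun n := fun j z => G z * covEnd G A j z with hT
  have key : ∀ j k, (G y * covEndTwo G A i j y) k l = pd i (fun z => T j z k l) y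
      - ∑ p, chrM G i y p k * T j y p l - ∑ p, T j y k p * chrM G i y p l
      - ∑ p, chrM G i y p j * T p y k l := by
    intro j k
    have h1 : pdM i (T j) y = ((chrM G i y)ᵀ * G y + G y * chrM G i y) * covEnd G A j y
        + G y * pdM i (covEnd G A j) y := by
      rw [hT]
      simp only
      rw [pdM_mul H.isOpen H.smooth (H.smooth_covEnd hA j) hy, H.pdM_metric hy]
    have h2 : G y * covEndTwo G A i j y = pdM i (T j) y - (chrM G i y)ᵀ * T j y
        - T j y * chrM G i y - ∑ p, chrM G i y p j • T p y := by
      rw [h1]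
      have e : covEnd G (covEnd G A j) i y = pdM i (covEnd G A j) y
        + (chrM G i y * covEnd G A j y - covEnd G A j y * chrM G i y) := rfl
      simp only [covEndTwo, e, hT, Matrix.mul_sub, Finset.mul_sum, Matrix.mul_smul]
      noncomm_ring
    rw [h2]
    simp only [Matrix.sub_apply, Matrix.sum_apply, Matrix.smul_apply, smul_eq_mul,
      Matrix.mul_apply, Matrix.transpose_apply, pdM_apply]
  have hTs : ∀ z ∈ U, ∀ j k l, T j z k l = T k z j l := hC
  rw [key, key, pd_congr H.isOpen (fun z hz => hTs z hz j k l) hy]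
  have e1 : ∑ p, chrM G i y p k * T j y p l = ∑ p, chrM G i y p k * T p y j l :=
    Finset.sum_congr rfl fun p _ => by rw [hTs y hy]
  have e2 : ∑ p, chrM G i y p j * T p y k l = ∑ p, chrM G i y p j * T k y p l :=
    Finset.sum_congr rfl fun p _ => by rw [hTs y hy]
  have e3 : ∑ p, T j y k p * chrM G i y p l = ∑ p, T k y j p * chrM G i y p l :=
    Finset.sum_congr rfl fun p _ => by rw [hTs y hy]
  rw [e1, e2, e3]
  ring

end IsLocalMetric

end Bochner

section BochnerFormula

open Matrix

variable {n : ℕ} {U : Set (Coord n)} {G : MatFun n} {y : Coord n}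

namespace IsLocalMetric

variable (H : IsLocalMetric U G)
include H

/-- A contraction commutes with the covariant derivative, so that `∇ₖ div A = 0` if `div A = 0`. -/
lemma sum_covEndTwo_eq_zero {A : MatFun n} (hA : SmoothMat U A)
    (hD : ∀ z ∈ U, ∀ l, ∑ i, covEnd G A i z i l = 0) (hy : y ∈ U) (k l : Fin n) :
    ∑ i, covEndTwo G A k i y i l = 0 := by
  have h1 : ∑ i, pdM k (covEnd G A i) y i l = 0 := by
    have := pd_sum (s := Finset.univ) (F := fun i z => covEnd G A i z i l)
      (fun i _ => (H.smooth_covEnd hA i).differentiableAt H.isOpen hy i l) k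
    rw [pd_eq_zero_of_const (c := 0) H.isOpen (fun z hz => hD z hz l) hy] at this
    exact this.symm
  have e1 : ∑ i, ∑ q, covEnd G A i y i q * chrM G k y q l = 0 := by
    rw [Finset.sum_comm]
    refine Finset.sum_eq_zero fun q _ => ?_
    rw [← Finset.sum_mul, hD y hy, zero_mul]
  have h2 : ∀ i, covEnd G (covEnd G A i) k y = pdM k (covEnd G A i) y
      + (chrM G k y * covEnd G A i y - covEnd G A i y * chrM G k y) := fun _ => rfl
  simp only [covEndTwo, h2, Matrix.sub_apply, Matrix.add_apply, Matrix.sum_apply,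
    Matrix.smul_apply, smul_eq_mul, Matrix.mul_apply, Finset.sum_sub_distrib,
    Finset.sum_add_distrib, h1, e1]
  have e4 : ∑ i, ∑ p, chrM G k y p i * covEnd G A p y i l
      = ∑ i, ∑ q, chrM G k y i q * covEnd G A i y q l := Finset.sum_comm
  rw [e4]
  ring

/-- The Weitzenböck formula for a divergence-free Codazzi tensor: its rough Laplacian is a
curvature term of order zero. -/
lemma sum_inv_mul_covEndTwo {A : MatFun n} (hA : SmoothMat U A)
    (hC : ∀ z ∈ U, ∀ j k l, (G z * covEnd G A j z) k l = (G z * covEnd G A k z) j l)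
    (hD : ∀ z ∈ U, ∀ l, ∑ i, covEnd G A i z i l = 0) (hy : y ∈ U) (k l : Fin n) :
    ∑ i, ∑ j, (G y)⁻¹ i j * (G y * covEndTwo G A i j y) k l
      = (ricM G y * A y) k l - ∑ i, ∑ p, A y i p * curvM G i k y p l := by
  have h1 : ∀ i, ∑ j, (G y)⁻¹ i j * (G y * covEndTwo G A i j y) k l = covEndTwo G A i k y i l := by
    intro i
    have : covEndTwo G A i k y = (G y)⁻¹ * (G y * covEndTwo G A i k y) := by
      rw [← Matrix.mul_assoc, H.inv_mul hy, Matrix.one_mul]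
    rw [this, Matrix.mul_apply]
    exact Finset.sum_congr rfl fun j _ => by rw [H.mul_covEndTwo_symm hA hC hy i j k l]
  have h2 : ∀ i, covEndTwo G A i k y i l = covEndTwo G A k i y i l
      + ((curvM G i k y * A y) i l - (A y * curvM G i k y) i l) := by
    intro i
    rw [← Matrix.sub_apply, ← H.covEndTwo_sub_swap hA hy i k, Matrix.sub_apply]
    ring
  simp only [h1]
  simp only [h2, Finset.sum_add_distrib, Finset.sum_sub_distrib, H.sum_covEndTwo_eq_zero hA hD hy,
    Matrix.mul_apply, zero_add]
  congr 1
  rw [Finset.sum_comm]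
  refine Finset.sum_congr rfl fun p _ => ?_
  rw [H.ricM_symm hy k p]
  simp only [ricM, Matrix.of_apply, Finset.sum_mul]

omit H in
lemma trace_mul_comm_bracket (A C X : Matrix (Fin n) (Fin n) ℝ) :
    (A * (C * X - X * C)).trace + ((C * A - A * C) * X).trace = 0 := by
  simp only [Matrix.mul_sub, Matrix.sub_mul, Matrix.trace_sub]
  rw [← Matrix.mul_assoc, ← Matrix.mul_assoc A X C, Matrix.trace_mul_comm (A * X) C,
    ← Matrix.mul_assoc]
  ring

/-- Differentiating a trace pairing by the product rule for covariant derivatives. -/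
lemma pd_trace_mul {A B : MatFun n} (hA : SmoothMat U A) (hB : SmoothMat U B) (hy : y ∈ U)
    (i : Fin n) : pd i (fun z => (A z * B z).trace) y
      = (covEnd G A i y * B y).trace + (A y * covEnd G B i y).trace := by
  rw [pd_trace H.isOpen (hA.mul hB) hy, pdM_mul H.isOpen hA hB hy]
  have h := trace_mul_comm_bracket (A y) (chrM G i y) (B y)
  simp only [covEnd, Matrix.add_mul, Matrix.mul_add, Matrix.trace_add]
  linarith

lemma pd_trace_sq {A : MatFun n} (hA : SmoothMat U A) (hy : y ∈ U) (i : Fin n) :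
    pd i (fun z => (A z * A z).trace) y = 2 * (A y * covEnd G A i y).trace := by
  rw [H.pd_trace_mul hA hA hy, Matrix.trace_mul_comm]; ring

/-- The Bochner formula for the squared norm of a field of endomorphisms. -/
lemma lap_trace_sq {A : MatFun n} (hA : SmoothMat U A) (hy : y ∈ U) :
    lap G (fun z => (A z * A z).trace) y
      = 2 * ∑ i, ∑ j, (G y)⁻¹ i j * (covEnd G A i y * covEnd G A j y).trace
        + 2 * ∑ i, ∑ j, (G y)⁻¹ i j * (A y * covEndTwo G A i j y).trace := by
  have h1 : ∀ i j, pd i (pd j (fun z => (A z * A z).trace)) y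
      = 2 * ((covEnd G A i y * covEnd G A j y).trace
        + (A y * covEnd G (covEnd G A j) i y).trace) := by
    intro i j
    rw [pd_congr H.isOpen (fun z hz => H.pd_trace_sq hA hz j) hy,
      pd_const_mul (differentiableAt_of_contDiffOn H.isOpen
        (hA.mul (H.smooth_covEnd hA j)).trace hy), H.pd_trace_mul hA (H.smooth_covEnd hA j) hy]
  simp only [lap, h1, H.pd_trace_sq hA hy, Finset.mul_sum, ← Finset.sum_add_distrib]
  refine Finset.sum_congr rfl fun i _ => Finset.sum_congr rfl fun j _ => ?_
  simp only [covEndTwo, Matrix.mul_sub, Finset.mul_sum, Matrix.mul_smul, Matrix.trace_sub,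
    Matrix.trace_sum, Matrix.trace_smul, smul_eq_mul]
  have : ∑ p, chrM G i y p j * (2 * (A y * covEnd G A p y).trace)
      = 2 * ∑ p, chrM G i y p j * (A y * covEnd G A p y).trace := by
    rw [Finset.mul_sum]; exact Finset.sum_congr rfl fun p _ => by ring
  rw [this]
  ring

/-- The Bochner formula for `|E|²` under harmonic curvature: `E` is then a divergence-free Codazzi
tensor, so that its rough Laplacian is algebraic in `E` and the curvature. -/
lemma lap_normSq_tfRic (hH : IsHarmonicOn U G) (hy : y ∈ U) :
    lap G (fun z => (tfRicEnd G z * tfRicEnd G z).trace) y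
      = 2 * ∑ i, ∑ j, (G y)⁻¹ i j * (((G y)⁻¹ * covTwo G (ricM G) i y)
          * ((G y)⁻¹ * covTwo G (ricM G) j y)).trace
        + 2 * ((tfRicEnd G y * (G y)⁻¹ * (ricM G y * tfRicEnd G y)).trace
          - ∑ k, ∑ l, (tfRicEnd G y * (G y)⁻¹) l k *
            ∑ i, ∑ p, tfRicEnd G y i p * curvM G i k y p l) := by
  have hA := H.smooth_tfRicEnd
  have hC : ∀ z ∈ U, ∀ j k l, (G z * covEnd G (tfRicEnd G) j z) k l
      = (G z * covEnd G (tfRicEnd G) k z) j l := by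
    intro z hz j k l
    have hs : ∀ m a b, covTwo G (ricM G) m z a b = covTwo G (ricM G) m z b a := fun m a b =>
      congrFun (congrFun (H.covTwo_symm (fun w hw => H.ricM_transpose hw) hz m) b) a
    rw [H.mul_covEnd_tfRicEnd hH hz, H.mul_covEnd_tfRicEnd hH hz, hs j k l, hs k j l,
      H.codazzi hH hz]
  have hB : ∀ z ∈ U, ∀ m, covEnd G (tfRicEnd G) m z = (G z)⁻¹ * covTwo G (ricM G) m z := by
    intro z hz m
    rw [← H.mul_covEnd_tfRicEnd hH hz, ← Matrix.mul_assoc, H.inv_mul hz, Matrix.one_mul]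
  have hD : ∀ z ∈ U, ∀ l, ∑ i, covEnd G (tfRicEnd G) i z i l = 0 := by
    intro z hz l
    rw [← H.div_ricM hH hz l]
    refine Finset.sum_congr rfl fun i _ => ?_
    rw [hB z hz, Matrix.mul_apply]
    refine Finset.sum_congr rfl fun j _ => ?_
    rw [show (G z)⁻¹ i j = (G z)⁻¹ j i from congrFun (congrFun (H.inv_transpose hz) j) i]
  rw [H.lap_trace_sq hA hy]
  simp only [hB y hy]
  congr 2
  set A := tfRicEnd G y
  have h1 : ∀ i j, (A * covEndTwo G (tfRicEnd G) i j y).trace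
      = (A * (G y)⁻¹ * (G y * covEndTwo G (tfRicEnd G) i j y)).trace := by
    intro i j
    rw [Matrix.mul_assoc A, ← Matrix.mul_assoc (G y)⁻¹, H.inv_mul hy, Matrix.one_mul]
  have h2 : ∀ X Y : Matrix (Fin n) (Fin n) ℝ, (X * Y).trace = ∑ k, ∑ l, X l k * Y k l := by
    intro X Y
    rw [Finset.sum_comm]
    simp [Matrix.trace, Matrix.mul_apply]
  simp only [h1]
  rw [h2 _ (ricM G y * A), ← Finset.sum_sub_distrib]
  simp only [← Finset.sum_sub_distrib, ← mul_sub]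
  have h3 : ∀ k l, (ricM G y * A) k l - ∑ i, ∑ p, A i p * curvM G i k y p l
      = ∑ i, ∑ j, (G y)⁻¹ i j * (G y * covEndTwo G (tfRicEnd G) i j y) k l :=
    fun k l => (H.sum_inv_mul_covEndTwo hA hC hD hy k l).symm
  simp only [h3, h2, Finset.mul_sum]
  rw [Finset.sum_congr rfl fun i _ => Finset.sum_comm, Finset.sum_comm]
  refine Finset.sum_congr rfl fun k _ => ?_
  rw [Finset.sum_congr rfl fun i _ => Finset.sum_comm, Finset.sum_comm]
  refine Finset.sum_congr rfl fun l _ => Finset.sum_congr rfl fun i _ =>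
    Finset.sum_congr rfl fun j _ => by ring

end IsLocalMetric
end BochnerFormula

/-! ### Pointwise algebra in an orthonormal frame -/

section FrameAlgebra

open Matrix

variable {n : ℕ}

lemma sum_mul_sq_le₂ (X Y : Fin n → Fin n → ℝ) :
    (∑ a, ∑ b, X a b * Y a b) ^ 2 ≤ (∑ a, ∑ b, X a b ^ 2) * ∑ a, ∑ b, Y a b ^ 2 := by
  have := Finset.sum_mul_sq_le_sq_mul_sq (Finset.univ : Finset (Fin n × Fin n))
    (fun p => X p.1 p.2) (fun p => Y p.1 p.2)
  simpa only [Fintype.sum_prod_type] using this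

lemma sum_mul_sq_le₃ (X Y : Fin n → Fin n → Fin n → ℝ) :
    (∑ a, ∑ b, ∑ c, X a b c * Y a b c) ^ 2
      ≤ (∑ a, ∑ b, ∑ c, X a b c ^ 2) * ∑ a, ∑ b, ∑ c, Y a b c ^ 2 := by
  have := Finset.sum_mul_sq_le_sq_mul_sq (Finset.univ : Finset (Fin n × Fin n × Fin n))
    (fun p => X p.1 p.2.1 p.2.2) (fun p => Y p.1 p.2.1 p.2.2)
  simpa only [Fintype.sum_prod_type] using this

lemma sum_mul_sq_le₄ (X Y : Fin n → Fin n → Fin n → Fin n → ℝ) :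
    (∑ a, ∑ b, ∑ c, ∑ d, X a b c d * Y a b c d) ^ 2
      ≤ (∑ a, ∑ b, ∑ c, ∑ d, X a b c d ^ 2) * ∑ a, ∑ b, ∑ c, ∑ d, Y a b c d ^ 2 := by
  have := Finset.sum_mul_sq_le_sq_mul_sq (Finset.univ : Finset (Fin n × Fin n × Fin n × Fin n))
    (fun p => X p.1 p.2.1 p.2.2.1 p.2.2.2) (fun p => Y p.1 p.2.1 p.2.2.1 p.2.2.2)
  simpa only [Fintype.sum_prod_type] using this

/-- A traceless symmetric matrix `E` satisfies `|E v|² ≤ (1 - 1 / n) |E|² |v|²`: pair `E` with the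
traceless symmetric part of `v ⊗ E v`. -/
lemma norm_mulVec_sq_le (hn : 2 ≤ n) {E : Fin n → Fin n → ℝ} (hs : ∀ a b, E a b = E b a)
    (ht : ∑ a, E a a = 0) (v : Fin n → ℝ) :
    n * ∑ a, (∑ b, E a b * v b) ^ 2 ≤ (n - 1) * (∑ a, ∑ b, E a b ^ 2) * ∑ a, v a ^ 2 := by
  set w : Fin n → ℝ := fun a => ∑ b, E a b * v b with hw
  set s := ∑ a, w a ^ 2 with hs'
  set N := ∑ a, v a ^ 2 with hN
  set q := ∑ a, v a * w a with hq
  have hn0 : (2 : ℝ) ≤ n := by exact_mod_cast hn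
  -- the traceless symmetric part of `v ⊗ E v`
  set X : Fin n → Fin n → ℝ := fun a b => (1 / 2) * (v a * w b) + (1 / 2) * (w a * v b)
    - q / n * (if a = b then 1 else 0) with hX
  have c1 : ∑ a, ∑ b, E a b * (v b * w a) = s := by
    refine Finset.sum_congr rfl fun a _ => ?_
    rw [sq]; conv_rhs => rw [hw]; simp only [Finset.sum_mul]
    exact Finset.sum_congr rfl fun b _ => by ring
  have c2 : ∑ a, ∑ b, E a b * (v a * w b) = s := by
    rw [← c1, Finset.sum_comm]
    exact Finset.sum_congr rfl fun b _ => Finset.sum_congr rfl fun a _ => by rw [hs a b]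
  have h1 : ∑ a, ∑ b, E a b * X a b = s := by
    have : ∀ a b, E a b * X a b = (1 / 2) * (E a b * (v a * w b)) + (1 / 2) * (E a b * (v b * w a))
        - q / n * (if a = b then E a b else 0) := by
      intro a b; simp only [hX]; split_ifs <;> ring
    simp only [this, Finset.sum_sub_distrib, Finset.sum_add_distrib, ← Finset.mul_sum, c1, c2,
      Finset.sum_ite_eq, Finset.mem_univ, if_true, ht]
    ring
  have p : ∀ x y x' y' : Fin n → ℝ, ∑ a, ∑ b, (x a * y b) * (x' a * y' b)
      = (∑ a, x a * x' a) * ∑ b, y b * y' b := by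
    intro x y x' y'
    rw [Finset.sum_mul_sum]
    exact Finset.sum_congr rfl fun b _ => Finset.sum_congr rfl fun a _ => by ring
  have h2 : ∑ a, ∑ b, X a b ^ 2 = (1 / 2) * (N * s) + (1 / 2) * q ^ 2 - q ^ 2 / n := by
    have : ∀ a b, X a b ^ 2 = (1 / 4) * ((v a * w b) * (v a * w b))
        + (1 / 2) * ((v a * w b) * (w a * v b)) + (1 / 4) * ((w a * v b) * (w a * v b))
        + (if a = b then q ^ 2 / n ^ 2 - 2 * (q / n) * (v a * w b) else 0) := by
      intro a b; simp only [hX]; split_ifs with h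
      · subst h; ring
      · ring
    simp only [this, Finset.sum_add_distrib, ← Finset.mul_sum, p, Finset.sum_ite_eq,
      Finset.mem_univ, if_true, Finset.sum_sub_distrib, Finset.sum_const, Finset.card_univ,
      Fintype.card_fin, nsmul_eq_mul]
    have e1 : ∑ a, v a * v a = N := Finset.sum_congr rfl fun a _ => (sq _).symm
    have e2 : ∑ a, w a * w a = s := Finset.sum_congr rfl fun a _ => (sq _).symm
    have e3 : ∑ a, w a * v a = q := Finset.sum_congr rfl fun a _ => mul_comm _ _
    rw [e1, e2, e3, ← hq]
    field_simp
    ring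
  have h3 : q ^ 2 ≤ N * s := Finset.sum_mul_sq_le_sq_mul_sq _ _ _
  have h4 := sum_mul_sq_le₂ E X
  rw [h1, h2] at h4
  set F := ∑ a, ∑ b, E a b ^ 2 with hF
  have hF0 : 0 ≤ F := Finset.sum_nonneg fun a _ => Finset.sum_nonneg fun b _ => sq_nonneg _
  have hs0 : 0 ≤ s := Finset.sum_nonneg fun a _ => sq_nonneg _
  have hN0 : 0 ≤ N := Finset.sum_nonneg fun a _ => sq_nonneg _
  have h5 : n * ((1 / 2) * (N * s) + (1 / 2) * q ^ 2 - q ^ 2 / n) ≤ (n - 1) * (N * s) := by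
    have : n * ((1 / 2) * (N * s) + (1 / 2) * q ^ 2 - q ^ 2 / n)
      = n / 2 * (N * s) + (n / 2 - 1) * q ^ 2 := by field_simp; ring
    rw [this]
    nlinarith
  have h6 : (n * s) * s ≤ ((n - 1) * F * N) * s := by
    have := mul_le_mul_of_nonneg_left h5 hF0
    have h7 := mul_le_mul_of_nonneg_left h4 (by linarith : (0 : ℝ) ≤ n)
    nlinarith
  rcases hs0.eq_or_lt with h | h
  · rw [← h, mul_zero]
    exact mul_nonneg (mul_nonneg (by linarith) hF0) hN0
  · exact le_of_mul_le_mul_right h6 h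

/-- A totally symmetric, totally traceless three-tensor. -/
structure IsCodazziTraceless (T : Fin n → Fin n → Fin n → ℝ) : Prop where
  symm₁ : ∀ k i j, T k i j = T i k j
  symm₂ : ∀ k i j, T k i j = T k j i
  traceless : ∀ k, ∑ i, T k i i = 0

/-- The refined Kato inequality for traceless Codazzi tensors, in algebraic form: pair `T` with the
totally symmetric traceless part of `v ⊗ E`. -/
lemma refined_kato (hn : 2 ≤ n) {E : Fin n → Fin n → ℝ} (hs : ∀ a b, E a b = E b a)
    (ht : ∑ a, E a a = 0) {T : Fin n → Fin n → Fin n → ℝ} (hT : IsCodazziTraceless T) :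
    (n + 2) * ∑ k, (∑ i, ∑ j, E i j * T k i j) ^ 2
      ≤ n * (∑ i, ∑ j, E i j ^ 2) * ∑ k, ∑ i, ∑ j, T k i j ^ 2 := by
  set v : Fin n → ℝ := fun k => ∑ i, ∑ j, E i j * T k i j with hv
  set w : Fin n → ℝ := fun a => ∑ b, E a b * v b with hw
  set s := ∑ k, v k ^ 2 with hs'
  -- the value of `c` for which the tensor `S` below is traceless
  set c : ℝ := 2 / (3 * (n + 2)) with hc
  have hn0 : (2 : ℝ) ≤ n := by exact_mod_cast hn
  set S : Fin n → Fin n → Fin n → ℝ := fun k i j =>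
    (1 / 3) * (v k * E i j) + (1 / 3) * (v i * E k j) + (1 / 3) * (v j * E k i)
    - (if k = i then c * w j else 0) - (if k = j then c * w i else 0)
    - (if i = j then c * w k else 0) with hS
  have pair : ∀ Y : Fin n → Fin n → Fin n → ℝ, IsCodazziTraceless Y →
      ∑ k, ∑ i, ∑ j, Y k i j * S k i j = ∑ k, ∑ i, ∑ j, Y k i j * (v k * E i j) := by
    intro Y hY
    have e1 : ∑ k, ∑ i, ∑ j, Y k i j * (v i * E k j) = ∑ k, ∑ i, ∑ j, Y k i j * (v k * E i j) := by
      rw [Finset.sum_comm]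
      refine Finset.sum_congr rfl fun k _ => Finset.sum_congr rfl fun i _ =>
        Finset.sum_congr rfl fun j _ => by rw [hY.symm₁]
    have e2 : ∑ k, ∑ i, ∑ j, Y k i j * (v j * E k i) = ∑ k, ∑ i, ∑ j, Y k i j * (v k * E i j) := by
      rw [← e1]
      refine Finset.sum_congr rfl fun k _ => ?_
      rw [Finset.sum_comm]
      refine Finset.sum_congr rfl fun i _ => Finset.sum_congr rfl fun j _ => by rw [hY.symm₂]
    have e3 : ∑ k, ∑ i, ∑ j, (if k = i then Y k i j * (c * w j) else 0) = 0 := by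
      rw [Finset.sum_congr rfl fun k _ => Finset.sum_comm, Finset.sum_comm]
      refine Finset.sum_eq_zero fun j _ => ?_
      simp only [Finset.sum_ite_eq, Finset.mem_univ, if_true]
      rw [← Finset.sum_mul]
      have : ∑ k, Y k k j = ∑ k, Y j k k := Finset.sum_congr rfl fun k _ => by
        rw [hY.symm₂, hY.symm₁]
      rw [this, hY.traceless, zero_mul]
    have e4 : ∑ k, ∑ i, ∑ j, (if k = j then Y k i j * (c * w i) else 0) = 0 := by
      rw [Finset.sum_comm]
      refine Finset.sum_eq_zero fun i _ => ?_
      simp only [Finset.sum_ite_eq, Finset.mem_univ, if_true]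
      rw [← Finset.sum_mul]
      have : ∑ k, Y k i k = ∑ k, Y i k k := Finset.sum_congr rfl fun k _ => by rw [hY.symm₁]
      rw [this, hY.traceless, zero_mul]
    have e5 : ∑ k, ∑ i, ∑ j, (if i = j then Y k i j * (c * w k) else 0) = 0 := by
      refine Finset.sum_eq_zero fun k _ => ?_
      simp only [Finset.sum_ite_eq, Finset.mem_univ, if_true]
      rw [← Finset.sum_mul, hY.traceless, zero_mul]
    have : ∀ k i j, Y k i j * S k i j = (1 / 3) * (Y k i j * (v k * E i j))
        + (1 / 3) * (Y k i j * (v i * E k j)) + (1 / 3) * (Y k i j * (v j * E k i))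
        - (if k = i then Y k i j * (c * w j) else 0) - (if k = j then Y k i j * (c * w i) else 0)
        - (if i = j then Y k i j * (c * w k) else 0) := by
      intro k i j; simp only [hS, mul_sub, mul_add, mul_ite, mul_zero]; ring
    simp only [this, Finset.sum_sub_distrib, Finset.sum_add_distrib, ← Finset.mul_sum, e1, e2, e3,
      e4, e5]
    ring
  have hST : IsCodazziTraceless S := by
    refine ⟨fun k i j => ?_, fun k i j => ?_, fun k => ?_⟩
    · simp only [hS, hs i k, eq_comm (a := i) (b := k)]; ring
    · simp only [hS, hs j i, eq_comm (a := j) (b := i)]; ring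
    · have e1 : ∑ i, v i * E k i = w k := Finset.sum_congr rfl fun i _ => mul_comm _ _
      simp only [hS, Finset.sum_sub_distrib, Finset.sum_add_distrib, ← Finset.mul_sum, ht, e1,
        Finset.sum_ite_eq, Finset.mem_univ, if_true, Finset.sum_const, Finset.card_univ,
        Fintype.card_fin, nsmul_eq_mul]
      rw [hc]; field_simp; ring
  have h1 : ∑ k, ∑ i, ∑ j, T k i j * S k i j = s := by
    rw [pair T hT]
    refine Finset.sum_congr rfl fun k _ => ?_
    rw [sq]; conv_rhs => rw [hv]; simp only [Finset.sum_mul]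
    exact Finset.sum_congr rfl fun i _ => Finset.sum_congr rfl fun j _ => by ring
  set F := ∑ i, ∑ j, E i j ^ 2 with hF
  set Q := ∑ k, ∑ i, ∑ j, T k i j ^ 2 with hQ
  set W := ∑ a, w a ^ 2 with hW
  have h2 : ∑ k, ∑ i, ∑ j, S k i j ^ 2 = (1 / 3) * (s * F) + (2 / 3 - 2 * c) * W := by
    have e0 : ∑ k, ∑ i, ∑ j, S k i j ^ 2 = ∑ k, ∑ i, ∑ j, S k i j * (v k * E i j) := by
      rw [← pair S hST]; simp only [sq]
    have e1 : ∑ k, ∑ i, ∑ j, (v k * E i j) * (v k * E i j) = s * F := by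
      rw [hs', hF, Finset.sum_mul]
      refine Finset.sum_congr rfl fun k _ => ?_
      simp only [Finset.mul_sum]
      exact Finset.sum_congr rfl fun i _ => Finset.sum_congr rfl fun j _ => by ring
    have e2 : ∑ k, ∑ i, ∑ j, (v i * E k j) * (v k * E i j) = W := by
      rw [Finset.sum_congr rfl fun k _ => Finset.sum_comm, Finset.sum_comm]
      refine Finset.sum_congr rfl fun j _ => ?_
      rw [sq, hw, Finset.sum_mul_sum]
      refine Finset.sum_congr rfl fun k _ => Finset.sum_congr rfl fun i _ => ?_
      rw [hs j k, hs j i]; ring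
    have e3 : ∑ k, ∑ i, ∑ j, (v j * E k i) * (v k * E i j) = W := by
      rw [← e2]
      refine Finset.sum_congr rfl fun k _ => ?_
      rw [Finset.sum_comm]
      refine Finset.sum_congr rfl fun i _ => Finset.sum_congr rfl fun j _ => ?_
      rw [hs j i]
    have e4 : ∑ k, ∑ j, (c * w j) * (v k * E k j) = c * W := by
      rw [Finset.sum_comm, hW, Finset.mul_sum]
      refine Finset.sum_congr rfl fun j _ => ?_
      rw [← Finset.mul_sum, sq, ← mul_assoc]
      congr 1
      exact Finset.sum_congr rfl fun k _ => by rw [hs j k, mul_comm]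
    have e4' : ∑ k, ∑ i, (c * w i) * (v k * E i k) = c * W := by
      rw [← e4]
      refine Finset.sum_congr rfl fun k _ => Finset.sum_congr rfl fun i _ => by rw [hs i k]
    have e5 : ∑ k, ∑ i, (c * w k) * (v k * E i i) = 0 := by
      refine Finset.sum_eq_zero fun k _ => ?_
      rw [← Finset.mul_sum, ← Finset.mul_sum, ht]; ring
    have : ∀ k i j, S k i j * (v k * E i j) = (1 / 3) * ((v k * E i j) * (v k * E i j))
        + (1 / 3) * ((v i * E k j) * (v k * E i j)) + (1 / 3) * ((v j * E k i) * (v k * E i j))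
        - (if k = i then (c * w j) * (v k * E i j) else 0)
        - (if k = j then (c * w i) * (v k * E i j) else 0)
        - (if i = j then (c * w k) * (v k * E i j) else 0) := by
      intro k i j; simp only [hS, sub_mul, add_mul, ite_mul, zero_mul]; ring
    have f1 : ∑ k, ∑ i, ∑ j, (if k = i then (c * w j) * (v k * E i j) else 0)
        = ∑ k, ∑ j, (c * w j) * (v k * E k j) := by
      refine Finset.sum_congr rfl fun k _ => ?_
      rw [Finset.sum_comm]
      simp only [Finset.sum_ite_eq, Finset.mem_univ, if_true]
    rw [e0]
    simp only [this, Finset.sum_sub_distrib, Finset.sum_add_distrib, ← Finset.mul_sum, e1, e2, e3]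
    rw [f1]
    simp only [Finset.sum_ite_eq, Finset.mem_univ, if_true]
    rw [e4, e4', e5]
    ring
  have h3 := sum_mul_sq_le₃ T S
  rw [h1, h2] at h3
  have h4 : n * W ≤ (n - 1) * F * s := norm_mulVec_sq_le hn hs ht v
  have hF0 : 0 ≤ F := Finset.sum_nonneg fun a _ => Finset.sum_nonneg fun b _ => sq_nonneg _
  have hQ0 : 0 ≤ Q := Finset.sum_nonneg fun a _ => Finset.sum_nonneg fun b _ =>
    Finset.sum_nonneg fun _ _ => sq_nonneg _
  have hs0 : 0 ≤ s := Finset.sum_nonneg fun a _ => sq_nonneg _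
  have h5 : (n + 2) * ((1 / 3) * (s * F) + (2 / 3 - 2 * c) * W) ≤ n * F * s := by
    have : (n + 2) * ((1 / 3) * (s * F) + (2 / 3 - 2 * c) * W)
        = (n + 2) / 3 * (s * F) + 2 / 3 * (n * W) := by
      rw [hc]; field_simp; ring
    rw [this]
    nlinarith
  -- Cauchy-Schwarz gives the claim with an additional factor `s`, which cancels
  have h6 : ((n + 2) * s) * s ≤ (n * F * Q) * s := by
    have := mul_le_mul_of_nonneg_left h5 hQ0
    have h7 := mul_le_mul_of_nonneg_left h3 (by linarith : (0 : ℝ) ≤ (n : ℝ) + 2)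
    nlinarith
  rcases hs0.eq_or_lt with h | h
  · rw [← h, mul_zero]
    exact mul_nonneg (mul_nonneg (by linarith) hF0) hQ0
  · exact le_of_mul_le_mul_right h6 h

/-- An array of frame components of a covariant four-tensor. -/
abbrev Arr4 (n : ℕ) : Type := Fin n → Fin n → Fin n → Fin n → ℝ

/-- Kronecker's delta. -/
def kron (a b : Fin n) : ℝ := if a = b then 1 else 0

/-- The Ricci contraction in an orthonormal frame. -/
def ricF (r : Arr4 n) (b d : Fin n) : ℝ := ∑ a, r a b a d

/-- The scalar curvature in an orthonormal frame. -/
def scalF (r : Arr4 n) : ℝ := ∑ b, ricF r b b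

/-- The traceless Ricci tensor in an orthonormal frame. -/
def tfF (r : Arr4 n) (a b : Fin n) : ℝ := ricF r a b - scalF r / n * kron a b

/-- The Weyl tensor in an orthonormal frame. -/
def weylF (r : Arr4 n) (i j k l : Fin n) : ℝ :=
  r i j k l
    - scalF r / ((n : ℝ) * ((n : ℝ) - 1)) * (kron i k * kron j l - kron i l * kron j k)
    - 1 / ((n : ℝ) - 2) * (tfF r i k * kron j l + tfF r j l * kron i k - tfF r i l * kron j k
      - tfF r j k * kron i l)

/-- `|E|²` in an orthonormal frame. -/
def sqE (r : Arr4 n) : ℝ := ∑ a, ∑ b, tfF r a b ^ 2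

/-- `|W|²` in an orthonormal frame. -/
def sqW (r : Arr4 n) : ℝ := ∑ a, ∑ b, ∑ c, ∑ d, weylF r a b c d ^ 2

lemma sqE_nonneg (r : Arr4 n) : 0 ≤ sqE r :=
  Finset.sum_nonneg fun _ _ => Finset.sum_nonneg fun _ _ => sq_nonneg _

lemma sqW_nonneg (r : Arr4 n) : 0 ≤ sqW r :=
  Finset.sum_nonneg fun _ _ => Finset.sum_nonneg fun _ _ => Finset.sum_nonneg fun _ _ =>
    Finset.sum_nonneg fun _ _ => sq_nonneg _

lemma tfF_trace (hn : n ≠ 0) (r : Arr4 n) : ∑ a, tfF r a a = 0 := by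
  have : (n : ℝ) ≠ 0 := by exact_mod_cast hn
  simp only [tfF, kron, if_true, Finset.sum_sub_distrib, Finset.sum_const, Finset.card_univ,
    Fintype.card_fin, nsmul_eq_mul, mul_one]
  rw [scalF]; field_simp; ring

/-- The zeroth order term of the Bochner formula, bounded below: it is
`R / (n - 1) |E|² + n / (n - 2) tr E³ - W(E, E)`. -/
lemma bochner_curvature_term (hn : 3 ≤ n) (r : Arr4 n) (hs : ∀ a b, tfF r a b = tfF r b a) :
    scalF r / (n - 1) * sqE r - (n / (n - 2) * √(sqE r) + √(sqW r)) * sqE r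
      ≤ ∑ a, ∑ b, ∑ c, tfF r a b * ricF r b c * tfF r c a
        - ∑ a, ∑ b, ∑ c, ∑ d, tfF r a c * tfF r b d * r a b c d := by
  set E := tfF r with hE
  set s := scalF r with hsc
  have hn0 : (3 : ℝ) ≤ n := by exact_mod_cast hn
  have ht : ∑ a, E a a = 0 := tfF_trace (by omega) r
  set t := ∑ a, ∑ b, ∑ c, E a b * E b c * E c a with ht'
  set f := sqE r with hf
  have hf0 : 0 ≤ f := sqE_nonneg r
  set w := ∑ a, ∑ b, ∑ c, ∑ d, weylF r a b c d * (E a c * E b d) with hw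
  have ff : ∑ a, ∑ b, E a b * E b a = f :=
    Finset.sum_congr rfl fun a _ => Finset.sum_congr rfl fun b _ => by rw [hs b a, sq]
  have h1 : ∑ a, ∑ b, ∑ c, E a b * ricF r b c * E c a = t + s / n * f := by
    have : ∀ a b c, E a b * ricF r b c * E c a = E a b * E b c * E c a
        + (if b = c then s / n * (E a b * E c a) else 0) := by
      intro a b c
      have : ricF r b c = E b c + s / n * kron b c := by rw [hE, tfF]; ring
      rw [this, kron]; split_ifs <;> ring
    simp only [this, Finset.sum_add_distrib, Finset.sum_ite_eq, Finset.mem_univ, if_true,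
      ← Finset.mul_sum, ff]
    rw [← ht']
  have h2 : ∑ a, ∑ b, ∑ c, ∑ d, E a c * E b d * r a b c d
      = w - s / (n * (n - 1)) * f - 1 / (n - 2) * (2 * t) := by
    have : ∀ a b c d, E a c * E b d * r a b c d = weylF r a b c d * (E a c * E b d)
        + s / (n * (n - 1)) * (E a c * kron a c * (E b d * kron b d))
        - s / (n * (n - 1)) * (if b = c then (if a = d then E a c * E b d else 0) else 0)
        + 1 / (n - 2) * ((E a c * E a c) * (E b d * kron b d))
        + 1 / (n - 2) * ((E a c * kron a c) * (E b d * E b d))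
        - 1 / (n - 2) * (if b = c then E a c * E b d * E a d else 0)
        - 1 / (n - 2) * (if a = d then E a c * E b d * E b c else 0) := by
      intro a b c d
      rw [weylF, ← hE, ← hsc]
      simp only [kron]
      split_ifs <;> ring
    have k0 : ∑ b, ∑ d, E b d * kron b d = 0 := by
      simpa [kron] using ht
    have p : ∀ X Y : Fin n → Fin n → ℝ, ∑ a, ∑ b, ∑ c, X a c * ∑ d, Y b d
        = (∑ a, ∑ c, X a c) * ∑ b, ∑ d, Y b d := by
      intro X Y
      rw [Finset.sum_mul_sum]
      exact Finset.sum_congr rfl fun a _ => Finset.sum_congr rfl fun b _ =>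
        (Finset.sum_mul _ _ _).symm
    have p1 : ∑ a, ∑ b, ∑ c, E a c * kron a c * ∑ d, E b d * kron b d = 0 := by
      rw [p (fun a c => E a c * kron a c) (fun b d => E b d * kron b d), k0, mul_zero]
    have p2 : ∑ a, ∑ b, ∑ c, E a c * E a c * ∑ d, E b d * kron b d = 0 := by
      rw [p (fun a c => E a c * E a c) (fun b d => E b d * kron b d), k0, mul_zero]
    have p3 : ∑ a, ∑ b, ∑ c, E a c * kron a c * ∑ d, E b d * E b d = 0 := by
      rw [p (fun a c => E a c * kron a c) (fun b d => E b d * E b d), k0, zero_mul]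
    have q1 : ∑ a, ∑ b, ∑ c, ∑ d, (if b = c then (if a = d then E a c * E b d else 0) else 0)
        = f := by
      rw [← ff]
      refine Finset.sum_congr rfl fun a _ => Finset.sum_congr rfl fun b _ => ?_
      rw [Finset.sum_comm]
      simp only [Finset.sum_ite_eq, Finset.mem_univ, if_true]
    have q2 : ∑ a, ∑ b, ∑ c, ∑ d, (if b = c then E a c * E b d * E a d else 0) = t := by
      refine Finset.sum_congr rfl fun a _ => Finset.sum_congr rfl fun b _ => ?_
      rw [Finset.sum_comm]
      simp only [Finset.sum_ite_eq, Finset.mem_univ, if_true]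
      exact Finset.sum_congr rfl fun d _ => by rw [hs d a]
    have q3 : ∑ a, ∑ b, ∑ c, ∑ d, (if a = d then E a c * E b d * E b c else 0) = t := by
      simp only [Finset.sum_ite_eq, Finset.mem_univ, if_true]
      refine Finset.sum_congr rfl fun a _ => Finset.sum_congr rfl fun b _ =>
        Finset.sum_congr rfl fun c _ => ?_
      rw [hs c a, hs a b]; ring
    simp only [this, Finset.sum_sub_distrib, Finset.sum_add_distrib, ← Finset.mul_sum, q1, q2, q3,
      p1, p2, p3]
    rw [← hw]
    ring
  have ht2 : |t| ≤ √f * f := by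
    set X : Fin n → Fin n → ℝ := fun a c => ∑ b, E a b * E b c with hX
    have e1 : t = ∑ a, ∑ c, X a c * E a c := by
      refine Finset.sum_congr rfl fun a _ => ?_
      rw [Finset.sum_comm]
      refine Finset.sum_congr rfl fun c _ => ?_
      rw [hX, Finset.sum_mul]
      exact Finset.sum_congr rfl fun b _ => by rw [hs c a]
    have e2 : ∑ a, ∑ c, X a c ^ 2 ≤ f * f := by
      have : f * f = ∑ a, ∑ c, (∑ b, E a b ^ 2) * ∑ b, E b c ^ 2 := by
        rw [← Finset.sum_mul_sum]
        congr 1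
        rw [Finset.sum_comm]; rfl
      rw [this]
      exact Finset.sum_le_sum fun a _ => Finset.sum_le_sum fun c _ =>
        Finset.sum_mul_sq_le_sq_mul_sq _ _ _
    have e3 := sum_mul_sq_le₂ X E
    rw [← e1] at e3
    have e4 : t ^ 2 ≤ (√f * f) ^ 2 := by
      rw [mul_pow, Real.sq_sqrt hf0]
      have := mul_le_mul_of_nonneg_right e2 hf0
      calc t ^ 2 ≤ _ := e3
        _ ≤ f * f * f := this
        _ = _ := by ring
    exact abs_le_of_sq_le_sq e4 (by positivity)
  have hw2 : |w| ≤ √(sqW r) * f := by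
    have e1 := sum_mul_sq_le₄ (weylF r) (fun a b c d => E a c * E b d)
    have e2 : ∑ a, ∑ b, ∑ c, ∑ d, (E a c * E b d) ^ 2 = f * f := by
      simp only [mul_pow]
      conv_rhs => rw [hf, sqE, Finset.sum_mul_sum]
      refine Finset.sum_congr rfl fun a _ => Finset.sum_congr rfl fun b _ => ?_
      rw [← Finset.sum_mul_sum]
    rw [e2] at e1
    have e4 : w ^ 2 ≤ (√(sqW r) * f) ^ 2 := by
      rw [mul_pow, Real.sq_sqrt (sqW_nonneg r), sq f]
      exact e1
    exact abs_le_of_sq_le_sq e4 (by positivity)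
  rw [h1, h2]
  have key : t + s / n * f - (w - s / (n * (n - 1)) * f - 1 / (n - 2) * (2 * t))
      = s / (n - 1) * f + n / (n - 2) * t - w := by
    have : (n : ℝ) - 1 ≠ 0 := by linarith
    have : (n : ℝ) - 2 ≠ 0 := by linarith
    have : (n : ℝ) ≠ 0 := by linarith
    field_simp
    ring
  rw [key]
  have hc : (0 : ℝ) ≤ n / (n - 2) := div_nonneg (by linarith) (by linarith)
  have a1 : -(n / (n - 2) * (√f * f)) ≤ n / (n - 2) * t := by
    rw [← mul_neg]
    exact mul_le_mul_of_nonneg_left (neg_le_of_abs_le ht2) hc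
  have a2 := le_of_abs_le hw2
  nlinarith

end FrameAlgebra

/-! ### Orthonormal frames -/

section Frames

open Matrix

variable {n : ℕ}

/-- The columns of `P` form an orthonormal basis for the inner product with matrix `g`. -/
structure IsFrame (g P : Matrix (Fin n) (Fin n) ℝ) : Prop where
  inv_eq : g⁻¹ = P * Pᵀ
  orth : Pᵀ * g * P = 1

open scoped MatrixOrder Matrix.Norms.L2Operator in
lemma exists_isFrame {g : Matrix (Fin n) (Fin n) ℝ} (hg : g.PosDef) : ∃ P, IsFrame g P := by
  obtain ⟨B, hB, rfl⟩ := CStarAlgebra.isStrictlyPositive_iff_eq_star_mul_self.mp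
    hg.isStrictlyPositive
  have hd : IsUnit B.det := (Matrix.isUnit_iff_isUnit_det B).1 hB
  have hd' : IsUnit Bᵀ.det := by rwa [Matrix.det_transpose]
  refine ⟨B⁻¹, ?_, ?_⟩
  · rw [Matrix.star_eq_conjTranspose, Matrix.conjTranspose_eq_transpose_of_trivial, Matrix.mul_inv_rev,
      Matrix.transpose_nonsing_inv]
  · rw [Matrix.star_eq_conjTranspose, Matrix.conjTranspose_eq_transpose_of_trivial, Matrix.transpose_nonsing_inv,
      ← Matrix.mul_assoc, Matrix.nonsing_inv_mul _ hd', Matrix.one_mul,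
      Matrix.mul_nonsing_inv _ hd]

lemma sum_inv_mul_mul {g P : Matrix (Fin n) (Fin n) ℝ} (hP : IsFrame g P) (x y : Fin n → ℝ) :
    ∑ i, ∑ j, g⁻¹ i j * (x i * y j) = ∑ a, (∑ i, P i a * x i) * ∑ j, P j a * y j := by
  rw [hP.inv_eq]
  simp only [Matrix.mul_apply, Matrix.transpose_apply, Finset.sum_mul]
  rw [Finset.sum_congr rfl fun i _ => Finset.sum_comm, Finset.sum_comm]
  refine Finset.sum_congr rfl fun a _ => Finset.sum_congr rfl fun i _ => ?_
  rw [Finset.mul_sum]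
  exact Finset.sum_congr rfl fun j _ => by ring

lemma trace_inv_mul_mul {g P : Matrix (Fin n) (Fin n) ℝ} (hP : IsFrame g P)
    (X Y : Matrix (Fin n) (Fin n) ℝ) :
    ((g⁻¹ * X) * (g⁻¹ * Y)).trace = ((Pᵀ * X * P) * (Pᵀ * Y * P)).trace := by
  rw [hP.inv_eq]
  have : P * Pᵀ * X * (P * Pᵀ * Y) = P * (Pᵀ * X * P * (Pᵀ * Y)) := by noncomm_ring
  rw [this, Matrix.trace_mul_comm]
  congr 1
  noncomm_ring

lemma trace_inv_mul {g P : Matrix (Fin n) (Fin n) ℝ} (hP : IsFrame g P)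
    (X : Matrix (Fin n) (Fin n) ℝ) : (g⁻¹ * X).trace = (Pᵀ * X * P).trace := by
  rw [hP.inv_eq, Matrix.mul_assoc, Matrix.trace_mul_comm]

lemma sum_comm₄ (f : Fin n → Fin n → Fin n → Fin n → Fin n → ℝ) :
    ∑ a, ∑ b, ∑ c, ∑ d, ∑ i, f a b c d i = ∑ i, ∑ a, ∑ b, ∑ c, ∑ d, f a b c d i := by
  have := Finset.sum_comm (s := (Finset.univ : Finset (Fin n × Fin n × Fin n × Fin n)))
    (t := (Finset.univ : Finset (Fin n))) (f := fun p i => f p.1 p.2.1 p.2.2.1 p.2.2.2 i)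
  simpa only [Fintype.sum_prod_type] using this

lemma sum_comm₄₂ (f : Fin n → Fin n → Fin n → Fin n → Fin n → Fin n → ℝ) :
    ∑ k, ∑ i, ∑ a, ∑ b, ∑ c, ∑ d, f k i a b c d
      = ∑ a, ∑ b, ∑ c, ∑ d, ∑ i, ∑ k, f k i a b c d := by
  calc _ = ∑ k, ∑ a, ∑ b, ∑ c, ∑ d, ∑ i, f k i a b c d :=
        Finset.sum_congr rfl fun k _ => (sum_comm₄ fun a b c d i => f k i a b c d).symm
    _ = ∑ a, ∑ b, ∑ c, ∑ d, ∑ k, ∑ i, f k i a b c d :=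
        (sum_comm₄ fun a b c d k => ∑ i, f k i a b c d).symm
    _ = _ := Finset.sum_congr rfl fun a _ => Finset.sum_congr rfl fun b _ =>
        Finset.sum_congr rfl fun c _ => Finset.sum_congr rfl fun d _ => Finset.sum_comm

lemma sum_rev₄ (f : Fin n → Fin n → Fin n → Fin n → ℝ) :
    ∑ d, ∑ c, ∑ b, ∑ a, f a b c d = ∑ a, ∑ b, ∑ c, ∑ d, f a b c d := by
  calc _ = ∑ d, ∑ a, ∑ c, ∑ b, f a b c d := by
        refine Finset.sum_congr rfl fun d _ => ?_
        rw [Finset.sum_congr rfl fun c _ => Finset.sum_comm, Finset.sum_comm]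
    _ = ∑ a, ∑ d, ∑ b, ∑ c, f a b c d := by
        rw [Finset.sum_comm]
        exact Finset.sum_congr rfl fun a _ => Finset.sum_congr rfl fun d _ => Finset.sum_comm
    _ = _ := by
        refine Finset.sum_congr rfl fun a _ => ?_
        rw [Finset.sum_comm]
        exact Finset.sum_congr rfl fun b _ => Finset.sum_comm

/-- The frame components of the curvature tensor. -/
def riemF (G : MatFun n) (P : Matrix (Fin n) (Fin n) ℝ) (y : Coord n) : Arr4 n :=
  fun a b c d => ∑ k, ∑ l, P k c * P l d * (Pᵀ * (G y * curvM G k l y) * P) a b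

/-- The pairing `⟨∇f, ∇f'⟩` of the gradients. -/
def gradM (G : MatFun n) (f f' : Coord n → ℝ) (y : Coord n) : ℝ :=
  ∑ i, ∑ j, (G y)⁻¹ i j * (pd i f y * pd j f' y)

/-- `|E|²` as a function of the coordinates. -/
def sqEM (G : MatFun n) (y : Coord n) : ℝ := (tfRicEnd G y * tfRicEnd G y).trace

variable {U : Set (Coord n)} {G : MatFun n} {y : Coord n} {P : Matrix (Fin n) (Fin n) ℝ}

namespace IsLocalMetric

variable (H : IsLocalMetric U G)
include H

lemma smooth_sqEM : ContDiffOn ℝ ∞ (sqEM G) U := (H.smooth_tfRicEnd.mul H.smooth_tfRicEnd).trace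

lemma ricF_riemF (hP : IsFrame (G y) P) (hy : y ∈ U) (b d : Fin n) :
    ricF (riemF G P y) b d = (Pᵀ * ricM G y * P) b d := by
  have h1 : ∀ k l, ∑ a, P k a * (Pᵀ * (G y * curvM G k l y) * P) a b
      = ∑ j, curvM G k l y k j * P j b := by
    intro k l
    have : P * (Pᵀ * (G y * curvM G k l y) * P) = curvM G k l y * P := by
      rw [← Matrix.mul_assoc, ← Matrix.mul_assoc, ← hP.inv_eq, ← Matrix.mul_assoc,
        H.inv_mul hy, Matrix.one_mul]
    rw [← Matrix.mul_apply, this, Matrix.mul_apply]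
  simp only [ricF, riemF]
  calc ∑ a, ∑ k, ∑ l, P k a * P l d * (Pᵀ * (G y * curvM G k l y) * P) a b
      = ∑ k, ∑ l, P l d * ∑ a, P k a * (Pᵀ * (G y * curvM G k l y) * P) a b := by
        rw [Finset.sum_comm]
        refine Finset.sum_congr rfl fun k _ => ?_
        rw [Finset.sum_comm]
        refine Finset.sum_congr rfl fun l _ => ?_
        rw [Finset.mul_sum]
        exact Finset.sum_congr rfl fun a _ => by ring
    _ = ∑ l, ∑ j, P j b * ricM G y j l * P l d := by
        rw [Finset.sum_comm]
        refine Finset.sum_congr rfl fun l _ => ?_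
        simp only [h1, ricM, Matrix.of_apply, Finset.mul_sum, Finset.sum_mul]
        rw [Finset.sum_comm]
        refine Finset.sum_congr rfl fun j _ => Finset.sum_congr rfl fun k _ => by ring
    _ = _ := by
        simp only [Matrix.mul_apply, Matrix.transpose_apply, Finset.sum_mul]

lemma scalF_riemF (hP : IsFrame (G y) P) (hy : y ∈ U) : scalF (riemF G P y) = scalM G y := by
  simp only [scalF, H.ricF_riemF hP hy, scalM, trace_inv_mul hP]
  rfl

lemma tfF_riemF (hP : IsFrame (G y) P) (hy : y ∈ U) : Matrix.of (tfF (riemF G P y))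
    = Pᵀ * ricM G y * P - (scalM G y / n) • (1 : Matrix (Fin n) (Fin n) ℝ) := by
  ext a b
  simp only [Matrix.of_apply, tfF, H.ricF_riemF hP hy, H.scalF_riemF hP hy, Matrix.sub_apply,
    Matrix.smul_apply, Matrix.one_apply, kron, smul_eq_mul]

lemma tfF_symm (hP : IsFrame (G y) P) (hy : y ∈ U) (a b : Fin n) :
    tfF (riemF G P y) a b = tfF (riemF G P y) b a := by
  have h : (Matrix.of (tfF (riemF G P y)))ᵀ = Matrix.of (tfF (riemF G P y)) := by
    rw [H.tfF_riemF hP hy]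
    simp only [Matrix.transpose_sub, Matrix.transpose_mul, Matrix.transpose_transpose,
      H.ricM_transpose hy, Matrix.transpose_smul, Matrix.transpose_one, Matrix.mul_assoc]
  exact congrFun (congrFun h b) a

lemma mul_frame_metric (hP : IsFrame (G y) P) (hy : y ∈ U) : P * Pᵀ * G y = 1 := by
  rw [← hP.inv_eq, H.inv_mul hy]

lemma tfRicEnd_eq (hP : IsFrame (G y) P) (hy : y ∈ U) :
    tfRicEnd G y = P * Matrix.of (tfF (riemF G P y)) * (Pᵀ * G y) := by
  have h := H.mul_frame_metric hP hy
  rw [H.tfF_riemF hP hy, tfRicEnd, hP.inv_eq]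
  simp only [Matrix.mul_sub, Matrix.sub_mul, Matrix.mul_smul, Matrix.smul_mul, Matrix.mul_one]
  rw [← Matrix.mul_assoc P Pᵀ (G y), h]
  congr 1
  calc P * Pᵀ * ricM G y = P * Pᵀ * ricM G y * (P * Pᵀ * G y) := by rw [h, Matrix.mul_one]
    _ = _ := by noncomm_ring

lemma sqEM_eq (hP : IsFrame (G y) P) (hy : y ∈ U) : sqEM G y = sqE (riemF G P y) := by
  set E := Matrix.of (tfF (riemF G P y)) with hE
  have h : tfRicEnd G y * tfRicEnd G y = P * (E * E * (Pᵀ * G y)) := by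
    rw [H.tfRicEnd_eq hP hy, ← hE]
    calc P * E * (Pᵀ * G y) * (P * E * (Pᵀ * G y))
        = P * E * (Pᵀ * G y * P) * E * (Pᵀ * G y) := by noncomm_ring
      _ = _ := by rw [hP.orth]; noncomm_ring
  rw [sqEM, h, Matrix.trace_mul_comm, Matrix.mul_assoc, hP.orth, Matrix.mul_one]
  simp only [Matrix.trace, Matrix.diag, Matrix.mul_apply, sqE]
  refine Finset.sum_congr rfl fun a _ => Finset.sum_congr rfl fun b _ => ?_
  rw [hE, Matrix.of_apply, Matrix.of_apply, H.tfF_symm hP hy b a, sq]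

/-- Under harmonic curvature the frame components of `∇Ric = ∇E` are those of a totally symmetric
and traceless tensor. -/
lemma exists_codazzi_frame (hH : IsHarmonicOn U G) (hP : IsFrame (G y) P) (hy : y ∈ U) :
    IsCodazziTraceless fun k i j => ∑ m, P m k * (Pᵀ * covTwo G (ricM G) m y * P) i j := by
  set T := fun m => covTwo G (ricM G) m y with hT
  have hs : ∀ m, (T m)ᵀ = T m := fun m => H.covTwo_symm (fun w hw => H.ricM_transpose hw) hy m
  have hs' : ∀ m a b, T m a b = T m b a := fun m a b => congrFun (congrFun (hs m) b) a
  have expand : ∀ k i j, ∑ m, P m k * (Pᵀ * T m * P) i j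
      = ∑ m, ∑ q, ∑ p, P m k * (P p i * (T m p q * P q j)) := by
    intro k i j
    simp only [Matrix.mul_apply, Matrix.transpose_apply, Finset.mul_sum, Finset.sum_mul]
    refine Finset.sum_congr rfl fun m _ => Finset.sum_congr rfl fun q _ =>
      Finset.sum_congr rfl fun p _ => by ring
  refine ⟨fun k i j => ?_, fun k i j => ?_, fun k => ?_⟩
  · rw [expand, expand, Finset.sum_comm]
    conv_rhs => rw [Finset.sum_comm]
    refine Finset.sum_congr rfl fun q _ => ?_
    rw [Finset.sum_comm]
    refine Finset.sum_congr rfl fun m _ => Finset.sum_congr rfl fun p _ => ?_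
    rw [hs' p m q, show T p q m = T m q p from H.codazzi hH hy q m p, hs' m q p]
    ring
  · refine Finset.sum_congr rfl fun m _ => ?_
    congr 1
    have : (Pᵀ * T m * P)ᵀ = Pᵀ * T m * P := by
      rw [Matrix.transpose_mul, Matrix.transpose_mul, hs, Matrix.transpose_transpose,
        Matrix.mul_assoc]
    exact congrFun (congrFun this j) i
  · rw [Finset.sum_comm]
    refine Finset.sum_eq_zero fun m _ => ?_
    rw [← Finset.mul_sum]
    have : ∑ i, (Pᵀ * T m * P) i i = 0 := by
      have h0 := H.pd_scalM_eq_zero hH hy m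
      rw [H.pd_scalM hy, trace_inv_mul hP] at h0
      exact h0
    rw [this, mul_zero]

/-- The differential inequality for `|E|²`, with `Q = |∇E|²`, together with the refined Kato
inequality. -/
lemma exists_bochner (hn : 3 ≤ n) (hH : IsHarmonicOn U G) (hP : IsFrame (G y) P) (hy : y ∈ U) :
    ∃ Q : ℝ, 0 ≤ Q ∧
      Q + (scalM G y / (n - 1) * sqEM G y
        - (n / (n - 2) * √(sqEM G y) + √(sqW (riemF G P y))) * sqEM G y)
          ≤ (1 / 2) * lap G (sqEM G) y ∧
      (n + 2) * gradM G (sqEM G) (sqEM G) y ≤ 4 * (n * sqEM G y * Q) := by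
  set r := riemF G P y with hr
  set T : Fin n → Fin n → Fin n → ℝ :=
    fun k i j => ∑ m, P m k * (Pᵀ * covTwo G (ricM G) m y * P) i j with hT
  have hTC : IsCodazziTraceless T := H.exists_codazzi_frame hH hP hy
  set E := Matrix.of (tfF r) with hE
  have hEs : ∀ a b, E a b = E b a := H.tfF_symm hP hy
  have hA : tfRicEnd G y = P * E * (Pᵀ * G y) := H.tfRicEnd_eq hP hy
  have hGP : G y * (P * Pᵀ) = 1 := by rw [← hP.inv_eq, H.mul_inv hy]
  have hAinv : tfRicEnd G y * (G y)⁻¹ = P * E * Pᵀ := by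
    rw [hA, hP.inv_eq]
    calc P * E * (Pᵀ * G y) * (P * Pᵀ) = P * E * Pᵀ * (G y * (P * Pᵀ)) := by noncomm_ring
      _ = _ := by rw [hGP, Matrix.mul_one]
  have hf : sqEM G y = sqE r := H.sqEM_eq hP hy
  -- in the frame, the gradient term of the Bochner formula is `|∇E|²`
  have hB : ∀ m, covEnd G (tfRicEnd G) m y = (G y)⁻¹ * covTwo G (ricM G) m y := by
    intro m
    rw [← H.mul_covEnd_tfRicEnd hH hy, ← Matrix.mul_assoc, H.inv_mul hy, Matrix.one_mul]
  have hpd : ∀ m, pd m (sqEM G) y = 2 * ∑ i, ∑ j, E i j * (Pᵀ * covTwo G (ricM G) m y * P) i j := by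
    intro m
    have e : (tfRicEnd G y * ((G y)⁻¹ * covTwo G (ricM G) m y)).trace
        = (E * (Pᵀ * covTwo G (ricM G) m y * P)).trace := by
      rw [← Matrix.mul_assoc, hAinv, Matrix.mul_assoc, Matrix.mul_assoc, Matrix.trace_mul_comm]
      simp only [Matrix.mul_assoc]
    rw [show sqEM G = fun z => (tfRicEnd G z * tfRicEnd G z).trace from rfl,
      H.pd_trace_sq H.smooth_tfRicEnd hy, hB, e]
    simp only [Matrix.trace, Matrix.diag, Matrix.mul_apply (M := E)]
    congr 1
    conv_rhs => rw [Finset.sum_comm]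
    exact Finset.sum_congr rfl fun j _ => Finset.sum_congr rfl fun i _ => by rw [hEs i j]
  have hgrad : gradM G (sqEM G) (sqEM G) y
      = 4 * ∑ k, (∑ i, ∑ j, tfF r i j * T k i j) ^ 2 := by
    rw [gradM, sum_inv_mul_mul hP, Finset.mul_sum]
    refine Finset.sum_congr rfl fun k _ => ?_
    have : ∑ m, P m k * pd m (sqEM G) y = 2 * ∑ i, ∑ j, tfF r i j * T k i j := by
      simp only [hpd, hT, Finset.mul_sum]
      rw [Finset.sum_comm]
      refine Finset.sum_congr rfl fun i _ => ?_
      rw [Finset.sum_comm]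
      refine Finset.sum_congr rfl fun j _ => Finset.sum_congr rfl fun m _ => ?_
      rw [hE, Matrix.of_apply]; ring
    rw [this]; ring
  have hQ : ∑ i, ∑ j, (G y)⁻¹ i j * (((G y)⁻¹ * covTwo G (ricM G) i y)
      * ((G y)⁻¹ * covTwo G (ricM G) j y)).trace = ∑ k, ∑ i, ∑ j, T k i j ^ 2 := by
    have e1 : ∀ i j, (G y)⁻¹ i j * (((G y)⁻¹ * covTwo G (ricM G) i y)
        * ((G y)⁻¹ * covTwo G (ricM G) j y)).trace = ∑ a, ∑ b, (G y)⁻¹ i j *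
          ((Pᵀ * covTwo G (ricM G) i y * P) a b * (Pᵀ * covTwo G (ricM G) j y * P) b a) := by
      intro i j
      rw [trace_inv_mul_mul hP]
      simp only [Matrix.trace, Matrix.diag, Finset.mul_sum,
        Matrix.mul_apply (M := Pᵀ * covTwo G (ricM G) i y * P)]
    simp only [e1]
    calc _ = ∑ a, ∑ b, ∑ i, ∑ j, (G y)⁻¹ i j * ((Pᵀ * covTwo G (ricM G) i y * P) a b
          * (Pᵀ * covTwo G (ricM G) j y * P) b a) := by
          rw [Finset.sum_congr rfl fun i _ => Finset.sum_comm, Finset.sum_comm]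
          refine Finset.sum_congr rfl fun a _ => ?_
          rw [Finset.sum_congr rfl fun i _ => Finset.sum_comm, Finset.sum_comm]
      _ = ∑ a, ∑ b, ∑ k, T k a b * T k b a := by
          refine Finset.sum_congr rfl fun a _ => Finset.sum_congr rfl fun b _ => ?_
          exact sum_inv_mul_mul hP _ _
      _ = _ := by
          rw [Finset.sum_congr rfl fun i _ => Finset.sum_comm, Finset.sum_comm]
          refine Finset.sum_congr rfl fun k _ => Finset.sum_congr rfl fun a _ =>
            Finset.sum_congr rfl fun b _ => ?_
          rw [← hTC.symm₂, sq]
  have hR1 : (tfRicEnd G y * (G y)⁻¹ * (ricM G y * tfRicEnd G y)).trace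
      = ∑ a, ∑ b, ∑ c, tfF r a b * ricF r b c * tfF r c a := by
    have e1 : tfRicEnd G y * (G y)⁻¹ * (ricM G y * tfRicEnd G y)
        = P * (E * (Pᵀ * ricM G y * P) * E * (Pᵀ * G y)) := by
      rw [hAinv, hA]; noncomm_ring
    rw [e1, Matrix.trace_mul_comm, Matrix.mul_assoc, hP.orth, Matrix.mul_one]
    have e2 : Pᵀ * ricM G y * P = Matrix.of (ricF r) := by
      ext a b; exact (H.ricF_riemF hP hy a b).symm
    rw [e2]
    simp only [Matrix.trace, Matrix.diag, Matrix.mul_apply, Finset.sum_mul, hE, Matrix.of_apply]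
    exact Finset.sum_congr rfl fun a _ => Finset.sum_comm
  have hR2 : ∑ k, ∑ l, (tfRicEnd G y * (G y)⁻¹) l k *
        ∑ i, ∑ p, tfRicEnd G y i p * curvM G i k y p l
      = ∑ a, ∑ b, ∑ c, ∑ d, tfF r a c * tfF r b d * r a b c d := by
    have e1 : ∀ i k, ∑ l, (P * E * Pᵀ) l k * (tfRicEnd G y * curvM G i k y) i l
        = ∑ a, ∑ b, ∑ c, ∑ d, tfF r a c * tfF r b d *
          (P i c * P k d * (Pᵀ * (G y * curvM G i k y) * P) a b) := by
      intro i k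
      have : ∑ l, (P * E * Pᵀ) l k * (tfRicEnd G y * curvM G i k y) i l
          = (P * (E * (Pᵀ * (G y * curvM G i k y) * P) * E) * Pᵀ) i k := by
        have h2 : P * (E * (Pᵀ * (G y * curvM G i k y) * P) * E) * Pᵀ
            = (tfRicEnd G y * curvM G i k y) * (P * E * Pᵀ) := by
          rw [hA]; noncomm_ring
        rw [h2, Matrix.mul_apply]
        exact Finset.sum_congr rfl fun l _ => mul_comm _ _
      rw [this]
      generalize Pᵀ * (G y * curvM G i k y) * P = X
      simp only [Matrix.mul_apply, Matrix.transpose_apply, Finset.mul_sum, Finset.sum_mul]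
      rw [← sum_rev₄]
      refine Finset.sum_congr rfl fun d _ => Finset.sum_congr rfl fun c _ =>
        Finset.sum_congr rfl fun b _ => Finset.sum_congr rfl fun a _ => ?_
      simp only [hE, Matrix.of_apply]
      rw [H.tfF_symm hP hy b d]
      ring
    calc _ = ∑ k, ∑ i, ∑ l, (P * E * Pᵀ) l k * (tfRicEnd G y * curvM G i k y) i l := by
          refine Finset.sum_congr rfl fun k _ => ?_
          rw [Finset.sum_comm]
          refine Finset.sum_congr rfl fun l _ => ?_
          rw [hAinv, Finset.mul_sum]
          simp only [Matrix.mul_apply (M := tfRicEnd G y)]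
      _ = ∑ k, ∑ i, ∑ a, ∑ b, ∑ c, ∑ d, tfF r a c * tfF r b d *
          (P i c * P k d * (Pᵀ * (G y * curvM G i k y) * P) a b) := by simp only [e1]
      _ = _ := by
          rw [sum_comm₄₂]
          simp only [hr, riemF, Finset.mul_sum]
  refine ⟨∑ k, ∑ i, ∑ j, T k i j ^ 2, Finset.sum_nonneg fun _ _ => Finset.sum_nonneg fun _ _ =>
    Finset.sum_nonneg fun _ _ => sq_nonneg _, ?_, ?_⟩
  · have h1 := bochner_curvature_term hn r (H.tfF_symm hP hy)
    have h2 : lap G (sqEM G) y = _ := H.lap_normSq_tfRic hH hy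
    rw [h2, hQ, hR1, hR2, hf, ← H.scalF_riemF hP hy]
    linarith
  · have h1 := refined_kato (by omega : 2 ≤ n) (H.tfF_symm hP hy) (tfF_trace (by omega) r) hTC
    rw [hgrad, hf]
    have h3 : sqE r = ∑ i, ∑ j, tfF r i j ^ 2 := rfl
    rw [h3]
    linarith

end IsLocalMetric

end Frames

/-! ### Change of coordinates -/

section ChangeOfCoordinates

open Matrix

variable {n : ℕ}

/-- The Jacobian matrix. -/
def jac (τ : Coord n → Coord n) : MatFun n := fun y => Matrix.of fun a i => pd i (fun z => τ z a) y

/-- The coordinate change `τ`, defined on `V` with values in `U`, pulls `G` back to `G'`. -/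
structure IsPullback (V U : Set (Coord n)) (τ : Coord n → Coord n) (G' G : MatFun n) : Prop where
  smooth : ContDiffOn ℝ ∞ τ V
  mapsTo : ∀ y ∈ V, τ y ∈ U
  metric_eq : ∀ y ∈ V, G' y = (jac τ y)ᵀ * G (τ y) * jac τ y

variable {U V : Set (Coord n)} {G G' : MatFun n} {τ : Coord n → Coord n} {y : Coord n}

lemma contDiffOn_coord (hτ : ContDiffOn ℝ ∞ τ V) (a : Fin n) :
    ContDiffOn ℝ ∞ (fun z => τ z a) V :=
  (contDiffOn_piLp 2).1 hτ a

lemma smoothMat_jac (hV : IsOpen V) (hτ : ContDiffOn ℝ ∞ τ V) : SmoothMat V (jac τ) :=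
  fun a i => contDiffOn_pd hV (contDiffOn_coord hτ a) i

lemma SmoothMat.comp {A : MatFun n} (hA : SmoothMat U A) (hτ : ContDiffOn ℝ ∞ τ V)
    (h : ∀ y ∈ V, τ y ∈ U) : SmoothMat V (fun z => A (τ z)) :=
  fun a b => (hA a b).comp hτ h

lemma pdM_comp {A : MatFun n} (hU : IsOpen U) (hV : IsOpen V) (hA : SmoothMat U A)
    (hτ : ContDiffOn ℝ ∞ τ V) (h : ∀ y ∈ V, τ y ∈ U) (hy : y ∈ V) (i : Fin n) :
    pdM i (fun z => A (τ z)) y = ∑ a, jac τ y a i • pdM a A (τ y) := by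
  ext c d
  simp only [Matrix.sum_apply, Matrix.smul_apply, smul_eq_mul]
  exact pd_comp (f := fun z => A z c d) (hA.differentiableAt hU (h y hy) c d)
    (fun a => differentiableAt_of_contDiffOn hV (contDiffOn_coord hτ a) hy) i

lemma pdM_jac_symm (hV : IsOpen V) (hτ : ContDiffOn ℝ ∞ τ V) (hy : y ∈ V) (i j a : Fin n) :
    pdM i (jac τ) y a j = pdM j (jac τ) y a i :=
  pd_comm hV (contDiffOn_coord hτ a) hy i j

/-- The pulled back connection matrices `∂ᵢτᵃ Γₐ ∘ τ`. -/
def chrPull (G : MatFun n) (τ : Coord n → Coord n) (i : Fin n) : MatFun n := fun y =>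
  ∑ a, jac τ y a i • chrM G a (τ y)

namespace IsPullback

variable (h : IsPullback V U τ G' G) (H : IsLocalMetric U G) (H' : IsLocalMetric V G')

include h H H'

omit H in
lemma isUnit_jac (hy : y ∈ V) : IsUnit (jac τ y).det := by
  have h1 := H'.det_ne_zero hy
  rw [h.metric_eq y hy, Matrix.det_mul] at h1
  exact isUnit_iff_ne_zero.2 (right_ne_zero_of_mul h1)

/-- The Levi-Civita connection transforms by a gauge transformation. -/
lemma jac_mul_chrM (hy : y ∈ V) (i : Fin n) :
    jac τ y * chrM G' i y = chrPull G τ i y * jac τ y + pdM i (jac τ) y := by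
  have hu := h.isUnit_jac H' hy
  have hJ := smoothMat_jac H'.isOpen h.smooth
  set J := jac τ y with hJd
  set X : Fin n → Matrix (Fin n) (Fin n) ℝ := fun i => chrPull G τ i y * J + pdM i (jac τ) y with hX
  set C : Fin n → Matrix (Fin n) (Fin n) ℝ := fun i => J⁻¹ * X i with hC
  have hXs : ∀ i j p, X i p j = X j p i := by
    intro i j p
    have : ∀ i j, (chrPull G τ i y * J) p j
        = ∑ a, ∑ b, J a i * (chrM G a (τ y) p b * J b j) := by
      intro i j
      simp only [chrPull, Finset.sum_mul, Matrix.sum_apply, Matrix.smul_apply,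
        smul_eq_mul, Matrix.mul_apply, hJd]
      rw [Finset.sum_comm]
      exact Finset.sum_congr rfl fun a _ => Finset.sum_congr rfl fun b _ => by ring
    simp only [hX, Matrix.add_apply]
    rw [this, this, pdM_jac_symm H'.isOpen h.smooth hy i j p, Finset.sum_comm]
    congr 1
    refine Finset.sum_congr rfl fun a _ => Finset.sum_congr rfl fun b _ => ?_
    rw [H.chrM_symm (h.mapsTo y hy) b a p]
    ring
  have hJC : ∀ i, J * C i = X i := fun i => by
    rw [hC]; simp only; rw [← Matrix.mul_assoc, Matrix.mul_nonsing_inv _ hu, Matrix.one_mul]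
  have hCs : ∀ i j k, C i k j = C j k i := by
    intro i j k
    simp only [hC, Matrix.mul_apply]
    exact Finset.sum_congr rfl fun p _ => by rw [hXs]
  have hGt : SmoothMat V (fun z => G (τ z)) := H.smooth.comp h.smooth h.mapsTo
  have hcomp : ∀ i, pdM i G' y = (C i)ᵀ * G' y + G' y * C i := by
    intro i
    have e0 : pdM i (fun z => G (τ z)) y
        = (chrPull G τ i y)ᵀ * G (τ y) + G (τ y) * chrPull G τ i y := by
      rw [pdM_comp H.isOpen H'.isOpen H.smooth h.smooth h.mapsTo hy]
      simp only [H.pdM_metric (h.mapsTo y hy), chrPull, Matrix.transpose_sum, Finset.sum_mul,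
        Finset.mul_sum, ← Finset.sum_add_distrib, Matrix.transpose_smul, Matrix.smul_mul,
        Matrix.mul_smul, smul_add]
    have e1 : pdM i G' y = (pdM i (jac τ) y)ᵀ * G (τ y) * J
        + Jᵀ * ((chrPull G τ i y)ᵀ * G (τ y) + G (τ y) * chrPull G τ i y) * J
        + Jᵀ * G (τ y) * pdM i (jac τ) y := by
      rw [pdM_congr H'.isOpen h.metric_eq hy, pdM_mul H'.isOpen (hJ.transpose.mul hGt) hJ hy,
        pdM_mul H'.isOpen hJ.transpose hGt hy, e0, pdM_transpose, Matrix.add_mul]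
    have e2 : G' y * C i = Jᵀ * G (τ y) * X i := by
      rw [h.metric_eq y hy, Matrix.mul_assoc, hJC]
    have e3 : (C i)ᵀ * G' y = (X i)ᵀ * G (τ y) * J := by
      rw [h.metric_eq y hy]
      conv_rhs => rw [← hJC i, Matrix.transpose_mul]
      simp only [Matrix.mul_assoc]
      rfl
    rw [e1, e2, e3, hX]
    simp only [Matrix.transpose_add, Matrix.transpose_mul]
    noncomm_ring
  rw [← H'.eq_chrM_of_compatible hy hCs hcomp i, hJC]

/-- The curvature transforms as a tensor. -/
lemma jac_mul_curvM (hy : y ∈ V) (k l : Fin n) : jac τ y * curvM G' k l y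
    = (∑ a, ∑ b, (jac τ y a k * jac τ y b l) • curvM G a b (τ y)) * jac τ y := by
  have hJ := smoothMat_jac H'.isOpen h.smooth
  have hΓ : ∀ a, SmoothMat V (fun z => chrM G a (τ z)) := fun a =>
    (H.smooth_chrM a).comp h.smooth h.mapsTo
  have hΓτ : ∀ l, SmoothMat V (chrPull G τ l) := fun l =>
    SmoothMat.sum fun a _ => SmoothMat.smul (hJ a l) (hΓ a)
  -- the derivative of the transformation law of the connection
  have hd : ∀ k l, pdM k (jac τ) y * chrM G' l y + jac τ y * pdM k (chrM G' l) y
      = pdM k (chrPull G τ l) y * jac τ y + chrPull G τ l y * pdM k (jac τ) y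
        + pdM k (pdM l (jac τ)) y := by
    intro k l
    rw [← pdM_mul H'.isOpen hJ (H'.smooth_chrM l) hy,
      pdM_congr H'.isOpen (fun z hz => h.jac_mul_chrM H H' hz l) hy,
      pdM_add H'.isOpen ((hΓτ l).mul hJ) (hJ.pdM H'.isOpen l) hy,
      pdM_mul H'.isOpen (hΓτ l) hJ hy]
  have hF : jac τ y * curvM G' k l y = (pdM k (chrPull G τ l) y - pdM l (chrPull G τ k) y
      + (chrPull G τ k y * chrPull G τ l y - chrPull G τ l y * chrPull G τ k y)) * jac τ y := by
    have g : ∀ i, jac τ y * chrM G' i y = chrPull G τ i y * jac τ y + pdM i (jac τ) y :=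
      fun i => h.jac_mul_chrM H H' hy i
    have d1 : ∀ k l, jac τ y * pdM k (chrM G' l) y = pdM k (chrPull G τ l) y * jac τ y
        + chrPull G τ l y * pdM k (jac τ) y + pdM k (pdM l (jac τ)) y
        - pdM k (jac τ) y * chrM G' l y := fun k l => by rw [← hd]; abel
    have d2 : ∀ k l, jac τ y * (chrM G' k y * chrM G' l y)
        = chrPull G τ k y * (chrPull G τ l y * jac τ y + pdM l (jac τ) y)
          + pdM k (jac τ) y * chrM G' l y := by
      intro k l
      rw [← Matrix.mul_assoc, g, Matrix.add_mul, Matrix.mul_assoc, g]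
    simp only [curvM, Matrix.mul_add, Matrix.mul_sub, d1, d2]
    rw [pdM_comm H'.isOpen hJ hy k l]
    noncomm_ring
  rw [hF]
  congr 1
  have p : ∀ k l, pdM k (chrPull G τ l) y = ∑ a, pdM k (jac τ) y a l • chrM G a (τ y)
      + ∑ a, ∑ b, (jac τ y a l * jac τ y b k) • pdM b (chrM G a) (τ y) := by
    intro k l
    have e : pdM k (chrPull G τ l) y
        = pdM k (fun z => ∑ a, jac τ z a l • chrM G a (τ z)) y := rfl
    rw [e, pdM_sum (F := fun a z => jac τ z a l • chrM G a (τ z)) H'.isOpen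
      (fun a _ => SmoothMat.smul (hJ a l) (hΓ a)) hy, ← Finset.sum_add_distrib]
    refine Finset.sum_congr rfl fun a _ => ?_
    rw [pdM_smul H'.isOpen (hJ a l) (hΓ a) hy, pdM_comp H.isOpen H'.isOpen (H.smooth_chrM a)
      h.smooth h.mapsTo hy, Finset.smul_sum]
    simp only [smul_smul]
    rfl
  have q : ∀ k l, chrPull G τ k y * chrPull G τ l y
      = ∑ a, ∑ b, (jac τ y a k * jac τ y b l) • (chrM G a (τ y) * chrM G b (τ y)) := by
    intro k l
    simp only [chrPull, Finset.sum_mul_sum, Matrix.smul_mul, Matrix.mul_smul, smul_smul]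
    refine Finset.sum_congr rfl fun a _ => Finset.sum_congr rfl fun b _ => ?_
    rw [mul_comm]
  have s : ∑ a, pdM k (jac τ) y a l • chrM G a (τ y) = ∑ a, pdM l (jac τ) y a k • chrM G a (τ y) :=
    Finset.sum_congr rfl fun a _ => by rw [pdM_jac_symm H'.isOpen h.smooth hy]
  have c1 : ∑ a, ∑ b, (jac τ y a l * jac τ y b k) • pdM b (chrM G a) (τ y)
      = ∑ a, ∑ b, (jac τ y a k * jac τ y b l) • pdM a (chrM G b) (τ y) := by
    rw [Finset.sum_comm]
    exact Finset.sum_congr rfl fun a _ => Finset.sum_congr rfl fun b _ => by rw [mul_comm]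
  have c2 : ∑ a, ∑ b, (jac τ y a l * jac τ y b k) • (chrM G a (τ y) * chrM G b (τ y))
      = ∑ a, ∑ b, (jac τ y a k * jac τ y b l) • (chrM G b (τ y) * chrM G a (τ y)) := by
    rw [Finset.sum_comm]
    exact Finset.sum_congr rfl fun a _ => Finset.sum_congr rfl fun b _ => by rw [mul_comm]
  rw [p, p, q, q, s, c1, c2]
  simp only [curvM, smul_add, smul_sub, Finset.sum_add_distrib, Finset.sum_sub_distrib]
  abel

omit H in
lemma isFrame {P : Matrix (Fin n) (Fin n) ℝ} (hy : y ∈ V) (hP : IsFrame (G' y) P) :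
    IsFrame (G (τ y)) (jac τ y * P) := by
  have hu := h.isUnit_jac H' hy
  have hut : IsUnit (jac τ y)ᵀ.det := by rwa [Matrix.det_transpose]
  constructor
  · have h1 := hP.inv_eq
    rw [h.metric_eq y hy, Matrix.mul_inv_rev, Matrix.mul_inv_rev] at h1
    have h2 := congrArg (fun X => jac τ y * X * (jac τ y)ᵀ) h1
    rw [Matrix.transpose_mul, Matrix.mul_assoc, ← Matrix.mul_assoc P, ← Matrix.mul_assoc, ← h2,
      ← Matrix.mul_assoc (jac τ y), Matrix.mul_nonsing_inv _ hu, Matrix.one_mul, Matrix.mul_assoc,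
      Matrix.nonsing_inv_mul _ hut, Matrix.mul_one]
  · rw [← hP.orth, h.metric_eq y hy, Matrix.transpose_mul]
    simp only [Matrix.mul_assoc]

/-- The frame components of the curvature do not depend on the coordinates. -/
lemma riemF_eq {P : Matrix (Fin n) (Fin n) ℝ} (hy : y ∈ V) :
    riemF G' P y = riemF G (jac τ y * P) (τ y) := by
  funext a b c d
  set J := jac τ y
  have h1 : ∀ k l, Pᵀ * (G' y * curvM G' k l y) * P
      = ∑ p, ∑ q, (J p k * J q l) • ((J * P)ᵀ * (G (τ y) * curvM G p q (τ y)) * (J * P)) := by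
    intro k l
    have e : Pᵀ * (G' y * curvM G' k l y) * P
        = (J * P)ᵀ * (G (τ y) * (J * curvM G' k l y)) * P := by
      rw [h.metric_eq y hy, Matrix.transpose_mul]
      simp only [Matrix.mul_assoc]
      rfl
    rw [e, h.jac_mul_curvM H H' hy]
    simp only [Finset.sum_mul, Finset.mul_sum, Matrix.smul_mul, Matrix.mul_smul, Matrix.mul_assoc]
    rfl
  have h2 : ∀ p c, (J * P) p c = ∑ k, J p k * P k c := fun p c => Matrix.mul_apply
  simp only [riemF, h1, Matrix.sum_apply, Matrix.smul_apply, smul_eq_mul, Finset.mul_sum]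
  have sc : ∀ f : Fin n → Fin n → Fin n → Fin n → ℝ,
      ∑ k, ∑ l, ∑ p, ∑ q, f k l p q = ∑ p, ∑ q, ∑ k, ∑ l, f k l p q := by
    intro f
    have := Finset.sum_comm (s := (Finset.univ : Finset (Fin n × Fin n)))
      (t := (Finset.univ : Finset (Fin n × Fin n))) (f := fun u v => f u.1 u.2 v.1 v.2)
    simpa only [Fintype.sum_prod_type] using this
  rw [sc]
  refine Finset.sum_congr rfl fun p _ => Finset.sum_congr rfl fun q _ => ?_
  rw [h2 p c, h2 q d, Finset.sum_mul_sum, Finset.sum_mul]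
  refine Finset.sum_congr rfl fun k _ => ?_
  rw [Finset.sum_mul]
  exact Finset.sum_congr rfl fun l _ => by ring

omit H in
lemma gradM_comp {f f' : Coord n → ℝ} (hy : y ∈ V) (hf : DifferentiableAt ℝ f (τ y))
    (hf' : DifferentiableAt ℝ f' (τ y)) :
    gradM G' (fun z => f (τ z)) (fun z => f' (τ z)) y = gradM G f f' (τ y) := by
  obtain ⟨P, hP⟩ := exists_isFrame (H'.posDef y hy)
  have hP' := h.isFrame H' hy hP
  have key : ∀ g : Coord n → ℝ, DifferentiableAt ℝ g (τ y) → ∀ a,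
      ∑ i, P i a * pd i (fun z => g (τ z)) y = ∑ b, (jac τ y * P) b a * pd b g (τ y) := by
    intro g hg a
    have : ∀ i, pd i (fun z => g (τ z)) y = ∑ b, jac τ y b i * pd b g (τ y) := fun i =>
      pd_comp hg (fun c => differentiableAt_of_contDiffOn H'.isOpen
        (contDiffOn_coord h.smooth c) hy) i
    simp only [this, Matrix.mul_apply, Finset.mul_sum, Finset.sum_mul]
    rw [Finset.sum_comm]
    exact Finset.sum_congr rfl fun b _ => Finset.sum_congr rfl fun i _ => by ring
  rw [gradM, gradM, sum_inv_mul_mul hP, sum_inv_mul_mul hP']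
  exact Finset.sum_congr rfl fun a _ => by rw [key f hf, key f' hf']

end IsPullback

end ChangeOfCoordinates

/-! ### Charts of a Riemannian manifold -/

section Charts

variable {n : ℕ} {M : Type*} [TopologicalSpace M] [ChartedSpace (Coord n) M]

/-- The open set of coordinates of the preferred chart around `x₀`. -/
abbrev tgt (n : ℕ) {M : Type*} [TopologicalSpace M] [ChartedSpace (Coord n) M] (x₀ : M) :
    Set (Coord n) := (extChartAt (𝓡 n) x₀).target

/-- The domain of the preferred chart around `x₀`. -/
abbrev src (n : ℕ) {M : Type*} [TopologicalSpace M] [ChartedSpace (Coord n) M] (x₀ : M) :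
    Set M := (extChartAt (𝓡 n) x₀).source

lemma isOpen_tgt (x₀ : M) : IsOpen (tgt n x₀) := isOpen_extChartAt_target x₀

lemma isOpen_src (x₀ : M) : IsOpen (src n x₀) := isOpen_extChartAt_source x₀

lemma ownCoord_mem (x : M) : (ownCoord x : Coord n) ∈ tgt n x := mem_extChartAt_target x

lemma chartPt_ownCoord (x : M) : chartPt x (ownCoord x : Coord n) = x := extChartAt_to_inv x

lemma chartPt_mem_src {x₀ : M} {y : Coord n} (hy : y ∈ tgt n x₀) : chartPt x₀ y ∈ src n x₀ :=
  (extChartAt (𝓡 n) x₀).map_target hy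

lemma extChartAt_chartPt {x₀ : M} {y : Coord n} (hy : y ∈ tgt n x₀) :
    extChartAt (𝓡 n) x₀ (chartPt x₀ y) = y := (extChartAt (𝓡 n) x₀).right_inv hy

lemma chartPt_extChartAt {x₀ x : M} (hx : x ∈ src n x₀) :
    chartPt x₀ (extChartAt (𝓡 n) x₀ x) = x := (extChartAt (𝓡 n) x₀).left_inv hx

variable [IsManifold (𝓡 n) ∞ M]

lemma contMDiffOn_chartPt (x₀ : M) : ContMDiffOn (𝓡 n) (𝓡 n) ∞ (chartPt x₀) (tgt n x₀) :=
  contMDiffOn_extChartAt_symm x₀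

lemma continuousOn_chartPt (x₀ : M) : ContinuousOn (chartPt x₀) (tgt n x₀) :=
  (contMDiffOn_chartPt x₀).continuousOn

lemma mdifferentiableAt_chartPt {x₀ : M} {y : Coord n} (hy : y ∈ tgt n x₀) :
    MDifferentiableAt (𝓡 n) (𝓡 n) (chartPt x₀) y :=
  ((contMDiffOn_chartPt x₀).mdifferentiableOn (by simp)).mdifferentiableAt
    ((isOpen_tgt x₀).mem_nhds hy)

/-- The change of coordinates from the chart at `x₁` to the chart at `x₀`. -/
def trans (x₁ x₀ : M) (y : Coord n) : Coord n := extChartAt (𝓡 n) x₀ (chartPt x₁ y)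

/-- The coordinates in the chart at `x₁` of the points that also lie in the chart at `x₀`. -/
def overlap (n : ℕ) {M : Type*} [TopologicalSpace M] [ChartedSpace (Coord n) M] (x₁ x₀ : M) :
    Set (Coord n) := tgt n x₁ ∩ chartPt x₁ ⁻¹' src n x₀

omit [IsManifold (𝓡 n) ∞ M] in
lemma isOpen_overlap (x₁ x₀ : M) : IsOpen (overlap n x₁ x₀) :=
  (continuousOn_extChartAt_symm x₁).isOpen_inter_preimage (isOpen_tgt x₁) (isOpen_src x₀)

omit [IsManifold (𝓡 n) ∞ M] in
lemma trans_mem {x₁ x₀ : M} {y : Coord n} (hy : y ∈ overlap n x₁ x₀) : trans x₁ x₀ y ∈ tgt n x₀ :=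
  (extChartAt (𝓡 n) x₀).map_source hy.2

omit [IsManifold (𝓡 n) ∞ M] in
lemma chartPt_trans {x₁ x₀ : M} {y : Coord n} (hy : y ∈ overlap n x₁ x₀) :
    chartPt x₀ (trans x₁ x₀ y) = chartPt x₁ y := chartPt_extChartAt hy.2

lemma contDiffOn_trans (x₁ x₀ : M) :
    ContDiffOn ℝ ∞ (trans x₁ x₀ : Coord n → Coord n) (overlap n x₁ x₀) := by
  rw [← contMDiffOn_iff_contDiffOn]
  refine ((contMDiffOn_extChartAt (x := x₀)).comp ((contMDiffOn_chartPt x₁).mono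
    Set.inter_subset_left) ?_)
  intro y hy
  rw [← extChartAt_source (𝓡 n)]
  exact hy.2

variable [RiemannianBundle (fun x : M => TangentSpace (𝓡 n) x)]

omit [RiemannianBundle (fun x : M => TangentSpace (𝓡 n) x)] in
lemma contMDiffOn_coordVec (x₀ : M) (i : Fin n) :
    ContMDiffOn (𝓡 n) (𝓡 n).tangent ∞
      (fun y : Coord n => (⟨chartPt x₀ y, coordVec x₀ i y⟩ : TangentBundle (𝓡 n) M)) (tgt n x₀) := by
  have h1 := (contMDiffOn_chartPt (n := n) x₀).contMDiffOn_tangentMapWithin (m := ∞) (by simp)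
    (isOpen_tgt x₀).uniqueMDiffOn
  have h2 : ContMDiffOn (𝓡 n) (𝓡 n).tangent ∞ (fun y : Coord n =>
      (⟨y, EuclideanSpace.single i (1 : ℝ)⟩ : TangentBundle (𝓡 n) (Coord n))) (tgt n x₀) :=
    contMDiffOn_vectorSpace_iff_contDiffOn.2 contDiffOn_const
  refine (h1.comp h2 fun y hy => hy).congr fun y hy => ?_
  simp only [Function.comp_apply, tangentMapWithin, coordVec]
  rw [mfderivWithin_eq_mfderiv ((isOpen_tgt x₀).uniqueMDiffWithinAt hy)
    (mdifferentiableAt_chartPt hy)]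

omit [RiemannianBundle (fun x : M => TangentSpace (𝓡 n) x)] in
/-- The derivative of the chart inverts that of its inverse. -/
lemma mfderiv_extChartAt_comp_chartPt {x₀ : M} {y : Coord n} (hy : y ∈ tgt n x₀) (v : Coord n) :
    mfderiv (𝓡 n) (𝓡 n) (extChartAt (𝓡 n) x₀) (chartPt x₀ y)
      (mfderiv (𝓡 n) (𝓡 n) (chartPt x₀) y v) = v := by
  have h1 : mfderiv (𝓡 n) (𝓡 n) (extChartAt (𝓡 n) x₀ ∘ chartPt x₀) y v = v := by
    have : (extChartAt (𝓡 n) x₀ ∘ chartPt x₀) =ᶠ[nhds y] (id : Coord n → Coord n) := by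
      filter_upwards [(isOpen_tgt x₀).mem_nhds hy] with z hz using extChartAt_chartPt hz
    rw [this.mfderiv_eq, mfderiv_id]; rfl
  have h2 : MDifferentiableAt (𝓡 n) (𝓡 n) (extChartAt (𝓡 n) x₀) (chartPt x₀ y) := by
    apply mdifferentiableAt_extChartAt
    rw [← extChartAt_source (𝓡 n)]
    exact chartPt_mem_src hy
  rw [mfderiv_comp y h2 (mdifferentiableAt_chartPt hy)] at h1
  exact h1

omit [RiemannianBundle (fun x : M => TangentSpace (𝓡 n) x)] [IsManifold (𝓡 n) ∞ M] in
lemma mfderiv_chartPt_eq_sum (x₀ : M) (y v : Coord n) :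
    mfderiv (𝓡 n) (𝓡 n) (chartPt x₀) y v = ∑ i, v i • coordVec x₀ i y := by
  have : v = ∑ i, v i • EuclideanSpace.single i (1 : ℝ) := by
    ext j; simp [EuclideanSpace.single, Pi.single_apply]
  conv_lhs => rw [this]
  exact (map_sum (mfderiv (𝓡 n) (𝓡 n) (chartPt x₀) y) _ _).trans
    (Finset.sum_congr rfl fun i _ => map_smul _ _ _)

omit [IsManifold (𝓡 n) ∞ M] in
lemma inner_sum_coordVec (x₀ : M) (y : Coord n) (v w : Fin n → ℝ) :
    inner ℝ (∑ i, v i • coordVec x₀ i y) (∑ j, w j • coordVec x₀ j y)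
      = ∑ i, ∑ j, v i * w j * gLow x₀ y i j := by
  rw [sum_inner]
  refine Finset.sum_congr rfl fun i _ => ?_
  rw [inner_sum]
  refine Finset.sum_congr rfl fun j _ => ?_
  rw [real_inner_smul_left, real_inner_smul_right, gLow, Matrix.of_apply]
  ring

variable [IsContMDiffRiemannianBundle (𝓡 n) ∞ (Coord n) (fun x : M => TangentSpace (𝓡 n) x)]

/-- The components of the metric in a chart.  Smoothness comes from that of the coordinate vector
fields, positivity from their linear independence. -/
lemma isLocalMetric_gLow (x₀ : M) : IsLocalMetric (tgt n x₀) (gLow x₀) where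
  isOpen := isOpen_tgt x₀
  smooth := fun a b => by
    rw [← contMDiffOn_iff_contDiffOn]
    exact (contMDiffOn_coordVec x₀ a).inner_bundle (contMDiffOn_coordVec x₀ b)
  posDef := fun y hy => by
    refine Matrix.PosDef.of_dotProduct_mulVec_pos ?_ fun v hv => ?_
    · ext i j
      simp only [Matrix.conjTranspose_apply, gLow, Matrix.of_apply, star_trivial]
      exact real_inner_comm _ _
    · have h1 : star v ⬝ᵥ (gLow x₀ y).mulVec v
          = inner ℝ (∑ i, v i • coordVec x₀ i y) (∑ j, v j • coordVec x₀ j y) := by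
        rw [inner_sum_coordVec]
        simp only [dotProduct, Matrix.mulVec, star_trivial, Finset.mul_sum]
        exact Finset.sum_congr rfl fun i _ => Finset.sum_congr rfl fun j _ => by ring
      rw [h1]
      refine lt_of_le_of_ne real_inner_self_nonneg fun h0 => hv ?_
      have h2 : ∑ i, v i • coordVec x₀ i y = 0 := inner_self_eq_zero.1 h0.symm
      have h3 := mfderiv_extChartAt_comp_chartPt hy (WithLp.toLp 2 v)
      rw [mfderiv_chartPt_eq_sum] at h3
      rw [h2, map_zero] at h3
      have h4 := congrArg WithLp.ofLp h3
      exact h4.symm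

lemma isLocalMetric_gLow_overlap (x₁ x₀ : M) : IsLocalMetric (overlap n x₁ x₀) (gLow x₁) where
  isOpen := isOpen_overlap x₁ x₀
  smooth := fun a b => ((isLocalMetric_gLow x₁).smooth a b).mono Set.inter_subset_left
  posDef := fun y hy => (isLocalMetric_gLow x₁).posDef y hy.1

omit [RiemannianBundle (fun x : M => TangentSpace (𝓡 n) x)]
  [IsContMDiffRiemannianBundle (𝓡 n) ∞ (Coord n) (fun x : M => TangentSpace (𝓡 n) x)] in
lemma coordVec_eq_sum {x₁ x₀ : M} {y : Coord n} (hy : y ∈ overlap n x₁ x₀) (i : Fin n) :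
    (coordVec x₁ i y : Coord n)
      = ∑ a, jac (trans x₁ x₀) y a i • (coordVec x₀ a (trans x₁ x₀ y) : Coord n) := by
  have h1 : chartPt x₁ =ᶠ[nhds y] chartPt x₀ ∘ trans x₁ x₀ := by
    filter_upwards [(isOpen_overlap x₁ x₀).mem_nhds hy] with z hz using (chartPt_trans hz).symm
  have hd : DifferentiableAt ℝ (trans x₁ x₀ : Coord n → Coord n) y :=
    ((contDiffOn_trans x₁ x₀).differentiableOn (by simp)).differentiableAt
      ((isOpen_overlap x₁ x₀).mem_nhds hy)
  have h2 : mfderiv (𝓡 n) (𝓡 n) (chartPt x₁) y (EuclideanSpace.single i (1 : ℝ))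
      = mfderiv (𝓡 n) (𝓡 n) (chartPt x₀) (trans x₁ x₀ y)
        (fderiv ℝ (trans x₁ x₀) y (EuclideanSpace.single i (1 : ℝ))) := by
    rw [h1.mfderiv_eq, mfderiv_comp y (mdifferentiableAt_chartPt (trans_mem hy))
      hd.mdifferentiableAt, mfderiv_eq_fderiv]
    rfl
  have h3 : ∀ a, (fderiv ℝ (trans x₁ x₀) y (EuclideanSpace.single i (1 : ℝ))) a
      = jac (trans x₁ x₀) y a i := by
    intro a
    have := ((EuclideanSpace.proj a : Coord n →L[ℝ] ℝ).hasFDerivAt.comp y hd.hasFDerivAt).fderiv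
    simp only [jac, Matrix.of_apply, pd]
    exact (congrArg (fun L => L (EuclideanSpace.single i (1 : ℝ))) this).symm
  rw [mfderiv_chartPt_eq_sum x₀ (trans x₁ x₀ y)] at h2
  simp only [h3] at h2
  exact h2

omit [IsManifold (𝓡 n) ∞ M]
  [IsContMDiffRiemannianBundle (𝓡 n) ∞ (Coord n) (fun x : M => TangentSpace (𝓡 n) x)] in
lemma inner_congr_base {p q : M} (h : p = q) (v w : Coord n) :
    @inner ℝ (TangentSpace (𝓡 n) p) _ v w = @inner ℝ (TangentSpace (𝓡 n) q) _ v w := by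
  subst h; rfl

omit [IsContMDiffRiemannianBundle (𝓡 n) ∞ (Coord n) (fun x : M => TangentSpace (𝓡 n) x)] in
/-- The change of coordinates is an isometry of the coordinate expressions of the metric. -/
lemma isPullback_trans (x₁ x₀ : M) :
    IsPullback (overlap n x₁ x₀) (tgt n x₀) (trans x₁ x₀) (gLow x₁) (gLow x₀) where
  smooth := contDiffOn_trans x₁ x₀
  mapsTo := fun _ hy => trans_mem hy
  metric_eq := fun y hy => by
    ext i j
    have h1 : gLow x₁ y i j = inner ℝ
        (∑ a, jac (trans x₁ x₀) y a i • coordVec x₀ a (trans x₁ x₀ y))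
        (∑ a, jac (trans x₁ x₀) y a j • coordVec x₀ a (trans x₁ x₀ y)) := by
      have e := inner_congr_base (chartPt_trans hy).symm (coordVec x₁ i y) (coordVec x₁ j y)
      rw [coordVec_eq_sum hy i, coordVec_eq_sum hy j] at e
      rw [gLow, Matrix.of_apply]
      refine Eq.trans ?_ e
      rw [← coordVec_eq_sum hy i, ← coordVec_eq_sum hy j]
    rw [h1, inner_sum_coordVec]
    simp only [Matrix.mul_apply, Matrix.transpose_apply, Finset.sum_mul]
    rw [Finset.sum_comm]
    exact Finset.sum_congr rfl fun a _ => Finset.sum_congr rfl fun b _ => by ring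

end Charts

/-! ### Curvature invariants do not depend on the chart -/

section Contraction

open Matrix

variable {n : ℕ}

/-- Contraction of one pair of indices in terms of frame components. -/
lemma sum_inv_mul_sum {σ : Type*} [Fintype σ] {g P : Matrix (Fin n) (Fin n) ℝ}
    (hP : IsFrame g P) (f f' : Fin n → σ → ℝ) :
    ∑ i, ∑ a, g⁻¹ i a * ∑ q, f i q * f' a q
      = ∑ s, ∑ q, (∑ i, P i s * f i q) * ∑ a, P a s * f' a q := by
  have h : ∀ q, ∑ i, ∑ a, g⁻¹ i a * (f i q * f' a q)
      = ∑ s, (∑ i, P i s * f i q) * ∑ a, P a s * f' a q := fun q =>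
    sum_inv_mul_mul hP (fun i => f i q) (fun a => f' a q)
  calc _ = ∑ q, ∑ i, ∑ a, g⁻¹ i a * (f i q * f' a q) := by
        simp only [Finset.mul_sum]
        rw [Finset.sum_congr rfl fun i _ => Finset.sum_comm, Finset.sum_comm]
    _ = _ := by
        simp only [h]
        exact Finset.sum_comm

/-- The frame components of a covariant four-tensor. -/
def frame4 (P : Matrix (Fin n) (Fin n) ℝ) (X : Arr4 n) : Arr4 n := fun a b c d =>
  ∑ i, P i a * ∑ j, P j b * ∑ k, P k c * ∑ l, P l d * X i j k l

lemma sum_inv_mul_mul₂ {g P : Matrix (Fin n) (Fin n) ℝ} (hP : IsFrame g P)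
    (X : Matrix (Fin n) (Fin n) ℝ) :
    ∑ i, ∑ j, ∑ a, ∑ b, g⁻¹ i a * g⁻¹ j b * (X i j * X a b)
      = ∑ s, ∑ t, (Pᵀ * X * P) s t ^ 2 := by
  have h2 : ∀ s t, (Pᵀ * X * P) s t = ∑ i, P i s * ∑ j, P j t * X i j := by
    intro s t
    simp only [Matrix.mul_apply, Matrix.transpose_apply, Finset.sum_mul, Finset.mul_sum]
    rw [Finset.sum_comm]
    exact Finset.sum_congr rfl fun i _ => Finset.sum_congr rfl fun j _ => by ring
  calc _ = ∑ i, ∑ a, g⁻¹ i a * ∑ j, ∑ b, g⁻¹ j b * (X i j * X a b) := by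
        refine Finset.sum_congr rfl fun i _ => ?_
        rw [Finset.sum_comm]
        simp only [Finset.mul_sum, mul_assoc]
    _ = _ := by
        simp only [sum_inv_mul_mul hP, sum_inv_mul_sum hP, h2, sq]

lemma sum_inv_mul_mul₄ {g P : Matrix (Fin n) (Fin n) ℝ} (hP : IsFrame g P) (X : Arr4 n) :
    ∑ i, ∑ j, ∑ k, ∑ l, ∑ a, ∑ b, ∑ c, ∑ d, g⁻¹ i a * g⁻¹ j b * g⁻¹ k c * g⁻¹ l d *
        (X i j k l * X a b c d)
      = ∑ s, ∑ t, ∑ u, ∑ v, frame4 P X s t u v ^ 2 := by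
  have sc3 : ∀ f : Fin n → Fin n → Fin n → Fin n → ℝ,
      ∑ j, ∑ k, ∑ l, ∑ a, f j k l a = ∑ a, ∑ j, ∑ k, ∑ l, f j k l a := by
    intro f
    have := Finset.sum_comm (s := (Finset.univ : Finset (Fin n × Fin n × Fin n)))
      (t := (Finset.univ : Finset (Fin n))) (f := fun u v => f u.1 u.2.1 u.2.2 v)
    simpa only [Fintype.sum_prod_type] using this
  have sc2 : ∀ f : Fin n → Fin n → Fin n → ℝ,
      ∑ k, ∑ l, ∑ a, f k l a = ∑ a, ∑ k, ∑ l, f k l a := by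
    intro f
    have := Finset.sum_comm (s := (Finset.univ : Finset (Fin n × Fin n)))
      (t := (Finset.univ : Finset (Fin n))) (f := fun u v => f u.1 u.2 v)
    simpa only [Fintype.sum_prod_type] using this
  have s2 := fun f f' : Fin n → Fin n × Fin n → ℝ => sum_inv_mul_sum hP f f'
  have s3 := fun f f' : Fin n → Fin n × Fin n × Fin n → ℝ => sum_inv_mul_sum hP f f'
  simp only [Fintype.sum_prod_type] at s2 s3
  calc _ = ∑ i, ∑ a, g⁻¹ i a * ∑ j, ∑ b, g⁻¹ j b * ∑ k, ∑ c, g⁻¹ k c * ∑ l, ∑ d, g⁻¹ l d *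
          (X i j k l * X a b c d) := by
        refine Finset.sum_congr rfl fun i _ => ?_
        rw [sc3]
        refine Finset.sum_congr rfl fun a _ => ?_
        rw [Finset.mul_sum]
        refine Finset.sum_congr rfl fun j _ => ?_
        rw [sc2, Finset.mul_sum]
        refine Finset.sum_congr rfl fun b _ => ?_
        simp only [Finset.mul_sum]
        refine Finset.sum_congr rfl fun k _ => ?_
        rw [Finset.sum_comm]
        refine Finset.sum_congr rfl fun c _ => Finset.sum_congr rfl fun l _ =>
          Finset.sum_congr rfl fun d _ => by ring
    _ = _ := by
        have e1 : ∀ i j k a b c, ∑ l, ∑ d, g⁻¹ l d * (X i j k l * X a b c d)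
            = ∑ v, (∑ l, P l v * X i j k l) * ∑ d, P d v * X a b c d := fun i j k a b c =>
          sum_inv_mul_mul hP _ _
        have e2 : ∀ i j a b, ∑ k, ∑ c, g⁻¹ k c *
              ∑ v, (∑ l, P l v * X i j k l) * ∑ d, P d v * X a b c d
            = ∑ u, ∑ v, (∑ k, P k u * ∑ l, P l v * X i j k l)
              * ∑ c, P c u * ∑ d, P d v * X a b c d := fun i j a b =>
          sum_inv_mul_sum hP (fun k v => ∑ l, P l v * X i j k l)
            (fun c v => ∑ d, P d v * X a b c d)
        have e3 : ∀ i a, ∑ j, ∑ b, g⁻¹ j b *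
              ∑ u, ∑ v, (∑ k, P k u * ∑ l, P l v * X i j k l)
                * ∑ c, P c u * ∑ d, P d v * X a b c d
            = ∑ t, ∑ u, ∑ v, (∑ j, P j t * ∑ k, P k u * ∑ l, P l v * X i j k l)
              * ∑ b, P b t * ∑ c, P c u * ∑ d, P d v * X a b c d := fun i a =>
          s2 (fun j q => ∑ k, P k q.1 * ∑ l, P l q.2 * X i j k l)
            (fun b q => ∑ c, P c q.1 * ∑ d, P d q.2 * X a b c d)
        have e4 := s3 (fun i q => ∑ j, P j q.1 * ∑ k, P k q.2.1 * ∑ l, P l q.2.2 * X i j k l)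
            (fun a q => ∑ b, P b q.1 * ∑ c, P c q.2.1 * ∑ d, P d q.2.2 * X a b c d)
        simp only at e4
        simp only [e1, e2, e3, e4, frame4, sq]

variable {P : Matrix (Fin n) (Fin n) ℝ}

lemma frame4_sub (X Y : Arr4 n) (a b c d : Fin n) :
    frame4 P (fun i j k l => X i j k l - Y i j k l) a b c d
      = frame4 P X a b c d - frame4 P Y a b c d := by
  simp only [frame4, mul_sub, Finset.sum_sub_distrib]

lemma frame4_add (X Y : Arr4 n) (a b c d : Fin n) :
    frame4 P (fun i j k l => X i j k l + Y i j k l) a b c d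
      = frame4 P X a b c d + frame4 P Y a b c d := by
  simp only [frame4, mul_add, Finset.sum_add_distrib]

lemma frame4_const_mul (r : ℝ) (X : Arr4 n) (a b c d : Fin n) :
    frame4 P (fun i j k l => r * X i j k l) a b c d = r * frame4 P X a b c d := by
  simp only [frame4, Finset.mul_sum]
  refine Finset.sum_congr rfl fun i _ => Finset.sum_congr rfl fun j _ =>
    Finset.sum_congr rfl fun k _ => Finset.sum_congr rfl fun l _ => by ring

lemma transpose_mul_mul_apply (X : Matrix (Fin n) (Fin n) ℝ) (s t : Fin n) :
    (Pᵀ * X * P) s t = ∑ i, P i s * ∑ j, P j t * X i j := by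
  simp only [Matrix.mul_apply, Matrix.transpose_apply, Finset.sum_mul, Finset.mul_sum]
  rw [Finset.sum_comm]
  exact Finset.sum_congr rfl fun i _ => Finset.sum_congr rfl fun j _ => by ring

lemma frame4_mul (X Y : Matrix (Fin n) (Fin n) ℝ) (a b c d : Fin n) :
    frame4 P (fun i j k l => X i k * Y j l) a b c d
      = (Pᵀ * X * P) a c * (Pᵀ * Y * P) b d := by
  have e1 : ∀ i j k, ∑ l, P l d * (X i k * Y j l) = X i k * ∑ l, P l d * Y j l := fun i j k => by
    rw [Finset.mul_sum]; exact Finset.sum_congr rfl fun l _ => by ring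
  have e2 : ∀ i, ∀ r : ℝ, ∑ k, P k c * (X i k * r) = r * ∑ k, P k c * X i k := fun i r => by
    rw [Finset.mul_sum]; exact Finset.sum_congr rfl fun l _ => by ring
  have e3 : ∀ (f : Fin n → ℝ) (r : ℝ), ∑ j, P j b * (f j * r) = r * ∑ j, P j b * f j :=
    fun f r => by rw [Finset.mul_sum]; exact Finset.sum_congr rfl fun l _ => by ring
  simp only [frame4, transpose_mul_mul_apply, e1, e2, e3]
  rw [Finset.sum_mul]
  exact Finset.sum_congr rfl fun i _ => by ring

lemma frame4_mul' (X Y : Matrix (Fin n) (Fin n) ℝ) (a b c d : Fin n) :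
    frame4 P (fun i j k l => X i l * Y j k) a b c d
      = (Pᵀ * X * P) a d * (Pᵀ * Y * P) b c := by
  have e1 : ∀ i j k, ∑ l, P l d * (X i l * Y j k) = Y j k * ∑ l, P l d * X i l := fun i j k => by
    rw [Finset.mul_sum]; exact Finset.sum_congr rfl fun l _ => by ring
  have e2 : ∀ i, ∀ r : ℝ, ∑ k, P k c * (Y i k * r) = r * ∑ k, P k c * Y i k := fun i r => by
    rw [Finset.mul_sum]; exact Finset.sum_congr rfl fun l _ => by ring
  have e3 : ∀ (f : Fin n → ℝ) (r : ℝ), ∑ j, P j b * (r * f j) = r * ∑ j, P j b * f j :=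
    fun f r => by rw [Finset.mul_sum]; exact Finset.sum_congr rfl fun l _ => by ring
  simp only [frame4, transpose_mul_mul_apply, e1, e2, e3]
  rw [Finset.sum_mul]
  exact Finset.sum_congr rfl fun i _ => by ring

end Contraction

section Invariance

open Matrix

variable {n : ℕ} {M : Type*} [TopologicalSpace M] [ChartedSpace (Coord n) M]
  [RiemannianBundle (fun x : M => TangentSpace (𝓡 n) x)]

lemma curvOp_eq (x₀ : M) (l i j k : Fin n) (y : Coord n) :
    curvOp x₀ l i j k y = curvM (gLow x₀) i j y l k := by
  simp only [curvOp, curvM, Matrix.add_apply, Matrix.sub_apply, pdM_apply, Matrix.mul_apply,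
    Finset.sum_sub_distrib]
  have h : ∀ a b c, christoffel x₀ a b c = fun z : Coord n => chrM (gLow x₀) b z a c := fun _ _ _ => rfl
  simp only [h]
  congr 2
  · exact Finset.sum_congr rfl fun m _ => mul_comm _ _
  · exact Finset.sum_congr rfl fun m _ => mul_comm _ _

lemma riem_eq (x₀ : M) (i j k l : Fin n) (y : Coord n) :
    riem x₀ i j k l y = (gLow x₀ y * curvM (gLow x₀) k l y) i j := by
  simp only [riem, curvOp_eq, Matrix.mul_apply]

lemma frame4_riem (x₀ : M) (P : Matrix (Fin n) (Fin n) ℝ) (y : Coord n) (a b c d : Fin n) :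
    frame4 P (fun i j k l => riem x₀ i j k l y) a b c d = riemF (gLow x₀) P y a b c d := by
  have sc : ∀ f : Fin n → Fin n → Fin n → Fin n → ℝ,
      ∑ i, ∑ j, ∑ k, ∑ l, f i j k l = ∑ k, ∑ l, ∑ i, ∑ j, f i j k l := by
    intro f
    have := Finset.sum_comm (s := (Finset.univ : Finset (Fin n × Fin n)))
      (t := (Finset.univ : Finset (Fin n × Fin n))) (f := fun u v => f u.1 u.2 v.1 v.2)
    simpa only [Fintype.sum_prod_type] using this
  simp only [frame4, riem_eq, riemF, transpose_mul_mul_apply, Finset.mul_sum]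
  rw [sc]
  refine Finset.sum_congr rfl fun i _ => Finset.sum_congr rfl fun j _ =>
    Finset.sum_congr rfl fun k _ => Finset.sum_congr rfl fun l _ => by ring

variable [IsManifold (𝓡 n) ∞ M]
  [IsContMDiffRiemannianBundle (𝓡 n) ∞ (Coord n) (fun x : M => TangentSpace (𝓡 n) x)]

variable {x₀ : M} {y : Coord n}

lemma ric_eq (hy : y ∈ tgt n x₀) (j l : Fin n) : ric x₀ j l y = ricM (gLow x₀) y j l := by
  have H := isLocalMetric_gLow (n := n) x₀
  have h : ∀ k, ∑ i, (gLow x₀ y)⁻¹ i k * (gLow x₀ y * curvM (gLow x₀) k l y) i j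
      = curvM (gLow x₀) k l y k j := by
    intro k
    have e : ∀ i, (gLow x₀ y)⁻¹ i k = (gLow x₀ y)⁻¹ k i := fun i =>
      congrFun (congrFun (H.inv_transpose hy) k) i
    simp only [e]
    rw [← Matrix.mul_apply, ← Matrix.mul_assoc, H.inv_mul hy, Matrix.one_mul]
  simp only [ric, riem_eq, gUp, ricM, Matrix.of_apply]
  rw [Finset.sum_comm]
  exact Finset.sum_congr rfl fun k _ => h k

lemma scalCoord_eq (hy : y ∈ tgt n x₀) : scalCoord x₀ y = scalM (gLow x₀) y := by
  have H := isLocalMetric_gLow (n := n) x₀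
  simp only [scalCoord, scalM, Matrix.trace, Matrix.diag, Matrix.mul_apply, gUp, ric_eq hy]
  exact Finset.sum_congr rfl fun j _ => Finset.sum_congr rfl fun l _ => by
    rw [H.ricM_symm hy j l]

lemma covRiem_eq (hy : y ∈ tgt n x₀) (m i j k l : Fin n) :
    covRiem x₀ m i j k l y = (gLow x₀ y * covCurvM (gLow x₀) m k l y) i j := by
  have H := isLocalMetric_gLow (n := n) x₀
  set G := gLow (n := n) x₀ with hG
  have h1 : pd m (riem x₀ i j k l) y = (pdM m (fun z => G z * curvM G k l z) y) i j := by
    rw [pdM_apply]; congr 1; funext z; exact riem_eq x₀ i j k l z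
  have h2 : ∀ a b c : Fin n, christoffel x₀ a b c y = chrM G b y a c := fun _ _ _ => rfl
  rw [covRiem, h1, pdM_mul H.isOpen H.smooth (H.smooth_curvM k l) hy, H.pdM_metric hy]
  simp only [h2, riem_eq, ← hG, covCurvM, Finset.sum_add_distrib]
  have e1 : ∑ p, chrM G m y p i * (G y * curvM G k l y) p j
      = ((chrM G m y)ᵀ * G y * curvM G k l y) i j := by
    rw [Matrix.mul_assoc, Matrix.mul_apply]; rfl
  have e2 : ∑ p, chrM G m y p j * (G y * curvM G k l y) i p
      = (G y * curvM G k l y * chrM G m y) i j := by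
    rw [Matrix.mul_apply]; exact Finset.sum_congr rfl fun p _ => mul_comm _ _
  have e3 : ∑ p, chrM G m y p k * (G y * curvM G p l y) i j
      = (G y * ∑ p, chrM G m y p k • curvM G p l y) i j := by
    simp only [Finset.mul_sum, Matrix.mul_smul, Matrix.sum_apply, Matrix.smul_apply, smul_eq_mul]
  have e4 : ∑ p, chrM G m y p l * (G y * curvM G k p y) i j
      = (G y * ∑ p, chrM G m y p l • curvM G k p y) i j := by
    simp only [Finset.mul_sum, Matrix.mul_smul, Matrix.sum_apply, Matrix.smul_apply, smul_eq_mul]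
  rw [e1, e2, e3, e4]
  simp only [Matrix.mul_add, Matrix.mul_sub, Matrix.add_mul, Matrix.add_apply, Matrix.sub_apply,
    ← Matrix.mul_assoc]
  ring

lemma isHarmonicOn_gLow (h : HasHarmonicCurvature n M) (x₀ : M) :
    IsHarmonicOn (tgt n x₀) (gLow x₀) := by
  intro y hy j k l
  have H := isLocalMetric_gLow (n := n) x₀
  rw [← h x₀ y hy j k l, divRiem]
  refine Finset.sum_congr rfl fun m _ => ?_
  simp only [covRiem_eq hy, gUp]
  rw [← Matrix.mul_apply, ← Matrix.mul_assoc, H.inv_mul hy, Matrix.one_mul]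

lemma tracelessRic_eq (hy : y ∈ tgt n x₀) : Matrix.of (fun i j => tracelessRic x₀ i j y)
    = ricM (gLow x₀) y - (scalM (gLow x₀) y / n) • gLow x₀ y := by
  ext i j
  simp only [tracelessRic, Matrix.of_apply, ric_eq hy, scalCoord_eq hy, Matrix.sub_apply,
    Matrix.smul_apply, smul_eq_mul]

lemma frame_tracelessRic {P : Matrix (Fin n) (Fin n) ℝ} (hP : IsFrame (gLow x₀ y) P)
    (hy : y ∈ tgt n x₀) : Pᵀ * Matrix.of (fun i j => tracelessRic x₀ i j y) * P
      = Matrix.of (tfF (riemF (gLow x₀) P y)) := by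
  rw [(isLocalMetric_gLow (n := n) x₀).tfF_riemF hP hy, tracelessRic_eq hy, Matrix.mul_sub, Matrix.sub_mul,
    Matrix.mul_smul, Matrix.smul_mul, hP.orth]

lemma frame4_weyl {P : Matrix (Fin n) (Fin n) ℝ} (hP : IsFrame (gLow x₀ y) P)
    (hy : y ∈ tgt n x₀) (a b c d : Fin n) :
    frame4 P (fun i j k l => weyl x₀ i j k l y) a b c d = weylF (riemF (gLow x₀) P y) a b c d := by
  set g := gLow x₀ y with hg
  set E : Matrix (Fin n) (Fin n) ℝ := Matrix.of (fun i j => tracelessRic x₀ i j y) with hE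
  have e : (fun i j k l => weyl x₀ i j k l y) = fun i j k l => riem x₀ i j k l y
      - scalCoord x₀ y / ((n : ℝ) * ((n : ℝ) - 1)) * (g i k * g j l - g i l * g j k)
      - 1 / ((n : ℝ) - 2) * (E i k * g j l + g i k * E j l - E i l * g j k - g i l * E j k) := by
    funext i j k l
    simp only [weyl, hE, Matrix.of_apply]
    ring
  have hk : ∀ s t, (Pᵀ * g * P) s t = kron s t := fun s t => by
    rw [hP.orth, Matrix.one_apply, kron]
  have hEk : ∀ s t, (Pᵀ * E * P) s t = tfF (riemF (gLow x₀) P y) s t := fun s t => by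
    rw [hE, frame_tracelessRic hP hy, Matrix.of_apply]
  rw [e, frame4_sub, frame4_sub, frame4_const_mul, frame4_const_mul, frame4_sub, frame4_sub,
    frame4_sub, frame4_add, frame4_mul, frame4_mul, frame4_mul, frame4_mul', frame4_mul',
    frame4_mul', frame4_riem]
  simp only [hk, hEk, weylF, (isLocalMetric_gLow (n := n) x₀).scalF_riemF hP hy, scalCoord_eq hy]
  ring

/-- `|W|²` in the chart around `x₀`. -/
def sqWCoord (x₀ : M) (y : Coord n) : ℝ :=
  ∑ i, ∑ j, ∑ k, ∑ l, ∑ a, ∑ b, ∑ c, ∑ d,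
    gUp x₀ y i a * gUp x₀ y j b * gUp x₀ y k c * gUp x₀ y l d *
      (weyl x₀ i j k l y * weyl x₀ a b c d y)

lemma sqWCoord_eq {P : Matrix (Fin n) (Fin n) ℝ} (hP : IsFrame (gLow x₀ y) P)
    (hy : y ∈ tgt n x₀) : sqWCoord x₀ y = sqW (riemF (gLow x₀) P y) := by
  have := sum_inv_mul_mul₄ hP (fun i j k l => weyl x₀ i j k l y)
  simp only [frame4_weyl hP hy] at this
  exact this

lemma contDiffOn_sqWCoord (x₀ : M) : ContDiffOn ℝ ∞ (sqWCoord x₀ : Coord n → ℝ) (tgt n x₀) := by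
  have H := isLocalMetric_gLow (n := n) x₀
  have hr : ∀ i j k l, ContDiffOn ℝ ∞ (riem x₀ i j k l) (tgt n x₀) := fun i j k l =>
    ((H.smooth.mul (H.smooth_curvM k l)) i j).congr fun z _ => riem_eq x₀ i j k l z
  have hs : ContDiffOn ℝ ∞ (scalCoord x₀) (tgt n x₀) :=
    H.smooth_scalM.congr fun z hz => scalCoord_eq hz
  have hE : ∀ i j, ContDiffOn ℝ ∞ (tracelessRic x₀ i j) (tgt n x₀) := fun i j =>
    ((H.smooth_ricM i j).congr fun z hz => ric_eq hz i j).sub ((hs.div_const _).mul (H.smooth i j))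
  have hg := H.smooth
  have hw : ∀ i j k l, ContDiffOn ℝ ∞ (weyl x₀ i j k l) (tgt n x₀) := fun i j k l =>
    ((hr i j k l).sub ((hs.div_const _).mul (((hg i k).mul (hg j l)).sub
      ((hg i l).mul (hg j k))))).sub (contDiffOn_const.mul
        (((((hE i k).mul (hg j l)).add ((hE j l).mul (hg i k))).sub
          ((hE i l).mul (hg j k))).sub ((hE j k).mul (hg i l))))
  have hu := H.smooth_inv
  refine ContDiffOn.sum fun i _ => ContDiffOn.sum fun j _ => ContDiffOn.sum fun k _ =>
    ContDiffOn.sum fun l _ => ContDiffOn.sum fun a _ => ContDiffOn.sum fun b _ =>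
    ContDiffOn.sum fun c _ => ContDiffOn.sum fun d _ => ?_
  exact ((((hu i a).mul (hu j b)).mul (hu k c)).mul (hu l d)).mul
    ((hw i j k l).mul (hw a b c d))

omit [IsManifold (𝓡 n) ∞ M]
  [IsContMDiffRiemannianBundle (𝓡 n) ∞ (Coord n) (fun x : M => TangentSpace (𝓡 n) x)]
  [RiemannianBundle (fun x : M => TangentSpace (𝓡 n) x)] in
lemma ownCoord_mem_overlap (hy : y ∈ tgt n x₀) :
    (ownCoord (chartPt x₀ y) : Coord n) ∈ overlap n (chartPt x₀ y) x₀ := by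
  refine ⟨ownCoord_mem _, ?_⟩
  rw [Set.mem_preimage, chartPt_ownCoord]
  exact chartPt_mem_src hy

omit [IsManifold (𝓡 n) ∞ M]
  [IsContMDiffRiemannianBundle (𝓡 n) ∞ (Coord n) (fun x : M => TangentSpace (𝓡 n) x)]
  [RiemannianBundle (fun x : M => TangentSpace (𝓡 n) x)] in
lemma trans_ownCoord (hy : y ∈ tgt n x₀) :
    trans (chartPt x₀ y) x₀ (ownCoord (chartPt x₀ y) : Coord n) = y := by
  rw [trans, chartPt_ownCoord, extChartAt_chartPt hy]

/-- An orthonormal frame at a point in its own chart, moved to another chart. -/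
lemma exists_frames (hy : y ∈ tgt n x₀) : ∃ P' P : Matrix (Fin n) (Fin n) ℝ,
    IsFrame (gLow (chartPt x₀ y) (ownCoord (chartPt x₀ y))) P' ∧ IsFrame (gLow x₀ y) P ∧
    riemF (gLow (chartPt x₀ y)) P' (ownCoord (chartPt x₀ y)) = riemF (gLow x₀) P y := by
  set x := chartPt x₀ y
  have hp := isPullback_trans (n := n) x x₀
  have hz : (ownCoord x : Coord n) ∈ overlap n x x₀ := ownCoord_mem_overlap hy
  have hτ : trans x x₀ (ownCoord x : Coord n) = y := trans_ownCoord hy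
  have H := isLocalMetric_gLow (n := n) x₀
  have H' := isLocalMetric_gLow_overlap (n := n) x x₀
  obtain ⟨P', hP'⟩ := exists_isFrame (H'.posDef _ hz)
  refine ⟨P', jac (trans x x₀) (ownCoord x) * P', hP', ?_, ?_⟩
  · have := hp.isFrame H' hz hP'
    rwa [hτ] at this
  · rw [hp.riemF_eq H H' hz, hτ]

lemma scal_chartPt (hy : y ∈ tgt n x₀) : scal (n := n) (chartPt x₀ y) = scalM (gLow x₀) y := by
  obtain ⟨P', P, hP', hP, h⟩ := exists_frames hy
  rw [scal, scalCoord_eq (ownCoord_mem _),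
    ← (isLocalMetric_gLow (n := n) _).scalF_riemF hP' (ownCoord_mem _), h,
    (isLocalMetric_gLow (n := n) x₀).scalF_riemF hP hy]

lemma normE_chartPt (hy : y ∈ tgt n x₀) : normE (n := n) (chartPt x₀ y) = √(sqEM (gLow x₀) y) := by
  obtain ⟨P', P, hP', hP, h⟩ := exists_frames hy
  rw [(isLocalMetric_gLow (n := n) x₀).sqEM_eq hP hy, ← h]
  have h1 := sum_inv_mul_mul₂ hP' (Matrix.of fun i j =>
    tracelessRic (chartPt x₀ y) i j (ownCoord (chartPt x₀ y)))
  rw [frame_tracelessRic hP' (ownCoord_mem _)] at h1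
  exact congrArg Real.sqrt h1

lemma normW_chartPt (hy : y ∈ tgt n x₀) : normW (n := n) (chartPt x₀ y) = √(sqWCoord x₀ y) := by
  obtain ⟨P', P, hP', hP, h⟩ := exists_frames hy
  rw [sqWCoord_eq hP hy, ← h, ← sqWCoord_eq hP' (ownCoord_mem _)]
  rfl

/-- The pairing `⟨∇u, ∇v⟩` of two functions on `M`. -/
def gradIn (u v : M → ℝ) (x : M) : ℝ :=
  gradM (gLow x) (fun z => u (chartPt x z)) (fun z => v (chartPt x z)) (ownCoord x : Coord n)

lemma gradIn_chartPt {u v : M → ℝ} (hy : y ∈ tgt n x₀)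
    (hu : DifferentiableAt ℝ (fun z => u (chartPt x₀ z)) y)
    (hv : DifferentiableAt ℝ (fun z => v (chartPt x₀ z)) y) :
    gradIn (n := n) u v (chartPt x₀ y)
      = gradM (gLow x₀) (fun z => u (chartPt x₀ z)) (fun z => v (chartPt x₀ z)) y := by
  set x := chartPt x₀ y
  have hz : (ownCoord x : Coord n) ∈ overlap n x x₀ := ownCoord_mem_overlap hy
  have hτ : trans x x₀ (ownCoord x : Coord n) = y := trans_ownCoord hy
  have H' := isLocalMetric_gLow_overlap (n := n) x x₀
  have h1 := (isPullback_trans (n := n) x x₀).gradM_comp (f := fun z => u (chartPt x₀ z))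
    (f' := fun z => v (chartPt x₀ z)) H' hz (by rwa [hτ]) (by rwa [hτ])
  rw [hτ] at h1
  rw [← h1, gradIn, gradM, gradM]
  have h2 : ∀ w : M → ℝ, ∀ i, pd i (fun z => w (chartPt x z)) (ownCoord x : Coord n)
      = pd i (fun z => w (chartPt x₀ (trans x x₀ z))) (ownCoord x) := fun w i =>
    pd_congr (isOpen_overlap x x₀) (fun z hz => by rw [chartPt_trans hz]) hz i
  simp only [h2]

end Invariance

/-! ### The Riemannian volume -/

section Volume

open Matrix

variable {n : ℕ}

lemma det_jac (τ : Coord n → Coord n) (y : Coord n) (hτ : DifferentiableAt ℝ τ y) :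
    (jac τ y).det = (fderiv ℝ τ y).det := by
  have h : jac τ y = LinearMap.toMatrix (EuclideanSpace.basisFun (Fin n) ℝ).toBasis
      (EuclideanSpace.basisFun (Fin n) ℝ).toBasis (fderiv ℝ τ y : Coord n →ₗ[ℝ] Coord n) := by
    ext a i
    have h1 : (fun z => τ z a) = (EuclideanSpace.proj a : Coord n →L[ℝ] ℝ) ∘ τ := rfl
    simp only [jac, Matrix.of_apply, pd, LinearMap.toMatrix_apply]
    rw [h1, ((EuclideanSpace.proj a : Coord n →L[ℝ] ℝ).hasFDerivAt.comp y hτ.hasFDerivAt).fderiv]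
    simp
  rw [h, LinearMap.det_toMatrix]

lemma IsPullback.sqrt_det {U V : Set (Coord n)} {τ : Coord n → Coord n} {G' G : MatFun n}
    (h : IsPullback V U τ G' G) (hV : IsOpen V) {y : Coord n} (hy : y ∈ V) :
    √(G' y).det = |(fderiv ℝ τ y).det| * √(G (τ y)).det := by
  have hd : DifferentiableAt ℝ τ y :=
    (h.smooth.differentiableOn (by simp)).differentiableAt (hV.mem_nhds hy)
  rw [h.metric_eq y hy, Matrix.det_mul, Matrix.det_mul, Matrix.det_transpose, ← det_jac τ y hd,
    mul_right_comm, ← sq, Real.sqrt_mul (sq_nonneg _), Real.sqrt_sq_eq_abs]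

variable {M : Type*} [TopologicalSpace M] [ChartedSpace (Coord n) M] [MeasurableSpace M]
  [BorelSpace M]

lemma measurableSet_tgt_inter (x₀ : M) {A : Set M} (hA : MeasurableSet A) :
    MeasurableSet (tgt n x₀ ∩ chartPt x₀ ⁻¹' A) := by
  have h : Measurable ((tgt n x₀).domRestrict (chartPt x₀)) :=
    (continuousOn_iff_continuous_domRestrict.1 (continuousOn_extChartAt_symm x₀)).measurable
  have := (MeasurableEmbedding.subtype_coe (isOpen_tgt x₀).measurableSet).measurableSet_image.2
    (h hA)
  convert this using 1
  ext y
  simp [Set.domRestrict, and_comm]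

lemma aemeasurable_chartPt (x₀ : M) :
    AEMeasurable (chartPt x₀) (volume.restrict (tgt n x₀)) :=
  (show ContinuousOn (chartPt x₀) (tgt n x₀) from continuousOn_extChartAt_symm x₀).aemeasurable
    (isOpen_tgt x₀).measurableSet

variable [RiemannianBundle (fun x : M => TangentSpace (𝓡 n) x)]

/-- The density `√(det g)` of the Riemannian volume in the chart around `x₀`. -/
def volDens (x₀ : M) (y : Coord n) : ℝ := √(gLow x₀ y).det

lemma aemeasurable_chartPt' (x₀ : M) :
    AEMeasurable (chartPt x₀) ((volume.restrict (tgt n x₀)).withDensity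
      (fun y : Coord n => ENNReal.ofReal (volDens x₀ y))) :=
  (aemeasurable_chartPt x₀).mono_ac (withDensity_absolutelyContinuous _ _)

omit [BorelSpace M] in
lemma chartVolume_def (x₀ : M) : chartVolume n x₀ = Measure.map (chartPt x₀)
    ((volume.restrict (tgt n x₀)).withDensity
      (fun y : Coord n => ENNReal.ofReal (volDens x₀ y))) := rfl

lemma chartVolume_apply (x₀ : M) {A : Set M} (hA : MeasurableSet A) :
    chartVolume n x₀ A
      = ∫⁻ y in tgt n x₀ ∩ chartPt x₀ ⁻¹' A, ENNReal.ofReal (volDens x₀ y) := by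
  rw [chartVolume_def, Measure.map_apply_of_aemeasurable (aemeasurable_chartPt' x₀) hA,
    withDensity_apply', Measure.restrict_restrict' (isOpen_tgt x₀).measurableSet, Set.inter_comm]

lemma chartVolume_inter_src (x₀ : M) {A : Set M} (hA : MeasurableSet A) :
    chartVolume n x₀ (A ∩ src n x₀) = chartVolume n x₀ A := by
  rw [chartVolume_apply x₀ hA, chartVolume_apply x₀ (hA.inter (isOpen_src x₀).measurableSet)]
  congr 2
  ext y
  simp only [Set.mem_inter_iff, Set.mem_preimage]
  exact ⟨fun h => ⟨h.1, h.2.1⟩, fun h => ⟨h.1, h.2, chartPt_mem_src h.1⟩⟩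

variable [IsManifold (𝓡 n) ∞ M]
  [IsContMDiffRiemannianBundle (𝓡 n) ∞ (Coord n) (fun x : M => TangentSpace (𝓡 n) x)]

omit [IsContMDiffRiemannianBundle (𝓡 n) ∞ (Coord n) (fun x : M => TangentSpace (𝓡 n) x)] in
/-- The volume measures of two charts agree on the intersection of the domains. -/
lemma chartVolume_eq (x₀ x₁ : M) {A : Set M} (hA : MeasurableSet A)
    (h0 : A ⊆ src n x₀) (h1 : A ⊆ src n x₁) : chartVolume n x₁ A = chartVolume n x₀ A := by
  rw [chartVolume_apply x₀ hA, chartVolume_apply x₁ hA]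
  set s := tgt n x₁ ∩ chartPt x₁ ⁻¹' A with hs
  have hso : s ⊆ overlap n x₁ x₀ := fun y hy => ⟨hy.1, h0 hy.2⟩
  have him : tgt n x₀ ∩ chartPt x₀ ⁻¹' A = trans x₁ x₀ '' s := by
    ext z
    constructor
    · rintro ⟨hz, hzA⟩
      refine ⟨extChartAt (𝓡 n) x₁ (chartPt x₀ z),
        ⟨(extChartAt (𝓡 n) x₁).map_source (h1 hzA), ?_⟩, ?_⟩
      · rw [Set.mem_preimage, chartPt_extChartAt (h1 hzA)]; exact hzA
      · rw [trans, chartPt_extChartAt (h1 hzA), extChartAt_chartPt hz]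
    · rintro ⟨y, hy, rfl⟩
      exact ⟨trans_mem (hso hy), by rw [Set.mem_preimage, chartPt_trans (hso hy)]; exact hy.2⟩
  have hinj : Set.InjOn (trans x₁ x₀) s := by
    intro y hy z hz hyz
    have := congrArg (chartPt x₀) hyz
    rw [chartPt_trans (hso hy), chartPt_trans (hso hz)] at this
    rw [← extChartAt_chartPt hy.1, this, extChartAt_chartPt hz.1]
  have hd : ∀ y ∈ s, HasFDerivWithinAt (trans x₁ x₀) (fderiv ℝ (trans x₁ x₀) y) s y :=
    fun y hy => (((contDiffOn_trans x₁ x₀).differentiableOn (by simp)).differentiableAt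
      ((isOpen_overlap x₁ x₀).mem_nhds (hso hy))).hasFDerivAt.hasFDerivWithinAt
  have hm : MeasurableSet s := measurableSet_tgt_inter x₁ hA
  rw [him, lintegral_image_eq_lintegral_abs_det_fderiv_mul volume hm hd hinj]
  refine setLIntegral_congr_fun hm fun y hy => ?_
  rw [← ENNReal.ofReal_mul (abs_nonneg _), volDens, volDens,
    (isPullback_trans x₁ x₀).sqrt_det (isOpen_overlap x₁ x₀) (hso hy)]

omit [IsContMDiffRiemannianBundle (𝓡 n) ∞ (Coord n) (fun x : M => TangentSpace (𝓡 n) x)] in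
/-- In the domain of a chart the Riemannian volume is the volume measure of the chart. -/
lemma restrict_riemVolume (x₀ : M) :
    (riemVolume n M).restrict (src n x₀) = chartVolume n x₀ := by
  have hs : MeasurableSet (src n x₀) := (isOpen_src x₀).measurableSet
  apply le_antisymm
  · -- all chart measures lie below `ν`, which is infinite on points outside the chart
    set ν : Measure M := chartVolume n x₀ +
      (((⊤ : ℝ≥0∞) • Measure.count : Measure M).restrict (src n x₀)ᶜ) with hν
    have key : riemVolume n M ≤ ν := by
      refine iSup_le fun x₁ => Measure.le_iff.2 fun A hA => ?_
      rw [← measure_inter_add_sdiff A hs, hν, Measure.add_apply]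
      refine add_le_add ?_ ?_
      · rw [← chartVolume_inter_src x₁ (hA.inter hs), chartVolume_eq x₀ x₁
          ((hA.inter hs).inter (isOpen_src x₁).measurableSet)
          (fun x hx => hx.1.2) (fun x hx => hx.2)]
        exact measure_mono fun x hx => hx.1.1
      · rw [Measure.restrict_apply hA, ← Set.sdiff_eq, Measure.smul_apply, smul_eq_mul]
        rcases (A \ src n x₀).eq_empty_or_nonempty with h | h
        · simp [h]
        · rw [ENNReal.top_mul]
          · exact le_top
          · rw [Ne, Measure.count_eq_zero_iff]
            exact h.ne_empty
    refine (Measure.restrict_mono le_rfl key).trans ?_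
    rw [hν, Measure.restrict_add, Measure.restrict_restrict hs, Set.inter_compl_self,
      Measure.restrict_empty, add_zero]
    exact Measure.restrict_le_self
  · refine Measure.le_iff.2 fun A hA => ?_
    rw [Measure.restrict_apply hA, ← chartVolume_inter_src x₀ hA]
    exact Measure.le_iff.1 (le_iSup (fun x : M => chartVolume n x) x₀) _ (hA.inter hs)

omit [MeasurableSpace M] [BorelSpace M] in
lemma continuousOn_volDens (x₀ : M) : ContinuousOn (volDens x₀ : Coord n → ℝ) (tgt n x₀) :=
  (isLocalMetric_gLow x₀).smooth.det.continuousOn.sqrt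

omit [MeasurableSpace M] [BorelSpace M] in
lemma volDens_pos {x₀ : M} {y : Coord n} (hy : y ∈ tgt n x₀) : 0 < volDens x₀ y :=
  Real.sqrt_pos.2 ((isLocalMetric_gLow x₀).posDef y hy).det_pos

/-- The integral over the domain of a chart is that of the coordinate expression against the
density `√(det g)`. -/
lemma setIntegral_src (x₀ : M) {h : M → ℝ} (hh : AEStronglyMeasurable h (riemVolume n M)) :
    ∫ x in src n x₀, h x ∂riemVolume n M
      = ∫ y in tgt n x₀, volDens x₀ y * h (chartPt x₀ y) := by
  have h1 := hh.restrict (s := src n x₀)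
  rw [restrict_riemVolume] at h1 ⊢
  rw [chartVolume_def] at h1 ⊢
  rw [integral_map (aemeasurable_chartPt' x₀) h1,
    integral_withDensity_eq_integral_toReal_smul₀]
  · refine integral_congr_ae (Filter.Eventually.of_forall fun y => ?_)
    simp only [smul_eq_mul]
    rw [ENNReal.toReal_ofReal (show 0 ≤ volDens x₀ y from Real.sqrt_nonneg _)]
  · exact ((continuousOn_volDens x₀).aemeasurable (isOpen_tgt x₀).measurableSet).ennreal_ofReal
  · exact Filter.Eventually.of_forall fun y => ENNReal.ofReal_lt_top

lemma integral_eq_of_support {x₀ : M} {h : M → ℝ}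
    (hh : AEStronglyMeasurable h (riemVolume n M)) (hs : Function.support h ⊆ src n x₀) :
    ∫ x, h x ∂riemVolume n M = ∫ y in tgt n x₀, volDens x₀ y * h (chartPt x₀ y) := by
  rw [← setIntegral_src x₀ hh, setIntegral_eq_integral_of_forall_compl_eq_zero]
  intro x hx
  by_contra h0
  exact hx (hs h0)

instance isLocallyFiniteMeasure_riemVolume : IsLocallyFiniteMeasure (riemVolume n M) where
  finiteAtNhds x := by
    obtain ⟨K, hK, hxK, hKt⟩ := exists_compact_subset (isOpen_tgt x) (ownCoord_mem (n := n) x)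
    have hc : ContinuousOn (extChartAt (𝓡 n) x) (src n x) := continuousOn_extChartAt x
    refine ⟨src n x ∩ extChartAt (𝓡 n) x ⁻¹' interior K,
      (hc.isOpen_inter_preimage (isOpen_src x) isOpen_interior).mem_nhds
        ⟨mem_extChartAt_source x, hxK⟩, ?_⟩
    have hm : MeasurableSet (src n x ∩ extChartAt (𝓡 n) x ⁻¹' interior K) :=
      (hc.isOpen_inter_preimage (isOpen_src x) isOpen_interior).measurableSet
    have h1 : riemVolume n M (src n x ∩ extChartAt (𝓡 n) x ⁻¹' interior K)
        = chartVolume n x (src n x ∩ extChartAt (𝓡 n) x ⁻¹' interior K) := by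
      rw [← restrict_riemVolume, Measure.restrict_apply hm,
        Set.inter_eq_left.2 Set.inter_subset_left]
    rw [h1, chartVolume_apply x hm]
    have hi : IntegrableOn (volDens x : Coord n → ℝ) K volume :=
      ((continuousOn_volDens x).mono hKt).integrableOn_compact hK
    refine (lintegral_mono_set (μ := volume) (t := K) ?_).trans_lt
      ((hasFiniteIntegral_iff_ofReal (Filter.Eventually.of_forall fun y =>
        Real.sqrt_nonneg _)).1 hi.2)
    rintro y ⟨hy, hy1, hy2⟩
    rw [Set.mem_preimage, extChartAt_chartPt hy] at hy2
    exact interior_subset hy2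

end Volume

/-! ### The Laplacian in divergence form and integration by parts -/

section Divergence

open Matrix

variable {n : ℕ} {U : Set (Coord n)} {G : MatFun n} {y : Coord n} {f p : Coord n → ℝ}

/-- The `i`-th component of the vector density `√(det g) ∇f`. -/
def flux (G : MatFun n) (f : Coord n → ℝ) (i : Fin n) (y : Coord n) : ℝ :=
  √(G y).det * ∑ j, (G y)⁻¹ i j * pd j f y

lemma gradM_eq_flux (y : Coord n) :
    √(G y).det * gradM G p f y = ∑ i, flux G f i y * pd i p y := by
  simp only [gradM, flux, Finset.mul_sum, Finset.sum_mul]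
  exact Finset.sum_congr rfl fun i _ => Finset.sum_congr rfl fun j _ => by ring

namespace IsLocalMetric

variable (H : IsLocalMetric U G)
include H

lemma smooth_sqrt_det : ContDiffOn ℝ ∞ (fun z => √(G z).det) U :=
  H.smooth.det.sqrt fun _ hz => H.det_ne_zero hz

lemma smooth_flux (hf : ContDiffOn ℝ ∞ f U) (i : Fin n) : ContDiffOn ℝ ∞ (flux G f i) U :=
  H.smooth_sqrt_det.mul (ContDiffOn.sum fun j _ =>
    (H.smooth_inv i j).mul (contDiffOn_pd H.isOpen hf j))

lemma smooth_gradM {f' : Coord n → ℝ} (hf : ContDiffOn ℝ ∞ f U) (hf' : ContDiffOn ℝ ∞ f' U) :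
    ContDiffOn ℝ ∞ (gradM G f f') U :=
  ContDiffOn.sum fun i _ => ContDiffOn.sum fun j _ => (H.smooth_inv i j).mul
    ((contDiffOn_pd H.isOpen hf i).mul (contDiffOn_pd H.isOpen hf' j))

lemma smooth_lap (hf : ContDiffOn ℝ ∞ f U) : ContDiffOn ℝ ∞ (lap G f) U :=
  ContDiffOn.sum fun i _ => ContDiffOn.sum fun j _ => (H.smooth_inv i j).mul
    ((contDiffOn_pd H.isOpen (contDiffOn_pd H.isOpen hf j) i).sub (ContDiffOn.sum fun k _ =>
      (H.smooth_chrM i k j).mul (contDiffOn_pd H.isOpen hf k)))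

lemma pd_sqrt_det (hy : y ∈ U) (i : Fin n) :
    pd i (fun z => √(G z).det) y = √(G y).det * (chrM G i y).trace := by
  have hd := (H.posDef y hy).det_pos
  have h1 := pd_comp_real (f := fun z => (G z).det) (Real.hasDerivAt_sqrt hd.ne')
    (differentiableAt_of_contDiffOn H.isOpen H.smooth.det hy) i
  have h2 : (G y).adjugate = (G y).det • (G y)⁻¹ := by
    rw [Matrix.inv_def, smul_smul, Ring.inverse_eq_inv', mul_inv_cancel₀ hd.ne', one_smul]
  have h3 : ((G y)⁻¹ * ((chrM G i y)ᵀ * G y)).trace = (chrM G i y).trace := by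
    rw [← Matrix.mul_assoc, Matrix.trace_mul_comm, ← Matrix.mul_assoc, H.mul_inv hy,
      Matrix.one_mul, Matrix.trace_transpose]
  have h4 : ((G y)⁻¹ * (G y * chrM G i y)).trace = (chrM G i y).trace := by
    rw [← Matrix.mul_assoc, H.inv_mul hy, Matrix.one_mul]
  rw [h1, pd_det H.isOpen H.smooth hy, H.pdM_metric hy, h2, Matrix.smul_mul, Matrix.trace_smul,
    Matrix.mul_add, Matrix.trace_add, h3, h4, smul_eq_mul]
  have hs : √(G y).det ≠ 0 := (Real.sqrt_pos.2 hd).ne'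
  field_simp
  rw [Real.sq_sqrt hd.le]
  ring

/-- The Laplacian in divergence form. -/
lemma sum_pd_flux (hf : ContDiffOn ℝ ∞ f U) (hy : y ∈ U) :
    ∑ i, pd i (flux G f i) y = √(G y).det * lap G f y := by
  have hD := fun {h : Coord n → ℝ} (hh : ContDiffOn ℝ ∞ h U) =>
    differentiableAt_of_contDiffOn H.isOpen hh hy
  have h1 : ∀ i, pd i (flux G f i) y = √(G y).det * ((chrM G i y).trace * ∑ j, (G y)⁻¹ i j * pd j f y
      + ∑ j, ((pdM i (fun z => (G z)⁻¹) y) i j * pd j f y + (G y)⁻¹ i j * pd i (pd j f) y)) := by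
    intro i
    have e1 := pd_mul (hD H.smooth_sqrt_det) (hD (ContDiffOn.sum (s := Finset.univ) fun j _ =>
      (H.smooth_inv i j).mul (contDiffOn_pd H.isOpen hf j))) i
    refine e1.trans ?_
    rw [H.pd_sqrt_det hy, pd_sum (F := fun j z => (G z)⁻¹ i j * pd j f z) fun j _ =>
      hD ((H.smooth_inv i j).mul (contDiffOn_pd H.isOpen hf j))]
    have e2 : ∀ j, pd i (fun z => (G z)⁻¹ i j * pd j f z) y
        = (pdM i (fun z => (G z)⁻¹) y) i j * pd j f y + (G y)⁻¹ i j * pd i (pd j f) y := fun j =>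
      pd_mul (hD (H.smooth_inv i j)) (hD (contDiffOn_pd H.isOpen hf j)) i
    simp only [e2]
    ring
  have h2 : ∑ i, ∑ j, (chrM G i y * (G y)⁻¹) i j * pd j f y
      = ∑ i, (chrM G i y).trace * ∑ j, (G y)⁻¹ i j * pd j f y := by
    simp only [Matrix.mul_apply, Matrix.trace, Matrix.diag, Finset.sum_mul, Finset.mul_sum]
    calc ∑ i, ∑ j, ∑ k, chrM G i y i k * (G y)⁻¹ k j * pd j f y
        = ∑ i, ∑ k, ∑ j, chrM G i y i k * (G y)⁻¹ k j * pd j f y :=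
          Finset.sum_congr rfl fun i _ => Finset.sum_comm
      _ = ∑ k, ∑ i, ∑ j, chrM G i y i k * (G y)⁻¹ k j * pd j f y := Finset.sum_comm
      _ = ∑ k, ∑ j, ∑ i, chrM G i y i k * (G y)⁻¹ k j * pd j f y :=
          Finset.sum_congr rfl fun i _ => Finset.sum_comm
      _ = _ := Finset.sum_congr rfl fun k _ => Finset.sum_congr rfl fun j _ =>
          Finset.sum_congr rfl fun i _ => by rw [H.chrM_symm hy i k i]; ring
  have h3 : ∑ i, ∑ j, ((G y)⁻¹ * (chrM G i y)ᵀ) i j * pd j f y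
      = ∑ i, ∑ j, (G y)⁻¹ i j * ∑ q, chrM G i y q j * pd q f y := by
    simp only [Matrix.mul_apply, Matrix.transpose_apply, Finset.sum_mul, Finset.mul_sum]
    refine Finset.sum_congr rfl fun i _ => ?_
    rw [Finset.sum_comm]
    exact Finset.sum_congr rfl fun k _ => Finset.sum_congr rfl fun j _ => by ring
  simp only [h1, ← Finset.mul_sum, H.pdM_inv hy, Matrix.neg_apply, Matrix.add_apply, neg_mul,
    add_mul, neg_add, Finset.sum_add_distrib, Finset.sum_neg_distrib, h2, h3, lap, mul_sub,
    Finset.sum_sub_distrib]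
  ring

end IsLocalMetric

lemma integrable_of_support_subset {h : Coord n → ℝ} (hh : ContinuousOn h U) {K : Set (Coord n)}
    (hK : IsCompact K) (hKU : K ⊆ U) (hs : ∀ y, y ∉ K → h y = 0) : Integrable h := by
  rw [← integrableOn_iff_integrable_of_support_subset (s := K)]
  · exact (hh.mono hKU).integrableOn_compact hK
  · intro y hy
    by_contra h0
    exact hy (hs y h0)

/-- Green's formula for a function with compact support in the domain of the coordinates. -/
lemma IsLocalMetric.integral_gradM (H : IsLocalMetric U G) (hf : ContDiffOn ℝ ∞ f U)
    (hp : ContDiffOn ℝ ∞ p U) {K : Set (Coord n)} (hK : IsCompact K) (hKU : K ⊆ U)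
    (hs : ∀ y ∈ U, y ∉ K → p y = 0) :
    ∫ y in U, √(G y).det * gradM G p f y = -∫ y in U, √(G y).det * (p y * lap G f y) := by
  set q : Coord n → ℝ := U.indicator p with hq
  have hqU : ∀ z ∈ U, q z = p z := fun z hz => Set.indicator_of_mem hz p
  have hqK : ∀ z, z ∉ K → q z = 0 := by
    intro z hz
    by_cases hzU : z ∈ U
    · rw [hqU z hzU, hs z hzU hz]
    · exact Set.indicator_of_notMem hzU p
  have hqs : ContDiffOn ℝ ∞ q U := hp.congr hqU
  have hts : tsupport q ⊆ K := closure_minimal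
    (fun z hz => by by_contra h0; exact hz (hqK z h0)) hK.isClosed
  have hqd : Differentiable ℝ q := by
    intro z
    by_cases hz : z ∈ K
    · exact differentiableAt_of_contDiffOn H.isOpen hqs (hKU hz)
    · have : q =ᶠ[nhds z] fun _ => 0 := by
        filter_upwards [hK.isClosed.isOpen_compl.mem_nhds hz] with w hw using hqK w hw
      exact (differentiableAt_const (0 : ℝ)).congr_of_eventuallyEq this
  have hpdK : ∀ i z, z ∉ K → pd i q z = 0 := by
    intro i z hz
    rw [pd, fderiv_of_notMem_tsupport ℝ (fun h => hz (hts h))]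
    rfl
  have hi1 : ∀ i, Integrable (fun z => pd i (flux G f i) z * q z) := fun i =>
    integrable_of_support_subset ((contDiffOn_pd H.isOpen (H.smooth_flux hf i) i).continuousOn.mul
      hqs.continuousOn) hK hKU fun z hz => by simp [hqK z hz]
  have hi2 : ∀ i, Integrable (fun z => flux G f i z * pd i q z) := fun i =>
    integrable_of_support_subset ((H.smooth_flux hf i).continuousOn.mul
      (contDiffOn_pd H.isOpen hqs i).continuousOn) hK hKU fun z hz => by simp [hpdK i z hz]
  have hi3 : ∀ i, Integrable (fun z => flux G f i z * q z) := fun i =>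
    integrable_of_support_subset ((H.smooth_flux hf i).continuousOn.mul
      hqs.continuousOn) hK hKU fun z hz => by simp [hqK z hz]
  have hparts : ∀ i, ∫ z, flux G f i z * pd i q z = -∫ z, pd i (flux G f i) z * q z := fun i =>
    integral_mul_fderiv_eq_neg_fderiv_mul_of_integrable (hi1 i) (hi2 i) (hi3 i)
      (fun z hz => differentiableAt_of_contDiffOn H.isOpen (H.smooth_flux hf i) (hKU (hts hz)))
      (fun z _ => hqd z)
  have hU := H.isOpen.measurableSet
  calc ∫ y in U, √(G y).det * gradM G p f y
      = ∫ y in U, ∑ i, flux G f i y * pd i q y := by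
        refine setIntegral_congr_fun hU fun y hy => ?_
        rw [gradM_eq_flux]
        exact Finset.sum_congr rfl fun i _ => by rw [pd_congr H.isOpen hqU hy]
    _ = ∫ y, ∑ i, flux G f i y * pd i q y := by
        refine setIntegral_eq_integral_of_forall_compl_eq_zero fun y hy => ?_
        exact Finset.sum_eq_zero fun i _ => by rw [hpdK i y (fun h => hy (hKU h)), mul_zero]
    _ = -∫ y, ∑ i, pd i (flux G f i) y * q y := by
        rw [integral_finsetSum _ fun i _ => hi2 i, integral_finsetSum _ fun i _ => hi1 i,
          ← Finset.sum_neg_distrib]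
        exact Finset.sum_congr rfl fun i _ => hparts i
    _ = -∫ y in U, ∑ i, pd i (flux G f i) y * q y := by
        congr 1
        refine (setIntegral_eq_integral_of_forall_compl_eq_zero fun y hy => ?_).symm
        exact Finset.sum_eq_zero fun i _ => by rw [hqK y (fun h => hy (hKU h)), mul_zero]
    _ = _ := by
        congr 1
        refine setIntegral_congr_fun hU fun y hy => ?_
        rw [← Finset.sum_mul, H.sum_pd_flux hf hy, hqU y hy]
        ring

end Divergence

/-! ### Functions on the manifold -/

section Functions

variable {n : ℕ} {M : Type*} [TopologicalSpace M] [ChartedSpace (Coord n) M]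

lemma continuous_of_chartPt {u : M → ℝ}
    (h : ∀ x₀ : M, ContinuousOn (fun z : Coord n => u (chartPt x₀ z)) (tgt n x₀)) :
    Continuous u := by
  rw [continuous_iff_continuousAt]
  intro x
  have h1 : ContinuousOn (fun w => u (chartPt x (extChartAt (𝓡 n) x w))) (src n x) :=
    (h x).comp (continuousOn_extChartAt x) fun w hw => (extChartAt (𝓡 n) x).map_source hw
  exact (h1.congr fun w hw => by rw [chartPt_extChartAt hw]).continuousAt
    ((isOpen_src x).mem_nhds (mem_extChartAt_source x))

variable [IsManifold (𝓡 n) ∞ M]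

lemma contDiffOn_comp_chartPt {u : M → ℝ} (hu : ContMDiff (𝓡 n) 𝓘(ℝ) ∞ u) (x₀ : M) :
    ContDiffOn ℝ ∞ (fun z : Coord n => u (chartPt x₀ z)) (tgt n x₀) := by
  rw [← contMDiffOn_iff_contDiffOn]
  exact hu.comp_contMDiffOn (contMDiffOn_chartPt x₀)

lemma contMDiff_of_chartPt {u : M → ℝ}
    (h : ∀ x₀ : M, ContDiffOn ℝ ∞ (fun z : Coord n => u (chartPt x₀ z)) (tgt n x₀)) :
    ContMDiff (𝓡 n) 𝓘(ℝ) ∞ u := by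
  intro x
  have hsm : ContMDiffOn (𝓡 n) (𝓡 n) ∞ (extChartAt (𝓡 n) x) (src n x) := by
    simpa [src, extChartAt_source] using contMDiffOn_extChartAt (I := 𝓡 n) (n := ∞) (x := x)
  have h1 : ContMDiffOn (𝓡 n) 𝓘(ℝ) ∞ (fun w => u (chartPt x (extChartAt (𝓡 n) x w))) (src n x) :=
    (contMDiffOn_iff_contDiffOn.2 (h x)).comp hsm
      fun w hw => (extChartAt (𝓡 n) x).map_source hw
  exact (h1.congr fun w hw => by rw [chartPt_extChartAt hw]).contMDiffAt
    ((isOpen_src x).mem_nhds (mem_extChartAt_source x))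

lemma differentiableAt_comp_chartPt {u : M → ℝ} (hu : ContMDiff (𝓡 n) 𝓘(ℝ) ∞ u) {x₀ : M}
    {y : Coord n} (hy : y ∈ tgt n x₀) : DifferentiableAt ℝ (fun z : Coord n => u (chartPt x₀ z)) y :=
  differentiableAt_of_contDiffOn (isOpen_tgt x₀) (contDiffOn_comp_chartPt hu x₀) hy

variable [RiemannianBundle (fun x : M => TangentSpace (𝓡 n) x)]

section Gradient

variable {u v w : M → ℝ} {x : M}

omit [IsManifold (𝓡 n) ∞ M] in
lemma gradIn_eq_zero_of_notMem_tsupport (hx : x ∉ tsupport u) : gradIn (n := n) u v x = 0 := by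
  have h1 : ∀ i, pd i (fun z => u (chartPt x z)) (ownCoord x : Coord n) = 0 := by
    intro i
    set V := tgt n x ∩ chartPt x ⁻¹' (tsupport u)ᶜ with hV
    have hVo : IsOpen V := (continuousOn_extChartAt_symm x).isOpen_inter_preimage (isOpen_tgt x)
      (isClosed_tsupport u).isOpen_compl
    refine pd_eq_zero_of_const hVo (c := 0) (fun z hz => image_eq_zero_of_notMem_tsupport hz.2) ?_ i
    exact ⟨ownCoord_mem x, by rw [Set.mem_preimage, chartPt_ownCoord]; exact hx⟩
  simp [gradIn, gradM, h1]

omit [IsManifold (𝓡 n) ∞ M] in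
lemma hasCompactSupport_gradIn (hu : HasCompactSupport u) :
    HasCompactSupport (gradIn (n := n) u v) :=
  hu.of_isClosed_subset (isClosed_tsupport _) (closure_minimal (fun x hx => by
    by_contra h; exact hx (gradIn_eq_zero_of_notMem_tsupport h)) (isClosed_tsupport u))

lemma gradIn_sum {ι : Type*} {s : Finset ι} {F : ι → M → ℝ}
    (hF : ∀ i ∈ s, ContMDiff (𝓡 n) 𝓘(ℝ) ∞ (F i)) (v : M → ℝ) (x : M) :
    gradIn (n := n) (fun z => ∑ i ∈ s, F i z) v x = ∑ i ∈ s, gradIn (n := n) (F i) v x := by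
  simp only [gradIn, gradM]
  have h1 : ∀ a, pd a (fun z => ∑ i ∈ s, F i (chartPt x z)) (ownCoord x : Coord n)
      = ∑ i ∈ s, pd a (fun z => F i (chartPt x z)) (ownCoord x) := fun a =>
    pd_sum (F := fun i z => F i (chartPt x z))
      (fun i hi => differentiableAt_comp_chartPt (hF i hi) (ownCoord_mem x)) a
  simp only [h1, Finset.sum_mul, Finset.mul_sum]
  rw [Finset.sum_congr rfl fun i _ => Finset.sum_comm, Finset.sum_comm]

lemma gradIn_mul (hu : ContMDiff (𝓡 n) 𝓘(ℝ) ∞ u) (hv : ContMDiff (𝓡 n) 𝓘(ℝ) ∞ v) (w : M → ℝ)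
    (x : M) : gradIn (n := n) (fun z => u z * v z) w x
      = u x * gradIn (n := n) v w x + v x * gradIn (n := n) u w x := by
  simp only [gradIn, gradM]
  have h1 : ∀ a, pd a (fun z => u (chartPt x z) * v (chartPt x z)) (ownCoord x : Coord n)
      = pd a (fun z => u (chartPt x z)) (ownCoord x) * v x
        + u x * pd a (fun z => v (chartPt x z)) (ownCoord x) := by
    intro a
    rw [pd_mul (differentiableAt_comp_chartPt hu (ownCoord_mem x))
      (differentiableAt_comp_chartPt hv (ownCoord_mem x)), chartPt_ownCoord]
  simp only [h1, Finset.mul_sum, ← Finset.sum_add_distrib]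
  exact Finset.sum_congr rfl fun i _ => Finset.sum_congr rfl fun j _ => by ring

lemma gradIn_comp_real (hu : ContMDiff (𝓡 n) 𝓘(ℝ) ∞ u) {φ : ℝ → ℝ} {φ' : ℝ}
    (hφ : HasDerivAt φ φ' (u x)) (w : M → ℝ) :
    gradIn (n := n) (fun z => φ (u z)) w x = φ' * gradIn (n := n) u w x := by
  simp only [gradIn, gradM, Finset.mul_sum]
  have h1 : ∀ a, pd a (fun z => φ (u (chartPt x z))) (ownCoord x : Coord n)
      = φ' * pd a (fun z => u (chartPt x z)) (ownCoord x) := by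
    intro a
    refine pd_comp_real (f := fun z => u (chartPt x z)) ?_
      (differentiableAt_comp_chartPt hu (ownCoord_mem x)) a
    rwa [chartPt_ownCoord]
  simp only [h1]
  exact Finset.sum_congr rfl fun i _ => Finset.sum_congr rfl fun j _ => by ring

variable [IsContMDiffRiemannianBundle (𝓡 n) ∞ (Coord n) (fun x : M => TangentSpace (𝓡 n) x)]

lemma gradIn_comm (u v : M → ℝ) (x : M) : gradIn (n := n) u v x = gradIn (n := n) v u x := by
  simp only [gradIn, gradM]
  rw [Finset.sum_comm]
  have H := isLocalMetric_gLow (n := n) x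
  refine Finset.sum_congr rfl fun i _ => Finset.sum_congr rfl fun j _ => ?_
  have e : (gLow x (ownCoord x : Coord n))⁻¹ j i = (gLow x (ownCoord x : Coord n))⁻¹ i j :=
    congrFun (congrFun (H.inv_transpose (ownCoord_mem x)) i) j
  rw [e, mul_comm (pd j _ _)]

lemma gradIn_self_nonneg (u : M → ℝ) (x : M) : 0 ≤ gradIn (n := n) u u x := by
  have H := isLocalMetric_gLow (n := n) x
  have h := (H.posDef _ (ownCoord_mem x)).inv.posSemidef.dotProduct_mulVec_nonneg
    (fun i => pd i (fun z => u (chartPt x z)) (ownCoord x : Coord n))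
  simp only [star_trivial, dotProduct, Matrix.mulVec, Finset.mul_sum] at h
  refine h.trans_eq ?_
  simp only [gradIn, gradM]
  exact Finset.sum_congr rfl fun i _ => Finset.sum_congr rfl fun j _ => by ring

lemma continuous_gradIn (hu : ContMDiff (𝓡 n) 𝓘(ℝ) ∞ u) (hv : ContMDiff (𝓡 n) 𝓘(ℝ) ∞ v) :
    Continuous (gradIn (n := n) u v) := by
  refine continuous_of_chartPt (n := n) fun x₀ => ?_
  refine ((isLocalMetric_gLow x₀).smooth_gradM (contDiffOn_comp_chartPt hu x₀)
    (contDiffOn_comp_chartPt hv x₀)).continuousOn.congr fun y hy => ?_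
  exact gradIn_chartPt hy (differentiableAt_comp_chartPt hu hy)
    (differentiableAt_comp_chartPt hv hy)

end Gradient

variable [IsContMDiffRiemannianBundle (𝓡 n) ∞ (Coord n) (fun x : M => TangentSpace (𝓡 n) x)]

section Curvature

lemma normE_sq_chartPt {x₀ : M} {y : Coord n} (hy : y ∈ tgt n x₀) :
    normE (n := n) (chartPt x₀ y) ^ 2 = sqEM (gLow x₀) y := by
  rw [normE_chartPt hy, Real.sq_sqrt]
  have H := isLocalMetric_gLow (n := n) x₀
  obtain ⟨P, hP⟩ := exists_isFrame (H.posDef y hy)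
  rw [H.sqEM_eq hP hy]
  exact Finset.sum_nonneg fun i _ => Finset.sum_nonneg fun j _ => sq_nonneg _

lemma contMDiff_normE_sq : ContMDiff (𝓡 n) 𝓘(ℝ) ∞ (fun x : M => normE (n := n) x ^ 2) :=
  contMDiff_of_chartPt fun x₀ => ((isLocalMetric_gLow (n := n) x₀).smooth_sqEM).congr
    fun _ hy => normE_sq_chartPt hy

omit [IsManifold (𝓡 n) ∞ M]
  [IsContMDiffRiemannianBundle (𝓡 n) ∞ (Coord n) (fun x : M => TangentSpace (𝓡 n) x)] in
lemma normE_nonneg (x : M) : 0 ≤ normE (n := n) x := Real.sqrt_nonneg _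

omit [IsManifold (𝓡 n) ∞ M]
  [IsContMDiffRiemannianBundle (𝓡 n) ∞ (Coord n) (fun x : M => TangentSpace (𝓡 n) x)] in
lemma normW_nonneg (x : M) : 0 ≤ normW (n := n) x := Real.sqrt_nonneg _

lemma continuous_normE : Continuous (fun x : M => normE (n := n) x) := by
  have h := (contMDiff_normE_sq (n := n) (M := M)).continuous.sqrt
  simpa only [Real.sqrt_sq (normE_nonneg (n := n) _)] using h

lemma continuous_normW : Continuous (fun x : M => normW (n := n) x) :=
  continuous_of_chartPt (n := n) fun x₀ =>
    ((contDiffOn_sqWCoord x₀).continuousOn.sqrt).congr fun _ hy => normW_chartPt hy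

/-- The scalar curvature is locally constant, because the trace of the Codazzi equation is
`dR = div Ric = 0`, hence constant on the connected manifold. -/
lemma exists_scal_eq [ConnectedSpace M] (h : HasHarmonicCurvature n M) :
    ∃ R : ℝ, ∀ x : M, scal (n := n) x = R := by
  have hl : IsLocallyConstant (fun x : M => scal (n := n) x) := by
    rw [IsLocallyConstant.iff_eventually_eq]
    intro x
    have H := isLocalMetric_gLow (n := n) x
    obtain ⟨r, hr, hb⟩ := Metric.isOpen_iff.1 (isOpen_tgt (n := n) x) _ (ownCoord_mem x)
    have hc : ∀ z ∈ Metric.ball (ownCoord x : Coord n) r,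
        scalM (gLow x) z = scalM (gLow x) (ownCoord x : Coord n) := by
      intro z hz
      refine Metric.isOpen_ball.is_const_of_fderiv_eq_zero
        (convex_ball (ownCoord x : Coord n) r).isPreconnected (𝕜 := ℝ)
        ((H.smooth_scalM.differentiableOn (by simp)).mono hb) ?_ hz (Metric.mem_ball_self hr)
      intro w hw
      ext v
      rw [fderiv_eq_sum_pd]
      exact Finset.sum_eq_zero fun i _ => by
        rw [H.pd_scalM_eq_zero (isHarmonicOn_gLow h x) (hb hw), mul_zero]
    have hV : IsOpen (src n x ∩ extChartAt (𝓡 n) x ⁻¹' Metric.ball (ownCoord x) r) :=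
      (continuousOn_extChartAt x).isOpen_inter_preimage (isOpen_src x) Metric.isOpen_ball
    filter_upwards [hV.mem_nhds ⟨mem_extChartAt_source x, Metric.mem_ball_self hr⟩] with z hz
    have e1 := scal_chartPt (hb hz.2)
    have e2 := scal_chartPt (ownCoord_mem (n := n) x)
    rw [chartPt_extChartAt hz.1] at e1
    rw [chartPt_ownCoord] at e2
    rw [e1, e2, hc _ hz.2]
  obtain ⟨x₀⟩ := (inferInstance : Nonempty M)
  exact ⟨scal x₀, fun x => hl.apply_eq_of_isPreconnected isPreconnected_univ trivial trivial⟩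

end Curvature

end Functions

/-! ### The weak form of the Bochner inequality -/

section WeakBochner

/-- The Bochner inequality for `|E|²`, with the refined Kato inequality in terms of
`√(|E|² + ε²)`.  The regularization makes it hold at the zeros of `E` as well. -/
lemma IsLocalMetric.le_lap_sqEM {n : ℕ} {U : Set (Coord n)} {G : MatFun n}
    (H : IsLocalMetric U G) (hn : 3 ≤ n) (hH : IsHarmonicOn U G) {P : Matrix (Fin n) (Fin n) ℝ}
    {y : Coord n} (hP : IsFrame (G y) P) (hy : y ∈ U) {ε : ℝ} (hε : 0 < ε) :
    2 * ((1 + 2 / n) * gradM G (fun z => √(sqEM G z + ε ^ 2)) (fun z => √(sqEM G z + ε ^ 2)) y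
      + (scalM G y / (n - 1) - (n / (n - 2) * √(sqEM G y) + √(sqW (riemF G P y)))) * sqEM G y)
      ≤ lap G (sqEM G) y := by
  obtain ⟨Q, hQ, h1, h2⟩ := H.exists_bochner hn hH hP hy
  have hf : 0 ≤ sqEM G y := by
    rw [H.sqEM_eq hP hy]; exact sqE_nonneg _
  have hn' : (0 : ℝ) < n := by positivity
  set f := sqEM G y
  have hpos : 0 < f + ε ^ 2 := by positivity
  have hs : 0 < √(f + ε ^ 2) := Real.sqrt_pos.2 hpos
  have hd : ∀ i, pd i (fun z => √(sqEM G z + ε ^ 2)) y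
      = 1 / (2 * √(f + ε ^ 2)) * pd i (sqEM G) y := by
    intro i
    have hdf := differentiableAt_of_contDiffOn H.isOpen H.smooth_sqEM hy
    exact pd_comp_real (φ := fun t => √(t + ε ^ 2))
      (((hasDerivAt_id f).add_const (ε ^ 2)).sqrt hpos.ne') hdf i
  have hg : gradM G (fun z => √(sqEM G z + ε ^ 2)) (fun z => √(sqEM G z + ε ^ 2)) y
      = gradM G (sqEM G) (sqEM G) y / (4 * (f + ε ^ 2)) := by
    simp only [gradM, hd, Finset.sum_div]
    refine Finset.sum_congr rfl fun i _ => Finset.sum_congr rfl fun j _ => ?_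
    have hsq : √(f + ε ^ 2) ^ 2 = f + ε ^ 2 := Real.sq_sqrt hpos.le
    rw [show 4 * (f + ε ^ 2) = 4 * √(f + ε ^ 2) ^ 2 by rw [hsq]]
    field_simp
    ring
  have h3 : (1 + 2 / n) * (gradM G (sqEM G) (sqEM G) y / (4 * (f + ε ^ 2))) ≤ Q := by
    rw [← mul_div_assoc, div_le_iff₀ (by positivity), one_add_div hn'.ne', div_mul_eq_mul_div,
      div_le_iff₀ hn']
    have : 0 ≤ n * ε ^ 2 * Q := by positivity
    linarith
  rw [hg]
  linarith

variable {n : ℕ} {M : Type*} [TopologicalSpace M] [ChartedSpace (Coord n) M]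
  [IsManifold (𝓡 n) ∞ M] [RiemannianBundle (fun x : M => TangentSpace (𝓡 n) x)]
  [IsContMDiffRiemannianBundle (𝓡 n) ∞ (Coord n) (fun x : M => TangentSpace (𝓡 n) x)]

variable (n) in
/-- `√(|E|² + ε²)`, a smooth approximation of `|E|`. -/
def regE (ε : ℝ) (x : M) : ℝ := √(normE (n := n) x ^ 2 + ε ^ 2)

variable (n) in
/-- The lower bound for `Δ|E|²` that the Bochner formula and the refined Kato inequality give. -/
def lapLower (ε : ℝ) (x : M) : ℝ :=
  2 * ((1 + 2 / n) * gradIn (n := n) (regE n ε) (regE n ε) x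
    + (scal (n := n) x / (n - 1) - (n / (n - 2) * normE (n := n) x + normW (n := n) x))
      * normE (n := n) x ^ 2)

lemma contMDiff_regE {ε : ℝ} (hε : 0 < ε) : ContMDiff (𝓡 n) 𝓘(ℝ) ∞ (regE n ε : M → ℝ) := by
  refine contMDiff_of_chartPt fun x₀ => ?_
  refine ContDiffOn.sqrt ((contDiffOn_comp_chartPt (contMDiff_normE_sq (n := n)) x₀).add
    contDiffOn_const) fun z _ => ?_
  positivity

/-- The Bochner inequality in the chart around `x₀`, for the functions `|E|²` and `√(|E|² + ε²)` on
the manifold. -/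
lemma lapLower_le (hn : 3 ≤ n) (h : HasHarmonicCurvature n M) {ε : ℝ} (hε : 0 < ε) {x₀ : M}
    {y : Coord n} (hy : y ∈ tgt n x₀) : lapLower n ε (chartPt x₀ y)
      ≤ lap (gLow x₀) (fun z => normE (n := n) (chartPt x₀ z) ^ 2) y := by
  have H := isLocalMetric_gLow (n := n) x₀
  obtain ⟨P, hP⟩ := exists_isFrame (H.posDef y hy)
  have h1 := H.le_lap_sqEM hn (isHarmonicOn_gLow h x₀) hP hy hε
  have hU := isOpen_tgt (n := n) x₀
  have e1 : ∀ z ∈ tgt n x₀, normE (n := n) (chartPt x₀ z) ^ 2 = sqEM (gLow x₀) z :=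
    fun z hz => normE_sq_chartPt hz
  have e2 : ∀ j, ∀ z ∈ tgt n x₀, pd j (fun z => normE (n := n) (chartPt x₀ z) ^ 2) z
      = pd j (sqEM (gLow x₀)) z := fun j z hz => pd_congr hU e1 hz j
  have e3 : lap (gLow x₀) (fun z => normE (n := n) (chartPt x₀ z) ^ 2) y
      = lap (gLow x₀) (sqEM (gLow x₀)) y := by
    simp only [lap]
    refine Finset.sum_congr rfl fun i _ => Finset.sum_congr rfl fun j _ => ?_
    rw [pd_congr hU (e2 j) hy i]
    simp only [e2 _ y hy]
  have e4 : gradIn (n := n) (regE n ε) (regE n ε) (chartPt x₀ y) = gradM (gLow x₀)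
      (fun z => √(sqEM (gLow x₀) z + ε ^ 2)) (fun z => √(sqEM (gLow x₀) z + ε ^ 2)) y := by
    rw [gradIn_chartPt hy (differentiableAt_comp_chartPt (contMDiff_regE hε) hy)
      (differentiableAt_comp_chartPt (contMDiff_regE hε) hy)]
    have : ∀ i, pd i (fun z => regE n ε (chartPt x₀ z)) y
        = pd i (fun z => √(sqEM (gLow x₀) z + ε ^ 2)) y := fun i =>
      pd_congr hU (fun z hz => by rw [regE, e1 z hz]) hy i
    simp only [gradM, this]
  rw [lapLower, e3, e4, scal_chartPt hy, normE_sq_chartPt hy, normE_chartPt hy, normW_chartPt hy,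
    sqWCoord_eq hP hy]
  exact h1

variable [MeasurableSpace M] [BorelSpace M]

lemma integrableOn_of_support_subset {U K : Set (Coord n)} (hU : IsOpen U) {h : Coord n → ℝ}
    (hh : ContinuousOn h U) (hK : IsCompact K) (hKU : K ⊆ U) (hs : ∀ y ∈ U, y ∉ K → h y = 0) :
    IntegrableOn h U := by
  rw [← integrable_indicator_iff hU.measurableSet]
  refine integrable_of_support_subset
    (hh.congr fun y hy => Set.indicator_of_mem hy h) hK hKU fun y hy => ?_
  by_cases hyU : y ∈ U
  · rw [Set.indicator_of_mem hyU, hs y hyU hy]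
  · exact Set.indicator_of_notMem hyU h

/-- The weak form of `F ≤ Δf` for a test function supported in the domain of one chart. -/
lemma integral_gradIn_le_of_tsupport {f F p : M → ℝ} [T2Space M]
    [SecondCountableTopology M] (hf : ContMDiff (𝓡 n) 𝓘(ℝ) ∞ f) (hF : Continuous F)
    (hfF : ∀ x₀ : M, ∀ y ∈ tgt n x₀, F (chartPt x₀ y) ≤ lap (gLow x₀) (fun z => f (chartPt x₀ z)) y)
    (hp : ContMDiff (𝓡 n) 𝓘(ℝ) ∞ p) (hpc : HasCompactSupport p) (hp0 : ∀ x, 0 ≤ p x) {x₀ : M}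
    (hps : tsupport p ⊆ src n x₀) :
    ∫ x, gradIn (n := n) p f x ∂riemVolume n M ≤ -∫ x, p x * F x ∂riemVolume n M := by
  have H := isLocalMetric_gLow (n := n) x₀
  -- the compact support of `p` in coordinates
  set K : Set (Coord n) := extChartAt (𝓡 n) x₀ '' tsupport p with hK
  have hKc : IsCompact K := hpc.isCompact.image_of_continuousOn
    ((continuousOn_extChartAt x₀).mono hps)
  have hKt : K ⊆ tgt n x₀ := by
    rintro _ ⟨x, hx, rfl⟩
    exact (extChartAt (𝓡 n) x₀).map_source (hps hx)
  have hKp : ∀ y ∈ tgt n x₀, y ∉ K → p (chartPt x₀ y) = 0 := by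
    intro y hy hyK
    refine image_eq_zero_of_notMem_tsupport fun h => hyK ⟨_, h, extChartAt_chartPt hy⟩
  have hpd := contDiffOn_comp_chartPt hp x₀
  have hfd := contDiffOn_comp_chartPt hf x₀
  have hpF : Continuous fun x => p x * F x := hp.continuous.mul hF
  rw [integral_eq_of_support (x₀ := x₀) (continuous_gradIn hp hf).aestronglyMeasurable,
    integral_eq_of_support (x₀ := x₀) hpF.aestronglyMeasurable]
  · have h1 := H.integral_gradM hfd hpd hKc hKt hKp
    have h2 : ∫ y in tgt n x₀, volDens x₀ y * gradIn (n := n) p f (chartPt x₀ y)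
        = ∫ y in tgt n x₀, √(gLow x₀ y).det
          * gradM (gLow x₀) (fun z => p (chartPt x₀ z)) (fun z => f (chartPt x₀ z)) y := by
      refine setIntegral_congr_fun (isOpen_tgt x₀).measurableSet fun y hy => ?_
      rw [gradIn_chartPt hy (differentiableAt_comp_chartPt hp hy)
        (differentiableAt_comp_chartPt hf hy)]
      rfl
    rw [h2, h1]
    refine neg_le_neg (setIntegral_mono_on ?_ ?_ (isOpen_tgt x₀).measurableSet fun y hy => ?_)
    · refine integrableOn_of_support_subset (isOpen_tgt x₀) ((continuousOn_volDens x₀).mul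
        (hpF.comp_continuousOn (continuousOn_chartPt x₀))) hKc hKt fun y hy hyK => ?_
      simp [hKp y hy hyK]
    · refine integrableOn_of_support_subset (isOpen_tgt x₀) ((continuousOn_volDens x₀).mul
        (hpd.continuousOn.mul (H.smooth_lap hfd).continuousOn)) hKc hKt fun y hy hyK => ?_
      simp [hKp y hy hyK]
    · exact mul_le_mul_of_nonneg_left (mul_le_mul_of_nonneg_left (hfF x₀ y hy) (hp0 _))
        (volDens_pos hy).le
  · intro x hx
    by_contra h
    refine hx (show p x * F x = 0 from ?_)
    rw [image_eq_zero_of_notMem_tsupport fun h' => h (hps h'), zero_mul]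
  · intro x hx
    by_contra h
    exact hx (gradIn_eq_zero_of_notMem_tsupport fun h' => h (hps h'))

/-- If `F ≤ Δf` in every chart, then `F ≤ Δf` in the weak sense: a partition of unity splits the
test function. -/
lemma integral_gradIn_le {f F ψ : M → ℝ} [T2Space M] [SecondCountableTopology M]
    (hf : ContMDiff (𝓡 n) 𝓘(ℝ) ∞ f) (hF : Continuous F)
    (hfF : ∀ x₀ : M, ∀ y ∈ tgt n x₀, F (chartPt x₀ y) ≤ lap (gLow x₀) (fun z => f (chartPt x₀ z)) y)
    (hψ : ContMDiff (𝓡 n) 𝓘(ℝ) ∞ ψ) (hψc : HasCompactSupport ψ) (hψ0 : ∀ x, 0 ≤ ψ x) :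
    ∫ x, gradIn (n := n) ψ f x ∂riemVolume n M ≤ -∫ x, ψ x * F x ∂riemVolume n M := by
  have : LocallyCompactSpace M := ChartedSpace.locallyCompactSpace (Coord n) M
  obtain ⟨ρ, hρ⟩ := SmoothPartitionOfUnity.exists_isSubordinate_chartAt_source (𝓡 n) M
  have hfin := ρ.locallyFinite.finite_nonempty_inter_compact hψc.isCompact
  set s := hfin.toFinset with hs
  have hsum : ψ = fun x => ∑ i ∈ s, ρ i x * ψ x := by
    funext x
    rw [← Finset.sum_mul]
    by_cases hx : x ∈ tsupport ψ
    · have h1 := ρ.sum_eq_one (Set.mem_univ x)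
      rw [finsum_eq_sum_of_support_subset (s := s)] at h1
      · rw [h1, one_mul]
      · intro i hi
        rw [hs, Set.Finite.coe_toFinset]
        exact ⟨x, hi, hx⟩
    · rw [image_eq_zero_of_notMem_tsupport hx, mul_zero]
  have hpd : ∀ i, ContMDiff (𝓡 n) 𝓘(ℝ) ∞ (fun x => ρ i x * ψ x) := fun i =>
    (ρ i).contMDiff.mul hψ
  have hpc : ∀ i, HasCompactSupport (fun x => ρ i x * ψ x) := fun i => hψc.mul_left
  have hpt : ∀ i, tsupport (fun x => ρ i x * ψ x) ⊆ src n i := fun i =>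
    (tsupport_mul_subset_left (f := fun x => ρ i x) (g := ψ)).trans
      ((hρ i).trans (by rw [src, extChartAt_source]))
  have hi1 : ∀ i, Integrable (gradIn (n := n) (fun x => ρ i x * ψ x) f) (riemVolume n M) := fun i =>
    (continuous_gradIn (hpd i) hf).integrable_of_hasCompactSupport (hasCompactSupport_gradIn (hpc i))
  have hi2 : ∀ i, Integrable (fun x => ρ i x * ψ x * F x) (riemVolume n M) := fun i =>
    ((hpd i).continuous.mul hF).integrable_of_hasCompactSupport (hpc i).mul_right
  have e1 : ∀ x, gradIn (n := n) ψ f x = ∑ i ∈ s, gradIn (n := n) (fun x => ρ i x * ψ x) f x := by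
    intro x
    conv_lhs => rw [hsum]
    exact gradIn_sum (fun i _ => hpd i) f x
  have e2 : ∀ x, ψ x * F x = ∑ i ∈ s, ρ i x * ψ x * F x := by
    intro x
    rw [← Finset.sum_mul, ← congrFun hsum x]
  simp only [e1, e2]
  rw [integral_finsetSum _ fun i _ => hi1 i, integral_finsetSum _ fun i _ => hi2 i,
    ← Finset.sum_neg_distrib]
  exact Finset.sum_le_sum fun i _ => integral_gradIn_le_of_tsupport hf hF hfF (hpd i) (hpc i)
    (fun x => mul_nonneg (ρ.nonneg i x) (hψ0 x)) (hpt i)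

end WeakBochner

/-! ### Complete Riemannian manifolds are proper -/

section Proper

open Metric

variable {n : ℕ} {M : Type*} [EMetricSpace M] [ChartedSpace (Coord n) M]
  [RiemannianBundle (fun x : M => TangentSpace (𝓡 n) x)] [IsRiemannianManifold (𝓡 n) M]

variable (n) in
include n in
/-- A Riemannian manifold is a length space. -/
lemma exists_edist_lt_edist_le {x k : M} {a b : ℝ≥0∞} (ha : 0 < a) (h : edist x k < a + b) :
    ∃ w, edist x w < a ∧ edist w k ≤ b := by
  rcases lt_or_ge (edist x k) a with h1 | h1
  · exact ⟨k, h1, by simp⟩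
  rcases eq_or_ne b ⊤ with rfl | hb
  · exact ⟨x, by simpa using ha, le_top⟩
  rw [IsRiemannianManifold.out (I := 𝓡 n) x k] at h
  obtain ⟨γ, γ0, γ1, hγ, hL⟩ := Manifold.exists_lt_of_riemannianEDist_lt h
  set L := Manifold.pathELength (𝓡 n) γ 0 1
  have h2 : L - b < a := by
    rcases le_total b L with hbL | hbL
    · exact ENNReal.sub_lt_of_lt_add hbL hL
    · rwa [tsub_eq_zero_of_le hbL]
  obtain ⟨a', ha1, ha2⟩ := exists_between h2
  have hL' : L < a' + b := by
    calc L ≤ L - b + b := le_tsub_add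
      _ < a' + b := (ENNReal.add_lt_add_iff_right hb).2 ha1
  have hsub : ∀ s t : ℝ, 0 ≤ s → s ≤ t → t ≤ 1 →
      edist (γ s) (γ t) ≤ Manifold.pathELength (𝓡 n) γ s t := by
    intro s t hs hst ht
    rw [IsRiemannianManifold.out (I := 𝓡 n) (γ s) (γ t)]
    exact Manifold.riemannianEDist_le_pathELength (hγ.mono (Set.Icc_subset_Icc hs ht)) rfl rfl hst
  have hc : ContinuousOn (fun t => edist x (γ t)) (Set.Icc 0 1) :=
    (continuous_const.edist continuous_id).comp_continuousOn hγ.continuousOn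
  obtain ⟨t, ht, hta⟩ := intermediate_value_Icc zero_le_one hc
    (show a' ∈ Set.Icc (edist x (γ 0)) (edist x (γ 1)) by
      rw [γ0, γ1, edist_self]; exact ⟨zero_le, ha2.le.trans h1⟩)
  refine ⟨γ t, by simpa only [hta] using ha2, ?_⟩
  have e1 := hsub 0 t le_rfl ht.1 ht.2
  have e2 := hsub t 1 ht.1 ht.2 le_rfl
  have e3 : Manifold.pathELength (𝓡 n) γ 0 t + Manifold.pathELength (𝓡 n) γ t 1 = L :=
    Manifold.pathELength_add ht.1 ht.2
  rw [γ0] at e1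
  rw [γ1] at e2
  have ha3 : a' ≠ ⊤ := ne_top_of_lt ha2
  have e4 : a' + Manifold.pathELength (𝓡 n) γ t 1 < a' + b := by
    refine lt_of_le_of_lt ?_ hL'
    rw [← e3]
    gcongr
    rwa [← hta]
  exact e2.trans ((ENNReal.add_lt_add_iff_left ha3).1 e4).le

variable (n) in
include n in
lemma exists_mem_cthickening {K : Set M} {x : M} {r r' δ : ℝ} (hx : x ∈ cthickening r K)
    (hδ : 0 < δ) (h : r < r' + δ) (hr' : 0 ≤ r') : ∃ w ∈ cthickening r' K, edist x w < ENNReal.ofReal δ := by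
  have h1 : infEDist x K < ENNReal.ofReal δ + ENNReal.ofReal r' := by
    refine lt_of_le_of_lt (mem_cthickening_iff.1 hx) ?_
    rw [← ENNReal.ofReal_add hδ.le hr', ENNReal.ofReal_lt_ofReal_iff (by positivity)]
    linarith
  obtain ⟨k, hk, hxk⟩ := infEDist_lt_iff.1 h1
  obtain ⟨w, hw1, hw2⟩ := exists_edist_lt_edist_le n (ENNReal.ofReal_pos.2 hδ) hxk
  exact ⟨w, mem_cthickening_iff.2 ((infEDist_le_edist_of_mem hk).trans hw2), hw1⟩

variable (n) in
include n in
/-- The Hopf-Rinow theorem: in a complete Riemannian manifold the closed thickenings of compact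
sets are compact.  The set of admissible radii is closed because a thickening of radius `r` is
totally bounded if those of smaller radius are, and open because the manifold is locally
compact. -/
lemma isCompact_cthickening [CompleteSpace M] {K : Set M} (hK : IsCompact K) (R : ℝ) :
    IsCompact (cthickening R K) := by
  have : LocallyCompactSpace M := ChartedSpace.locallyCompactSpace (Coord n) M
  rcases le_or_gt R 0 with hR | hR
  · rw [cthickening_of_nonpos hR, hK.isClosed.closure_eq]; exact hK
  set S : Set ℝ := {r | IsCompact (cthickening r K)} with hS
  have hmono : ∀ r r', r ≤ r' → r' ∈ S → r ∈ S := fun r r' h hr' =>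
    IsCompact.of_isClosed_subset hr' isClosed_cthickening (cthickening_mono h K)
  have hsub : Set.Icc 0 R ⊆ S := by
    refine IsClosed.Icc_subset_of_forall_exists_gt ?_ ?_ ?_
    · refine isClosed_of_closure_subset fun r hr => ?_
      have hrI : r ∈ Set.Icc 0 R := closure_minimal Set.inter_subset_right isClosed_Icc hr
      refine ⟨TotallyBounded.isCompact_of_isClosed ?_ isClosed_cthickening, hrI⟩
      rw [EMetric.totallyBounded_iff]
      intro ε hε
      obtain ⟨δ, hδ0, hδ⟩ : ∃ δ : ℝ, 0 < δ ∧ ENNReal.ofReal δ + ENNReal.ofReal δ ≤ ε := by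
        rcases eq_or_ne ε ⊤ with rfl | hε'
        · exact ⟨1, one_pos, le_top⟩
        · have hp : 0 < ε.toReal := ENNReal.toReal_pos hε.ne' hε'
          refine ⟨ε.toReal / 2, by positivity, ?_⟩
          rw [← ENNReal.ofReal_add (by positivity) (by positivity), add_halves,
            ENNReal.ofReal_toReal hε']
      obtain ⟨r', hr', hrr'⟩ := Metric.mem_closure_iff.1 hr δ hδ0
      rw [Real.dist_eq, abs_lt] at hrr'
      obtain ⟨t, htf, ht⟩ := EMetric.totallyBounded_iff.1
        (show IsCompact (cthickening r' K) from hr'.1).totallyBounded (ENNReal.ofReal δ)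
        (ENNReal.ofReal_pos.2 hδ0)
      refine ⟨t, htf, fun x hx => ?_⟩
      obtain ⟨w, hw, hxw⟩ := exists_mem_cthickening n hx hδ0 (by linarith) hr'.2.1
      obtain ⟨z, hz, hwz⟩ := Set.mem_iUnion₂.1 (ht hw)
      refine Set.mem_iUnion₂.2 ⟨z, hz, ?_⟩
      calc edist x z ≤ edist x w + edist w z := edist_triangle _ _ _
        _ < ENNReal.ofReal δ + ENNReal.ofReal δ := ENNReal.add_lt_add hxw hwz
        _ ≤ ε := hδ
    · show IsCompact (cthickening 0 K)
      rw [cthickening_zero, hK.isClosed.closure_eq]; exact hK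
    · rintro r ⟨hr, hr0, hrR⟩ r' hr'
      obtain ⟨δ, hδ0, hδ⟩ := IsCompact.exists_isCompact_cthickening hr
      have hmem : r + δ / 2 ∈ S := by
        refine IsCompact.of_isClosed_subset hδ isClosed_cthickening fun x hx => ?_
        obtain ⟨w, hw, hxw⟩ := exists_mem_cthickening n hx hδ0 (by linarith) hr0
        exact mem_cthickening_iff.2 ((infEDist_le_edist_of_mem hw).trans hxw.le)
      refine ⟨min (r + δ / 2) r', hmono _ _ (min_le_left _ _) hmem, ?_, min_le_right _ _⟩
      exact lt_min (by linarith) hr'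
  exact hsub ⟨hR.le, le_rfl⟩

end Proper

/-! ### The norms of tangent vectors and of differentials -/

section Norms

open Matrix

variable {n : ℕ}

/-- The Cauchy-Schwarz inequality for a positive definite matrix and its inverse. -/
lemma sq_dotProduct_le {g : Matrix (Fin n) (Fin n) ℝ} (hg : g.PosDef) (p v : Fin n → ℝ) :
    (p ⬝ᵥ v) ^ 2 ≤ (p ⬝ᵥ g⁻¹ *ᵥ p) * (v ⬝ᵥ g *ᵥ v) := by
  have hu : IsUnit g.det := isUnit_iff_ne_zero.2 hg.det_pos.ne'
  have hT : gᵀ = g := by simpa using hg.isHermitian.eq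
  set q := g⁻¹ *ᵥ p with hq
  have hgq : g *ᵥ q = p := by rw [hq, Matrix.mulVec_mulVec, Matrix.mul_nonsing_inv _ hu, Matrix.one_mulVec]
  have h : ∀ t : ℝ, 0 ≤ (v ⬝ᵥ g *ᵥ v) * (t * t) + (2 * (p ⬝ᵥ v)) * t + p ⬝ᵥ q := by
    intro t
    have h0 := hg.posSemidef.dotProduct_mulVec_nonneg (q + t • v)
    have e1 : q ⬝ᵥ g *ᵥ v = p ⬝ᵥ v := by
      rw [Matrix.dotProduct_mulVec, ← Matrix.mulVec_transpose, hT, hgq]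
    simp only [star_trivial, Matrix.mulVec_add, Matrix.mulVec_smul, add_dotProduct, dotProduct_add,
      smul_dotProduct, dotProduct_smul, smul_eq_mul, hgq, e1] at h0
    rw [dotProduct_comm q p, dotProduct_comm v p] at h0
    linarith
  have := discrim_le_zero h
  rw [discrim] at this
  nlinarith

/-- If `|p(v)| ≤ C |v|` for all `v`, then `|p| ≤ C`. -/
lemma dotProduct_inv_mulVec_le {g : Matrix (Fin n) (Fin n) ℝ} (hg : g.PosDef) {p : Fin n → ℝ}
    {C : ℝ} (h : ∀ v : Fin n → ℝ, (p ⬝ᵥ v) ^ 2 ≤ C * (v ⬝ᵥ g *ᵥ v)) (hC : 0 ≤ C) :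
    p ⬝ᵥ g⁻¹ *ᵥ p ≤ C := by
  have hu : IsUnit g.det := isUnit_iff_ne_zero.2 hg.det_pos.ne'
  have h1 := h (g⁻¹ *ᵥ p)
  rw [Matrix.mulVec_mulVec, Matrix.mul_nonsing_inv _ hu, Matrix.one_mulVec,
    dotProduct_comm (g⁻¹ *ᵥ p)] at h1
  by_contra! h2
  nlinarith

end Norms

/-! ### Smoothing Lipschitz functions in a chart -/

section Smoothing

open Matrix Metric

variable {n : ℕ}

lemma quadForm_smul (g : Matrix (Fin n) (Fin n) ℝ) (t : ℝ) (v : Fin n → ℝ) :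
    (t • v) ⬝ᵥ g *ᵥ (t • v) = t ^ 2 * (v ⬝ᵥ g *ᵥ v) := by
  simp only [Matrix.mulVec_smul, smul_dotProduct, dotProduct_smul, smul_eq_mul]
  ring

/-- Near a point a metric is comparable to its value at the point, with a universal constant. -/
lemma IsLocalMetric.eventually_quadForm_le {U : Set (Coord n)} {G : MatFun n}
    (H : IsLocalMetric U G) {y₀ : Coord n} (hy₀ : y₀ ∈ U) : ∀ᶠ y in nhds y₀, ∀ v : Fin n → ℝ,
      v ⬝ᵥ G y *ᵥ v ≤ 4 * (v ⬝ᵥ G y₀ *ᵥ v) ∧ v ⬝ᵥ G y₀ *ᵥ v ≤ 4 * (v ⬝ᵥ G y *ᵥ v) := by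
  have hcont : ∀ v, ContinuousAt (fun z : Coord n × (Fin n → ℝ) => z.2 ⬝ᵥ G z.1 *ᵥ z.2) (y₀, v) := by
    intro v
    simp only [dotProduct, Matrix.mulVec]
    have hG : ∀ i j, ContinuousAt (fun z : Coord n × (Fin n → ℝ) => G z.1 i j) (y₀, v) :=
      fun i j => ContinuousAt.comp (g := fun y => G y i j) (f := Prod.fst)
        ((H.smooth i j).continuousOn.continuousAt (H.isOpen.mem_nhds hy₀)) continuousAt_fst
    have h2 : ∀ i, ContinuousAt (fun z : Coord n × (Fin n → ℝ) => z.2 i) (y₀, v) := fun i =>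
      ((continuous_apply i).comp continuous_snd).continuousAt
    exact tendsto_finsetSum _ fun i _ => (h2 i).mul
      (tendsto_finsetSum _ fun j _ => (hG i j).mul (h2 j))
  have hcont0 : ∀ v, ContinuousAt (fun z : Coord n × (Fin n → ℝ) => z.2 ⬝ᵥ G y₀ *ᵥ z.2) (y₀, v) := by
    intro v
    simp only [dotProduct, Matrix.mulVec]
    fun_prop
  have hpos : ∀ v : Fin n → ℝ, v ≠ 0 → 0 < v ⬝ᵥ G y₀ *ᵥ v := fun v hv => by
    simpa using (H.posDef y₀ hy₀).dotProduct_mulVec_pos hv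
  have key := (isCompact_sphere (0 : Fin n → ℝ) 1).eventually_forall_of_forall_eventually (x₀ := y₀)
    (P := fun y v => v ⬝ᵥ G y *ᵥ v < 4 * (v ⬝ᵥ G y₀ *ᵥ v) ∧ v ⬝ᵥ G y₀ *ᵥ v < 4 * (v ⬝ᵥ G y *ᵥ v)) (by
      intro v hv
      have hv0 : v ≠ 0 := by rintro rfl; simp at hv
      have hp := hpos v hv0
      exact ((hcont v).eventually_lt (continuousAt_const.mul (hcont0 v)) (by simp only [Pi.mul_apply]; linarith)).and
        ((hcont0 v).eventually_lt (continuousAt_const.mul (hcont v)) (by simp only; linarith)))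
  filter_upwards [key] with y hy v
  by_cases hv : v = 0
  · subst hv; simp
  have hn : 0 < ‖v‖ := norm_pos_iff.2 hv
  have hs : ‖v‖⁻¹ • v ∈ sphere (0 : Fin n → ℝ) 1 := by
    simp [norm_smul, hn.ne']
  have h := hy _ hs
  have hr : 0 < (‖v‖⁻¹) ^ 2 := by positivity
  simp only [quadForm_smul] at h
  constructor
  · nlinarith [h.1]
  · nlinarith [h.2]

/-- Mollification of a function that is Lipschitz with respect to a Euclidean metric `g`, which
does not increase the Lipschitz constant because convolution averages over translates. -/
lemma exists_contDiff_approx {g : Matrix (Fin n) (Fin n) ℝ} (hg : g.PosSemidef)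
    {h : Coord n → ℝ} {y₀ : Coord n} {s L δ : ℝ} (hs : 0 < s) (hL : 0 ≤ L) (hδ : 0 < δ)
    (hc : ContinuousOn h (closedBall y₀ (2 * s)))
    (hh : ∀ y ∈ ball y₀ (2 * s), ∀ y' ∈ ball y₀ (2 * s),
      |h y - h y'| ≤ L * √((y - y').ofLp ⬝ᵥ g *ᵥ (y - y').ofLp)) :
    ∃ F : Coord n → ℝ, ContDiff ℝ ∞ F ∧ (∀ y ∈ ball y₀ s, |F y - h y| ≤ δ) ∧
      ∀ y ∈ ball y₀ s, ∀ v : Coord n, (fderiv ℝ F y v) ^ 2 ≤ L ^ 2 * (v.ofLp ⬝ᵥ g *ᵥ v.ofLp) := by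
  have hK := isCompact_closedBall y₀ (2 * s)
  set k : Coord n → ℝ := (closedBall y₀ (2 * s)).indicator h with hk
  have hki : Integrable k :=
    (integrable_indicator_iff measurableSet_closedBall).2 (hc.integrableOn_compact hK)
  have hkb : ∀ y ∈ ball y₀ (2 * s), k y = h y := fun y hy =>
    Set.indicator_of_mem (ball_subset_closedBall hy) h
  obtain ⟨η, hη, huc⟩ := Metric.uniformContinuousOn_iff.1 (hK.uniformContinuousOn_of_continuous hc)
    δ hδ
  set r := min s η with hr
  have hr0 : 0 < r := lt_min hs hη
  let φ : ContDiffBump (0 : Coord n) := ⟨r / 2, r, by positivity, by linarith⟩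
  set θ : Coord n → ℝ := φ.normed volume with hθ
  set F : Coord n → ℝ := convolution θ k (ContinuousLinearMap.lsmul ℝ ℝ) volume with hF
  have hFd : ContDiff ℝ ∞ F := φ.hasCompactSupport_normed.contDiff_convolution_left _
    φ.contDiff_normed hki.locallyIntegrable
  have hex : ∀ y, Integrable (fun t => θ t * k (y - t)) := fun y =>
    (φ.hasCompactSupport_normed.convolutionExists_left (ContinuousLinearMap.lsmul ℝ ℝ)
      φ.continuous_normed hki.locallyIntegrable y).integrable
  have hFe : ∀ y, F y = ∫ t, θ t * k (y - t) := fun y => rfl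
  have hsub : ∀ y ∈ ball y₀ s, ∀ t ∈ ball (0 : Coord n) r, y - t ∈ ball y₀ (2 * s) := by
    intro y hy t ht
    rw [mem_ball, dist_eq_norm] at hy ⊢
    rw [mem_ball_zero_iff] at ht
    calc ‖y - t - y₀‖ = ‖(y - y₀) - t‖ := by congr 1; abel
      _ ≤ ‖y - y₀‖ + ‖t‖ := norm_sub_le _ _
      _ < 2 * s := by linarith [min_le_left s η]
  have hss : ball y₀ s ⊆ ball y₀ (2 * s) := ball_subset_ball (by linarith)
  have hlip : ∀ y ∈ ball y₀ s, ∀ y' ∈ ball y₀ s,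
      |F y - F y'| ≤ L * √((y - y').ofLp ⬝ᵥ g *ᵥ (y - y').ofLp) := by
    intro y hy y' hy'
    set c := L * √((y - y').ofLp ⬝ᵥ g *ᵥ (y - y').ofLp) with hcdef
    rw [hFe, hFe, ← integral_sub (hex y) (hex y')]
    have hb : ∀ t, ‖θ t * k (y - t) - θ t * k (y' - t)‖ ≤ θ t * c := by
      intro t
      have hθ0 : 0 ≤ θ t := φ.nonneg_normed t
      rw [← mul_sub, norm_mul, Real.norm_of_nonneg hθ0]
      by_cases ht : t ∈ ball (0 : Coord n) r
      · refine mul_le_mul_of_nonneg_left ?_ hθ0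
        have e := hh _ (hsub y hy t ht) _ (hsub y' hy' t ht)
        rw [hkb _ (hsub y hy t ht), hkb _ (hsub y' hy' t ht), Real.norm_eq_abs]
        rwa [sub_sub_sub_cancel_right] at e
      · have : θ t = 0 := by
          by_contra h0
          apply ht
          have : t ∈ Function.support θ := h0
          rwa [hθ, φ.support_normed_eq] at this
        simp [this]
    calc |∫ t, (θ t * k (y - t) - θ t * k (y' - t))| ≤ ∫ t, θ t * c :=
          norm_integral_le_of_norm_le (φ.integrable_normed.mul_const c)
            (Filter.Eventually.of_forall hb)
      _ = c := by rw [integral_mul_const, φ.integral_normed, one_mul]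
  refine ⟨F, hFd, fun y hy => ?_, fun y hy v => ?_⟩
  · have e := φ.dist_normed_convolution_le (x₀ := y) (μ := volume) (g := k) (ε := δ)
      hki.aestronglyMeasurable fun z hz => by
        have hzy : dist z y < r := hz
        have hz2 : z ∈ ball y₀ (2 * s) := by
          have := dist_triangle z y y₀
          have hy1 : dist y y₀ < s := hy
          rw [mem_ball]
          linarith [min_le_left s η]
        rw [hkb z hz2, hkb y (hss hy)]
        exact (huc z (ball_subset_closedBall hz2) y (ball_subset_closedBall (hss hy))
          (hzy.trans_le (min_le_right _ _))).le
    rw [Real.dist_eq, hkb y (hss hy)] at e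
    exact e
  · have hq : 0 ≤ v.ofLp ⬝ᵥ g *ᵥ v.ofLp := by simpa using hg.dotProduct_mulVec_nonneg v.ofLp
    have hder : HasDerivAt (fun t : ℝ => F (y + t • v)) (fderiv ℝ F y v) 0 := by
      have h1 : HasFDerivAt F (fderiv ℝ F y) (y + (0 : ℝ) • v) := by
        simpa using (hFd.differentiable (by simp) y).hasFDerivAt
      have h2 : HasDerivAt (fun t : ℝ => y + t • v) v 0 := by
        simpa using ((hasDerivAt_id (0 : ℝ)).smul_const v).const_add y
      exact h1.comp_hasDerivAt 0 h2
    have hle : ‖deriv (fun t : ℝ => F (y + t • v)) 0‖ ≤ L * √(v.ofLp ⬝ᵥ g *ᵥ v.ofLp) := by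
      refine norm_deriv_le_of_lip' (by positivity) ?_
      have hcont : ContinuousAt (fun t : ℝ => y + t • v) 0 := by fun_prop
      have hmem : ball y₀ s ∈ nhds (y + (0 : ℝ) • v) := by
        simpa using isOpen_ball.mem_nhds hy
      filter_upwards [hcont.preimage_mem_nhds hmem] with t ht
      have := hlip _ ht y hy
      simp only [add_sub_cancel_left, WithLp.ofLp_smul, quadForm_smul, Real.sqrt_mul (sq_nonneg t),
        Real.sqrt_sq_eq_abs] at this
      simp only [zero_smul, add_zero, sub_zero, Real.norm_eq_abs]
      linarith
    rw [hder.deriv, Real.norm_eq_abs] at hle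
    rw [← sq_abs, ← Real.sq_sqrt hq, ← mul_pow]
    exact pow_le_pow_left₀ (abs_nonneg _) hle 2

end Smoothing

section SmoothingInChart

open Matrix Metric

variable {n : ℕ} {M : Type*} [EMetricSpace M] [ChartedSpace (Coord n) M] [IsManifold (𝓡 n) ∞ M]
  [RiemannianBundle (fun x : M => TangentSpace (𝓡 n) x)]

omit [IsManifold (𝓡 n) ∞ M] in
lemma enorm_mfderiv_chartPt (x₀ : M) (y v : Coord n) :
    ‖mfderiv (𝓡 n) (𝓡 n) (chartPt x₀) y v‖ₑ
      = ENNReal.ofReal √(v.ofLp ⬝ᵥ gLow x₀ y *ᵥ v.ofLp) := by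
  rw [mfderiv_chartPt_eq_sum, ← ofReal_norm, norm_eq_sqrt_real_inner, inner_sum_coordVec]
  congr 2
  simp only [dotProduct, Matrix.mulVec, Finset.mul_sum]
  exact Finset.sum_congr rfl fun i _ => Finset.sum_congr rfl fun j _ => by ring

variable [IsRiemannianManifold (𝓡 n) M]

/-- The distance of two points in a convex coordinate domain, bounded by the length of the
coordinate segment between them. -/
lemma edist_chartPt_le {x₀ : M} {B : Set (Coord n)} (hB : Convex ℝ B) (hBt : B ⊆ tgt n x₀)
    {g : Matrix (Fin n) (Fin n) ℝ} (hg : ∀ y ∈ B, ∀ v : Fin n → ℝ,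
      v ⬝ᵥ gLow x₀ y *ᵥ v ≤ 4 * (v ⬝ᵥ g *ᵥ v)) {y y' : Coord n} (hy : y ∈ B) (hy' : y' ∈ B) :
    edist (chartPt x₀ y) (chartPt x₀ y')
      ≤ ENNReal.ofReal (2 * √((y - y').ofLp ⬝ᵥ g *ᵥ (y - y').ofLp)) := by
  set v := y - y' with hv
  set γ : ℝ → M := fun t => chartPt x₀ (y' + t • v) with hγ
  have hmem : ∀ t ∈ Set.Icc (0 : ℝ) 1, y' + t • v ∈ B := fun t ht =>
    hB.add_smul_sub_mem hy' hy ht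
  have hline : ContDiff ℝ ∞ (fun t : ℝ => y' + t • v) := by fun_prop
  have hγs : ContMDiffOn 𝓘(ℝ, ℝ) (𝓡 n) 1 γ (Set.Icc 0 1) :=
    ((contMDiffOn_chartPt x₀).of_le (by simp)).comp
      (contMDiff_iff_contDiff.2 (hline.of_le (by simp))).contMDiffOn fun t ht => hBt (hmem t ht)
  rw [edist_comm, IsRiemannianManifold.out (I := 𝓡 n) (chartPt x₀ y') (chartPt x₀ y)]
  refine (Manifold.riemannianEDist_le_pathELength hγs (by simp [hγ]) (by simp [hγ, hv])
    zero_le_one).trans ?_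
  rw [Manifold.pathELength_eq_lintegral_mfderiv_Icc]
  have hb : ∀ t ∈ Set.Icc (0 : ℝ) 1, ‖mfderiv 𝓘(ℝ, ℝ) (𝓡 n) γ t 1‖ₑ
      ≤ ENNReal.ofReal (2 * √(v.ofLp ⬝ᵥ g *ᵥ v.ofLp)) := by
    intro t ht
    have h1 : mfderiv 𝓘(ℝ, ℝ) (𝓡 n) γ t 1
        = mfderiv (𝓡 n) (𝓡 n) (chartPt x₀) (y' + t • v) v := by
      have hd : HasDerivAt (fun t : ℝ => y' + t • v) v t := by
        simpa using ((hasDerivAt_id t).smul_const v).const_add y'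
      have hm : MDifferentiableAt 𝓘(ℝ, ℝ) (𝓡 n) (fun t : ℝ => y' + t • v) t :=
        hd.differentiableAt.mdifferentiableAt
      have := mfderiv_comp t (mdifferentiableAt_chartPt (hBt (hmem t ht))) hm
      have e : γ = chartPt x₀ ∘ fun t : ℝ => y' + t • v := rfl
      rw [e, this, ContinuousLinearMap.comp_apply, mfderiv_eq_fderiv]
      congr 1
      exact fderiv_apply_one_eq_deriv.trans hd.deriv
    rw [h1, enorm_mfderiv_chartPt]
    refine ENNReal.ofReal_le_ofReal ?_
    calc √(v.ofLp ⬝ᵥ gLow x₀ (y' + t • v) *ᵥ v.ofLp) ≤ √(2 ^ 2 * (v.ofLp ⬝ᵥ g *ᵥ v.ofLp)) := by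
          refine Real.sqrt_le_sqrt ?_
          have := hg _ (hmem t ht) v.ofLp
          linarith
      _ = 2 * √(v.ofLp ⬝ᵥ g *ᵥ v.ofLp) := by
          rw [Real.sqrt_mul (by norm_num), Real.sqrt_sq (by norm_num)]
  refine (setLIntegral_mono measurable_const hb).trans ?_
  simp

variable [IsContMDiffRiemannianBundle (𝓡 n) ∞ (Coord n) (fun x : M => TangentSpace (𝓡 n) x)]

/-- Near every point a Lipschitz function has smooth approximations whose gradients are controlled
by the Lipschitz constant. -/
lemma exists_local_approx {ψ : M → ℝ} {L : NNReal} (hψ : LipschitzWith L ψ) (x₀ : M) :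
    ∃ V K : Set M, IsOpen V ∧ x₀ ∈ V ∧ IsCompact K ∧ V ⊆ K ∧ ∀ δ > 0, ∃ u : M → ℝ,
      ∀ x ∈ V, ContMDiffAt (𝓡 n) 𝓘(ℝ) ∞ u x ∧ |u x - ψ x| ≤ δ ∧
        gradIn (n := n) u u x ≤ (4 * L) ^ 2 := by
  have H := isLocalMetric_gLow (n := n) x₀
  set y₀ : Coord n := ownCoord x₀ with hy₀
  have hy₀t : y₀ ∈ tgt n x₀ := ownCoord_mem x₀
  obtain ⟨r, hr, hball⟩ := Metric.eventually_nhds_iff_ball.1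
    ((H.eventually_quadForm_le hy₀t).and ((isOpen_tgt x₀).eventually_mem hy₀t))
  set s := r / 4 with hs
  have hs0 : 0 < s := by positivity
  have hcb : closedBall y₀ (2 * s) ⊆ ball y₀ r := closedBall_subset_ball (by linarith)
  have hct : closedBall y₀ (2 * s) ⊆ tgt n x₀ := fun y hy => (hball y (hcb hy)).2
  have hcs : closedBall y₀ s ⊆ closedBall y₀ (2 * s) := closedBall_subset_closedBall (by linarith)
  have hmem : ∀ {x}, x ∈ src n x₀ ∩ extChartAt (𝓡 n) x₀ ⁻¹' ball y₀ s →
      extChartAt (𝓡 n) x₀ x ∈ closedBall y₀ s := fun hx => ball_subset_closedBall hx.2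
  refine ⟨src n x₀ ∩ extChartAt (𝓡 n) x₀ ⁻¹' ball y₀ s, chartPt x₀ '' closedBall y₀ s,
    (continuousOn_extChartAt x₀).isOpen_inter_preimage (isOpen_src x₀) isOpen_ball,
    ⟨mem_extChartAt_source x₀, mem_ball_self hs0⟩,
    (isCompact_closedBall _ _).image_of_continuousOn
      ((continuousOn_chartPt x₀).mono (hcs.trans hct)),
    fun x hx => ⟨_, hmem hx, chartPt_extChartAt hx.1⟩, fun δ hδ => ?_⟩
  have hlip : ∀ y ∈ ball y₀ (2 * s), ∀ y' ∈ ball y₀ (2 * s), |ψ (chartPt x₀ y) - ψ (chartPt x₀ y')|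
      ≤ 2 * L * √((y - y').ofLp ⬝ᵥ gLow x₀ y₀ *ᵥ (y - y').ofLp) := by
    intro y hy y' hy'
    have e1 := edist_chartPt_le (convex_ball y₀ (2 * s)) (ball_subset_closedBall.trans hct)
      (fun y hy v => ((hball y (hcb (ball_subset_closedBall hy))).1 v).1) hy hy'
    have e2 := (hψ (chartPt x₀ y) (chartPt x₀ y')).trans (mul_le_mul_right e1 (L : ℝ≥0∞))
    rw [edist_dist, Real.dist_eq, ← ENNReal.ofReal_coe_nnreal,
      ← ENNReal.ofReal_mul L.coe_nonneg, ENNReal.ofReal_le_ofReal_iff (by positivity)] at e2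
    linarith
  obtain ⟨F, hF, hF1, hF2⟩ := exists_contDiff_approx (H.posDef y₀ hy₀t).posSemidef hs0
    (by positivity : (0 : ℝ) ≤ 2 * L) hδ
    (hψ.continuous.comp_continuousOn ((continuousOn_chartPt x₀).mono hct)) hlip
  refine ⟨fun x => F (extChartAt (𝓡 n) x₀ x), fun x hx => ⟨?_, ?_, ?_⟩⟩
  · refine (contMDiff_iff_contDiff.2 hF).contMDiffAt.comp x (contMDiffAt_extChartAt' ?_)
    rw [← extChartAt_source (𝓡 n)]
    exact hx.1
  · have := hF1 _ hx.2
    simp only [Function.comp_apply] at this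
    rwa [chartPt_extChartAt hx.1] at this
  · set y := extChartAt (𝓡 n) x₀ x with hy
    have hyt : y ∈ tgt n x₀ := hct (hcs (hmem hx))
    have hxy : chartPt x₀ y = x := chartPt_extChartAt hx.1
    have hFd : DifferentiableAt ℝ F y := hF.differentiable (by simp) y
    have hpd : ∀ z ∈ tgt n x₀, F (extChartAt (𝓡 n) x₀ (chartPt x₀ z)) = F z := fun z hz => by
      rw [extChartAt_chartPt hz]
    have hd : DifferentiableAt ℝ (fun z => F (extChartAt (𝓡 n) x₀ (chartPt x₀ z))) y := by
      refine hFd.congr_of_eventuallyEq ?_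
      filter_upwards [(isOpen_tgt x₀).mem_nhds hyt] with z hz using hpd z hz
    rw [← hxy, gradIn_chartPt hyt hd hd]
    simp only [gradM, pd_congr (isOpen_tgt x₀) hpd hyt]
    have h1 : ∑ i, ∑ j, (gLow x₀ y)⁻¹ i j * (pd i F y * pd j F y)
        = (fun i => pd i F y) ⬝ᵥ (gLow x₀ y)⁻¹ *ᵥ fun i => pd i F y := by
      simp only [dotProduct, Matrix.mulVec, Finset.mul_sum]
      exact Finset.sum_congr rfl fun i _ => Finset.sum_congr rfl fun j _ => by ring
    rw [h1]
    refine dotProduct_inv_mulVec_le (H.posDef y hyt) (fun v => ?_) (by positivity)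
    have e1 := hF2 y hx.2 (WithLp.toLp 2 v)
    rw [fderiv_eq_sum_pd] at e1
    have e2 : (fun i => pd i F y) ⬝ᵥ v = ∑ i, v i * pd i F y :=
      Finset.sum_congr rfl fun i _ => mul_comm _ _
    have e3 := ((hball y (hcb (hcs (hmem hx)))).1 v).2
    rw [e2]
    refine e1.trans ?_
    simp only
    nlinarith [sq_nonneg (2 * (L : ℝ))]

end SmoothingInChart

/-! ### Cutoff functions with small gradient -/

section Cutoff

open Matrix Metric

section Differential

variable {n : ℕ} {M : Type*} [TopologicalSpace M] [ChartedSpace (Coord n) M]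

/-- The differential of `u` at `x`, in the chart around `x`. -/
def dIn (u : M → ℝ) (x : M) (v : Coord n) : ℝ :=
  fderiv ℝ (fun z => u (chartPt x z)) (ownCoord x : Coord n) v

lemma differentiableAt_ownCoord [IsManifold (𝓡 n) ∞ M] {u : M → ℝ} {x : M}
    (hu : ContMDiffAt (𝓡 n) 𝓘(ℝ) ∞ u x) :
    DifferentiableAt ℝ (fun z => u (chartPt x z)) (ownCoord x : Coord n) := by
  rw [← mdifferentiableAt_iff_differentiableAt]
  have h1 : MDifferentiableAt (𝓡 n) 𝓘(ℝ) u (chartPt x (ownCoord x : Coord n)) := by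
    rw [chartPt_ownCoord]; exact hu.mdifferentiableAt (by simp)
  exact h1.comp _ (mdifferentiableAt_chartPt (ownCoord_mem x))

lemma dIn_eq_zero {u : M → ℝ} {x : M} {c : ℝ} (h : ∀ᶠ z in nhds x, u z = c) (v : Coord n) :
    dIn u x v = 0 := by
  have hc : ContinuousAt (chartPt x) (ownCoord x : Coord n) :=
    (continuousOn_extChartAt_symm x).continuousAt ((isOpen_tgt x).mem_nhds (ownCoord_mem x))
  have h2 : ∀ᶠ z in nhds (ownCoord x : Coord n), u (chartPt x z) = c :=
    hc.eventually (by rwa [chartPt_ownCoord])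
  have h3 : (fun z => u (chartPt x z)) =ᶠ[nhds (ownCoord x : Coord n)] fun _ => c := h2
  rw [dIn, h3.fderiv_eq]
  simp

lemma dIn_mul [IsManifold (𝓡 n) ∞ M] {u w : M → ℝ} {x : M}
    (hu : ContMDiffAt (𝓡 n) 𝓘(ℝ) ∞ u x) (hw : ContMDiffAt (𝓡 n) 𝓘(ℝ) ∞ w x) (v : Coord n) :
    dIn (fun z => u z * w z) x v = u x * dIn w x v + w x * dIn u x v := by
  rw [dIn, fderiv_fun_mul (differentiableAt_ownCoord hu) (differentiableAt_ownCoord hw)]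
  simp [dIn, chartPt_ownCoord]

lemma dIn_sum [IsManifold (𝓡 n) ∞ M] {ι : Type*} {s : Finset ι} {F : ι → M → ℝ} {x : M}
    (hF : ∀ i ∈ s, ContMDiffAt (𝓡 n) 𝓘(ℝ) ∞ (F i) x) (v : Coord n) :
    dIn (fun z => ∑ i ∈ s, F i z) x v = ∑ i ∈ s, dIn (F i) x v := by
  rw [dIn, fderiv_fun_sum fun i hi => differentiableAt_ownCoord (hF i hi)]
  simp [dIn]

variable [RiemannianBundle (fun x : M => TangentSpace (𝓡 n) x)]

lemma gradIn_self_eq (u : M → ℝ) (x : M) : gradIn (n := n) u u x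
    = (fun i => pd i (fun z => u (chartPt x z)) (ownCoord x : Coord n)) ⬝ᵥ
      (gLow x (ownCoord x : Coord n))⁻¹ *ᵥ fun i => pd i (fun z => u (chartPt x z)) (ownCoord x) := by
  simp only [gradIn, gradM, dotProduct, Matrix.mulVec, Finset.mul_sum]
  exact Finset.sum_congr rfl fun i _ => Finset.sum_congr rfl fun j _ => by ring

variable [IsManifold (𝓡 n) ∞ M]
  [IsContMDiffRiemannianBundle (𝓡 n) ∞ (Coord n) (fun x : M => TangentSpace (𝓡 n) x)]

/-- The norm of the gradient bounds that of the differential. -/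
lemma sq_dIn_le (u : M → ℝ) (x : M) (v : Coord n) : dIn u x v ^ 2
    ≤ gradIn (n := n) u u x * (v.ofLp ⬝ᵥ gLow x (ownCoord x : Coord n) *ᵥ v.ofLp) := by
  have h := sq_dotProduct_le ((isLocalMetric_gLow (n := n) x).posDef _ (ownCoord_mem x))
    (fun i => pd i (fun z => u (chartPt x z)) (ownCoord x : Coord n)) v.ofLp
  rw [← gradIn_self_eq] at h
  refine le_of_eq_of_le ?_ h
  rw [dIn, fderiv_eq_sum_pd]
  congr 1
  exact Finset.sum_congr rfl fun i _ => mul_comm _ _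

/-- The norm of the differential bounds that of the gradient. -/
lemma gradIn_self_le {u : M → ℝ} {x : M} {C : ℝ} (hC : 0 ≤ C) (h : ∀ v : Coord n,
    dIn u x v ^ 2 ≤ C * (v.ofLp ⬝ᵥ gLow x (ownCoord x : Coord n) *ᵥ v.ofLp)) :
    gradIn (n := n) u u x ≤ C := by
  rw [gradIn_self_eq]
  refine dotProduct_inv_mulVec_le ((isLocalMetric_gLow (n := n) x).posDef _ (ownCoord_mem x))
    (fun v => ?_) hC
  refine le_of_eq_of_le ?_ (h (WithLp.toLp 2 v))
  rw [dIn, fderiv_eq_sum_pd]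
  congr 1
  exact Finset.sum_congr rfl fun i _ => mul_comm _ _

end Differential

variable {n : ℕ} {M : Type*} [EMetricSpace M] [ChartedSpace (Coord n) M] [IsManifold (𝓡 n) ∞ M]
  [RiemannianBundle (fun x : M => TangentSpace (𝓡 n) x)] [IsRiemannianManifold (𝓡 n) M]
  [IsContMDiffRiemannianBundle (𝓡 n) ∞ (Coord n) (fun x : M => TangentSpace (𝓡 n) x)]
  [SecondCountableTopology M]

/-- A Lipschitz function with compact support has smooth approximations with compact support whose
gradients are controlled by the Lipschitz constant.  The local approximations `uᵢ` are glued to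
`φ = ∑ ρᵢ uᵢ`; since `∑ dρᵢ = 0` where `ψ ≠ 0`, the differential of `φ` is
`∑ ρᵢ duᵢ + ∑ (uᵢ - ψ) dρᵢ`, and its second part is small. -/
lemma exists_smooth_approx {ψ : M → ℝ} {L : NNReal} (hL : 0 < L) (hψ : LipschitzWith L ψ)
    (hψc : HasCompactSupport ψ) {δ : ℝ} (hδ : 0 < δ) :
    ∃ φ : M → ℝ, ContMDiff (𝓡 n) 𝓘(ℝ) ∞ φ ∧ HasCompactSupport φ ∧
      (∀ x ∈ tsupport ψ, |φ x - ψ x| ≤ δ) ∧ ∀ x, gradIn (n := n) φ φ x ≤ (5 * L) ^ 2 := by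
  have : LocallyCompactSpace M := ChartedSpace.locallyCompactSpace (Coord n) M
  choose V K hVo hxV hKc hVK happ using fun x₀ : M => exists_local_approx (n := n) hψ x₀
  obtain ⟨ρ, hρ⟩ := SmoothPartitionOfUnity.exists_isSubordinate (𝓡 n) isClosed_univ V hVo
    (fun x _ => Set.mem_iUnion.2 ⟨x, hxV x⟩)
  have hfin := ρ.locallyFinite.finite_nonempty_inter_compact hψc.isCompact
  set s := hfin.toFinset with hs
  have hρ0 : ∀ i x, x ∉ V i → x ∉ tsupport (ρ i) := fun i x hx h => hx (hρ i h)
  have hρc : ∀ i, HasCompactSupport (ρ i) := fun i =>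
    (hKc i).of_isClosed_subset (isClosed_tsupport _) ((hρ i).trans (hVK i))
  have hρs : ∀ i, ContMDiff (𝓡 n) 𝓘(ℝ) ∞ (fun x => ρ i x) := fun i => (ρ i).contMDiff
  have hsum : ∀ x ∈ tsupport ψ, ∑ i ∈ s, ρ i x = 1 := by
    intro x hx
    have h1 := ρ.sum_eq_one (Set.mem_univ x)
    rwa [finsum_eq_sum_of_support_subset (s := s)] at h1
    intro i hi
    rw [hs, Set.Finite.coe_toFinset]
    exact ⟨x, hi, hx⟩
  have hsum_le : ∀ x, ∑ i ∈ s, ρ i x ≤ 1 := by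
    intro x
    classical
    have h1 := ρ.sum_eq_one (Set.mem_univ x)
    have hf := ρ.locallyFinite.point_finite x
    rw [finsum_eq_sum_of_support_subset (s := s ∪ hf.toFinset)] at h1
    · rw [← h1]
      exact Finset.sum_le_sum_of_subset_of_nonneg Finset.subset_union_left
        fun i _ _ => ρ.nonneg i x
    · intro i hi
      rw [Finset.coe_union]
      exact Or.inr (hf.mem_toFinset.2 hi)
  have hB : ∀ i, ∃ B : ℝ, 0 ≤ B ∧ ∀ x, gradIn (n := n) (ρ i) (ρ i) x ≤ B ^ 2 := by
    intro i
    obtain ⟨C, hC⟩ := (continuous_gradIn (hρs i) (hρs i)).bddAbove_range_of_hasCompactSupport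
      (hasCompactSupport_gradIn (hρc i))
    refine ⟨√(max C 0), Real.sqrt_nonneg _, fun x => ?_⟩
    rw [Real.sq_sqrt (le_max_right _ _)]
    exact (hC ⟨x, rfl⟩).trans (le_max_left _ _)
  choose B hB0 hB using hB
  have hBs : 0 ≤ ∑ i ∈ s, B i := Finset.sum_nonneg fun i _ => hB0 i
  -- the accuracy of the local approximations is chosen after the gradients of the `ρᵢ`
  set ε := min δ (L / (∑ i ∈ s, B i + 1)) with hε
  have hL' : (0 : ℝ) < L := hL
  have hε0 : 0 < ε := lt_min hδ (by positivity)
  have hεB : ε * ∑ i ∈ s, B i ≤ L := by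
    calc ε * ∑ i ∈ s, B i ≤ L / (∑ i ∈ s, B i + 1) * ∑ i ∈ s, B i :=
          mul_le_mul_of_nonneg_right (min_le_right _ _) hBs
      _ ≤ L := by
          rw [div_mul_eq_mul_div, div_le_iff₀ (by positivity)]
          nlinarith
  choose u hu using fun i => happ i ε hε0
  have husm : ∀ i x, x ∈ V i → ContMDiffAt (𝓡 n) 𝓘(ℝ) ∞ (u i) x := fun i x hx => (hu i x hx).1
  have hprod : ∀ i, ContMDiff (𝓡 n) 𝓘(ℝ) ∞ (fun x => ρ i x * u i x) := by
    intro i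
    refine contMDiff_of_tsupport fun x hx => ?_
    exact ((hρs i) x).mul (husm i x (hρ i (tsupport_mul_subset_left hx)))
  refine ⟨fun x => ∑ i ∈ s, ρ i x * u i x, ?_, ?_, ?_, ?_⟩
  · exact contMDiff_finsetSum fun i _ => hprod i
  · refine HasCompactSupport.intro (s.isCompact_biUnion fun i _ => (hρc i).isCompact) fun x hx => ?_
    refine Finset.sum_eq_zero fun i hi => ?_
    rw [image_eq_zero_of_notMem_tsupport fun h => hx (Set.mem_biUnion hi h), zero_mul]
  · intro x hx
    have e : ∑ i ∈ s, ρ i x * u i x - ψ x = ∑ i ∈ s, ρ i x * (u i x - ψ x) := by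
      simp only [mul_sub, Finset.sum_sub_distrib, ← Finset.sum_mul, hsum x hx, one_mul]
    rw [e]
    calc |∑ i ∈ s, ρ i x * (u i x - ψ x)| ≤ ∑ i ∈ s, |ρ i x * (u i x - ψ x)| :=
          Finset.abs_sum_le_sum_abs _ _
      _ ≤ ∑ i ∈ s, ρ i x * δ := by
          refine Finset.sum_le_sum fun i _ => ?_
          rw [abs_mul, abs_of_nonneg (ρ.nonneg i x)]
          by_cases hxV : x ∈ V i
          · exact mul_le_mul_of_nonneg_left (((hu i x hxV).2.1).trans (min_le_left _ _))
              (ρ.nonneg i x)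
          · rw [image_eq_zero_of_notMem_tsupport (hρ0 i x hxV)]; simp
      _ = δ := by rw [← Finset.sum_mul, hsum x hx, one_mul]
  · intro x
    refine gradIn_self_le (by positivity) fun v => ?_
    set N2 := v.ofLp ⬝ᵥ gLow x (ownCoord x : Coord n) *ᵥ v.ofLp with hN2
    have hN0 : 0 ≤ N2 := by
      simpa using ((isLocalMetric_gLow (n := n) x).posDef _
        (ownCoord_mem x)).posSemidef.dotProduct_mulVec_nonneg v.ofLp
    have hroot : ∀ w : M → ℝ, ∀ C : ℝ, 0 ≤ C → gradIn (n := n) w w x ≤ C ^ 2 →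
        |dIn w x v| ≤ C * √N2 := by
      intro w C hC hw
      refine abs_le_of_sq_le_sq ?_ (by positivity)
      rw [mul_pow, Real.sq_sqrt hN0]
      exact (sq_dIn_le w x v).trans (mul_le_mul_of_nonneg_right hw hN0)
    have hρz : ∀ i, x ∉ V i → ρ i x = 0 ∧ dIn (ρ i) x v = 0 := by
      intro i hx
      have h1 : (ρ i : M → ℝ) =ᶠ[nhds x] 0 := notMem_tsupport_iff_eventuallyEq.1 (hρ0 i x hx)
      exact ⟨image_eq_zero_of_notMem_tsupport (hρ0 i x hx), dIn_eq_zero (c := 0) h1 v⟩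
    have hleib : ∀ i, dIn (fun z => ρ i z * u i z) x v
        = ρ i x * dIn (u i) x v + u i x * dIn (ρ i) x v := by
      intro i
      by_cases hx : x ∈ V i
      · exact dIn_mul ((hρs i) x) (husm i x hx) v
      · rw [(hρz i hx).1, (hρz i hx).2, dIn_eq_zero (c := 0)]
        · ring
        · filter_upwards [notMem_tsupport_iff_eventuallyEq.1 (hρ0 i x hx)] with z hz
          rw [hz]; simp
    have hzero : ψ x * ∑ i ∈ s, dIn (ρ i) x v = 0 := by
      by_cases hx : ψ x = 0
      · rw [hx, zero_mul]
      · rw [← dIn_sum (fun i _ => (hρs i) x), dIn_eq_zero (c := 1), mul_zero]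
        have hopen : IsOpen {z | ψ z ≠ 0} := isOpen_ne_fun hψ.continuous continuous_const
        filter_upwards [hopen.mem_nhds hx] with z hz using hsum z (subset_tsupport _ hz)
    have hd : dIn (fun z => ∑ i ∈ s, ρ i z * u i z) x v
        = ∑ i ∈ s, ρ i x * dIn (u i) x v + ∑ i ∈ s, (u i x - ψ x) * dIn (ρ i) x v := by
      rw [dIn_sum fun i _ => (hprod i) x]
      simp only [hleib, sub_mul, Finset.sum_add_distrib, Finset.sum_sub_distrib, ← Finset.mul_sum,
        hzero, sub_zero]
    have h1 : |∑ i ∈ s, ρ i x * dIn (u i) x v| ≤ 4 * L * √N2 := by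
      calc |∑ i ∈ s, ρ i x * dIn (u i) x v| ≤ ∑ i ∈ s, |ρ i x * dIn (u i) x v| :=
            Finset.abs_sum_le_sum_abs _ _
        _ ≤ ∑ i ∈ s, ρ i x * (4 * L * √N2) := by
            refine Finset.sum_le_sum fun i _ => ?_
            rw [abs_mul, abs_of_nonneg (ρ.nonneg i x)]
            by_cases hx : x ∈ V i
            · exact mul_le_mul_of_nonneg_left (hroot _ _ (by positivity) (hu i x hx).2.2)
                (ρ.nonneg i x)
            · rw [(hρz i hx).1]; simp
        _ ≤ 4 * L * √N2 := by
            rw [← Finset.sum_mul]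
            exact mul_le_of_le_one_left (by positivity) (hsum_le x)
    have h2 : |∑ i ∈ s, (u i x - ψ x) * dIn (ρ i) x v| ≤ L * √N2 := by
      calc |∑ i ∈ s, (u i x - ψ x) * dIn (ρ i) x v| ≤ ∑ i ∈ s, |(u i x - ψ x) * dIn (ρ i) x v| :=
            Finset.abs_sum_le_sum_abs _ _
        _ ≤ ∑ i ∈ s, ε * (B i * √N2) := by
            refine Finset.sum_le_sum fun i _ => ?_
            rw [abs_mul]
            by_cases hx : x ∈ V i
            · exact mul_le_mul (hu i x hx).2.1 (hroot _ _ (hB0 i) (hB i x)) (abs_nonneg _) hε0.le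
            · rw [(hρz i hx).2, abs_zero, mul_zero]
              have := hB0 i
              positivity
        _ = ε * (∑ i ∈ s, B i) * √N2 := by
            rw [← Finset.mul_sum, ← Finset.sum_mul, mul_assoc]
        _ ≤ L * √N2 := mul_le_mul_of_nonneg_right hεB (Real.sqrt_nonneg _)
    rw [hd, ← Real.sq_sqrt hN0, ← mul_pow, ← sq_abs]
    refine pow_le_pow_left₀ (abs_nonneg _) ((abs_add_le _ _).trans ?_) 2
    linarith

variable [CompleteSpace M]

/-- On a complete manifold there are cutoff functions with arbitrarily small gradient: smooth
`max (0, 1 - d(·, K) / r)` for a large radius `r`.  Its support is compact by the Hopf-Rinow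
theorem. -/
lemma exists_cutoff {K : Set M} (hK : IsCompact K) {η : ℝ} (hη : 0 < η) :
    ∃ φ : M → ℝ, ContMDiff (𝓡 n) 𝓘(ℝ) ∞ φ ∧ HasCompactSupport φ ∧ (∀ x ∈ K, 1 / 2 ≤ φ x) ∧
      ∀ x, gradIn (n := n) φ φ x ≤ η := by
  set r : ℝ := 5 / √η with hr
  have hsη : 0 < √η := Real.sqrt_pos.2 hη
  have hr0 : 0 < r := by positivity
  set ψ : M → ℝ := fun x => (thickenedIndicator hr0 K x : ℝ) with hψ
  have hL : LipschitzWith r.toNNReal⁻¹ ψ := fun x y => by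
    have := lipschitzWith_thickenedIndicator hr0 K x y
    exact this
  have hzero : ∀ x, x ∉ cthickening r K → ψ x = 0 := fun x hx => by
    rw [hψ]
    simp only [NNReal.coe_eq_zero]
    exact thickenedIndicator_zero hr0 K fun h => hx (thickening_subset_cthickening _ _ h)
  have hc : HasCompactSupport ψ := HasCompactSupport.intro (isCompact_cthickening n hK r) hzero
  have hLpos : 0 < r.toNNReal⁻¹ := inv_pos.2 (Real.toNNReal_pos.2 hr0)
  obtain ⟨φ, h1, h2, h3, h4⟩ := exists_smooth_approx (n := n) hLpos hL hc (δ := 1 / 2) (by norm_num)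
  refine ⟨φ, h1, h2, fun x hx => ?_, fun x => (h4 x).trans_eq ?_⟩
  · have e : ψ x = 1 := by
      rw [hψ]; simp only [thickenedIndicator_one hr0 K hx, NNReal.coe_one]
    have := h3 x (subset_tsupport _ (by rw [Function.mem_support, e]; exact one_ne_zero))
    rw [e, abs_le] at this
    linarith [this.1]
  · rw [NNReal.coe_inv, Real.coe_toNNReal _ hr0.le, hr, inv_div, mul_div_cancel₀ _ (by norm_num),
      Real.sq_sqrt hη.le]

end Cutoff

/-! ### The integral estimate -/

section Estimate

open Matrix Metric

variable {n : ℕ}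

section

variable {M : Type*} [TopologicalSpace M] [ChartedSpace (Coord n) M]
  [IsManifold (𝓡 n) ∞ M] [RiemannianBundle (fun x : M => TangentSpace (𝓡 n) x)]
  [IsContMDiffRiemannianBundle (𝓡 n) ∞ (Coord n) (fun x : M => TangentSpace (𝓡 n) x)]

/-- The Cauchy-Schwarz inequality for gradients. -/
lemma gradIn_sq_le (u v : M → ℝ) (x : M) :
    gradIn (n := n) u v x ^ 2 ≤ gradIn (n := n) u u x * gradIn (n := n) v v x := by
  have H := isLocalMetric_gLow (n := n) x
  set g := gLow x (ownCoord x : Coord n) with hg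
  have hpd : g.PosDef := H.posDef _ (ownCoord_mem x)
  set p : (M → ℝ) → Fin n → ℝ := fun w i => pd i (fun z => w (chartPt x z)) (ownCoord x : Coord n)
  have e : ∀ w w' : M → ℝ, gradIn (n := n) w w' x = p w ⬝ᵥ g⁻¹ *ᵥ p w' := by
    intro w w'
    simp only [gradIn, gradM, dotProduct, Matrix.mulVec, Finset.mul_sum]
    exact Finset.sum_congr rfl fun i _ => Finset.sum_congr rfl fun j _ => by ring
  have h := sq_dotProduct_le hpd (p u) (g⁻¹ *ᵥ p v)
  rw [Matrix.mulVec_mulVec, H.mul_inv (ownCoord_mem x), Matrix.one_mulVec,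
    dotProduct_comm (g⁻¹ *ᵥ p v)] at h
  rwa [e, e, e]

variable [MeasurableSpace M] [BorelSpace M]

instance isOpenPosMeasure_riemVolume : (riemVolume n M).IsOpenPosMeasure where
  open_pos O hO hne h0 := by
    obtain ⟨x, hx⟩ := hne
    have hOm : MeasurableSet O := hO.measurableSet
    have h1 : chartVolume n x O = 0 :=
      le_antisymm ((Measure.le_iff.1 (le_iSup (fun x : M => chartVolume n x) x) O hOm).trans_eq h0)
        zero_le
    rw [chartVolume_apply x hOm, lintegral_eq_zero_iff',
      Filter.EventuallyEq, ae_restrict_iff' (measurableSet_tgt_inter x hOm)] at h1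
    · have hV : IsOpen (tgt n x ∩ chartPt x ⁻¹' O) :=
        (continuousOn_chartPt x).isOpen_inter_preimage (isOpen_tgt x) hO
      refine (hV.measure_pos volume ⟨ownCoord x, ownCoord_mem x, ?_⟩).ne' ?_
      · rw [Set.mem_preimage, chartPt_ownCoord]; exact hx
      · rw [measure_eq_zero_iff_ae_notMem]
        filter_upwards [h1] with y hy hmem
        exact (ENNReal.ofReal_pos.2 (volDens_pos hmem.1)).ne' (hy hmem)
    · exact (((continuousOn_volDens x).mono Set.inter_subset_left).aemeasurable
        (measurableSet_tgt_inter x hOm)).ennreal_ofReal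

end

/-- Young's inequality for a mixed term `x` with the Cauchy-Schwarz bound `x² ≤ α β`. -/
lemma two_mul_mul_le {α β x : ℝ} (hα : 0 ≤ α) (hβ : 0 ≤ β) (h : x ^ 2 ≤ α * β) (P Q : ℝ) :
    2 * (P * Q * x) ≤ P ^ 2 * α + Q ^ 2 * β := by
  refine le_of_abs_le (abs_le_of_sq_le_sq ?_ (by positivity))
  have h1 : 0 ≤ (P * Q) ^ 2 * (α * β - x ^ 2) := mul_nonneg (sq_nonneg _) (by linarith)
  nlinarith [sq_nonneg (P ^ 2 * α - Q ^ 2 * β)]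

/-- Hölder's inequality with the exponents `n / 2` and `n / (n - 2)`. -/
lemma integral_mul_sq_le {X : Type*} [TopologicalSpace X] [MeasurableSpace X] [BorelSpace X]
    {μ : Measure X} [IsFiniteMeasureOnCompacts μ] (hn : 3 ≤ n) {w v : X → ℝ} (hw : Continuous w)
    (hw0 : ∀ x, 0 ≤ w x) (hv : Continuous v) (hvc : HasCompactSupport v) {m : ℝ} (hm : 0 ≤ m)
    (hwm : ∫⁻ x, ENNReal.ofReal (w x ^ ((n : ℝ) / 2)) ∂μ ≤ ENNReal.ofReal (m ^ ((n : ℝ) / 2))) :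
    ∫ x, w x * v x ^ 2 ∂μ
      ≤ m * (∫ x, |v x| ^ (2 * (n : ℝ) / ((n : ℝ) - 2)) ∂μ) ^ (((n : ℝ) - 2) / (n : ℝ)) := by
  have hn3 : (3 : ℝ) ≤ n := by exact_mod_cast hn
  have hn0 : (0 : ℝ) < n := by linarith
  have hn2 : (0 : ℝ) < n - 2 := by linarith
  set p : ℝ := 2 * (n : ℝ) / ((n : ℝ) - 2) with hp
  have hp0 : 0 < p := by positivity
  have hpq : ((n : ℝ) / 2).HolderConjugate ((n : ℝ) / ((n : ℝ) - 2)) := by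
    rw [Real.holderConjugate_iff]
    refine ⟨by linarith, ?_⟩
    field_simp
    ring
  have hvp : Continuous fun x => |v x| ^ p :=
    hv.abs.rpow_const fun x => Or.inr hp0.le
  have hvpc : HasCompactSupport fun x => |v x| ^ p :=
    hvc.comp_left (g := fun t : ℝ => |t| ^ p) (by simp [Real.zero_rpow hp0.ne'])
  have hi : Integrable (fun x => |v x| ^ p) μ := hvp.integrable_of_hasCompactSupport hvpc
  have hv2 : HasCompactSupport fun x => w x * v x ^ 2 :=
    hvc.mono fun x hx h0 => hx (by simp only [h0]; ring)
  have hi2 : Integrable (fun x => w x * v x ^ 2) μ :=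
    (hw.mul (hv.pow 2)).integrable_of_hasCompactSupport hv2
  have hI0 : 0 ≤ ∫ x, |v x| ^ p ∂μ := integral_nonneg fun x => by positivity
  have h1 := ENNReal.lintegral_mul_le_Lp_mul_Lq μ hpq
    (f := fun x => ENNReal.ofReal (w x)) (g := fun x => ENNReal.ofReal (v x ^ 2))
    hw.measurable.ennreal_ofReal.aemeasurable (hv.pow 2).measurable.ennreal_ofReal.aemeasurable
  have e1 : ∀ x, ENNReal.ofReal (w x) ^ ((n : ℝ) / 2) = ENNReal.ofReal (w x ^ ((n : ℝ) / 2)) :=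
    fun x => ENNReal.ofReal_rpow_of_nonneg (hw0 x) (by positivity)
  have e2 : ∀ x, ENNReal.ofReal (v x ^ 2) ^ ((n : ℝ) / ((n : ℝ) - 2))
      = ENNReal.ofReal (|v x| ^ p) := fun x => by
    rw [ENNReal.ofReal_rpow_of_nonneg (sq_nonneg _) (by positivity), ← sq_abs, ← Real.rpow_natCast,
      ← Real.rpow_mul (abs_nonneg _)]
    congr 2
    rw [hp]; push_cast; ring
  have e3 : ∫⁻ x, ENNReal.ofReal (|v x| ^ p) ∂μ = ENNReal.ofReal (∫ x, |v x| ^ p ∂μ) :=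
    (ofReal_integral_eq_lintegral_ofReal hi (Filter.Eventually.of_forall fun x => by positivity)).symm
  have e4 : ENNReal.ofReal (∫ x, w x * v x ^ 2 ∂μ)
      = ∫⁻ x, ENNReal.ofReal (w x) * ENNReal.ofReal (v x ^ 2) ∂μ := by
    rw [ofReal_integral_eq_lintegral_ofReal hi2
      (Filter.Eventually.of_forall fun x => mul_nonneg (hw0 x) (sq_nonneg _))]
    exact lintegral_congr fun x => ENNReal.ofReal_mul (hw0 x)
  have e5 : (ENNReal.ofReal (m ^ ((n : ℝ) / 2))) ^ (1 / ((n : ℝ) / 2)) = ENNReal.ofReal m := by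
    rw [ENNReal.ofReal_rpow_of_nonneg (by positivity) (by positivity), ← Real.rpow_mul hm,
      mul_one_div_cancel (by positivity), Real.rpow_one]
  have e6 : (1 : ℝ) / ((n : ℝ) / ((n : ℝ) - 2)) = ((n : ℝ) - 2) / n := by
    rw [one_div_div]
  simp only [Pi.mul_apply] at h1
  rw [← e4] at h1
  simp only [e1, e2] at h1
  rw [e3, e6, ENNReal.ofReal_rpow_of_nonneg hI0 (by positivity)] at h1
  have h2 : ENNReal.ofReal (∫ x, w x * v x ^ 2 ∂μ)
      ≤ ENNReal.ofReal (m * (∫ x, |v x| ^ p ∂μ) ^ (((n : ℝ) - 2) / (n : ℝ))) := by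
    rw [ENNReal.ofReal_mul hm, ← e5]
    exact h1.trans (mul_le_mul' (ENNReal.rpow_le_rpow hwm (by positivity)) le_rfl)
  exact (ENNReal.ofReal_le_ofReal_iff (by positivity)).1 h2

variable {M : Type*} [EMetricSpace M] [ChartedSpace (Coord n) M] [IsManifold (𝓡 n) ∞ M]
  [RiemannianBundle (fun x : M => TangentSpace (𝓡 n) x)]
  [IsContMDiffRiemannianBundle (𝓡 n) ∞ (Coord n) (fun x : M => TangentSpace (𝓡 n) x)]
  [SecondCountableTopology M] [MeasurableSpace M] [BorelSpace M]

omit [SecondCountableTopology M] [BorelSpace M]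
  [IsContMDiffRiemannianBundle (𝓡 n) ∞ (Coord n) (fun x : M => TangentSpace (𝓡 n) x)]
  [IsManifold (𝓡 n) ∞ M] in
/-- The Sobolev inequality.  A nonzero `v` has a nonzero denominator in its Sobolev quotient,
since otherwise the quotient would be the junk value `0 < Λ`. -/
lemma sobolev_inequality (hn : 3 ≤ n) {Λ : ℝ} (hΛ : 0 < Λ) (hS : (Λ : EReal) ≤ sobolevConst n M)
    {v : M → ℝ} (hv : ContMDiff (𝓡 n) 𝓘(ℝ) ∞ v) (hvc : HasCompactSupport v) :
    Λ * (∫ x, |v x| ^ (2 * (n : ℝ) / ((n : ℝ) - 2)) ∂riemVolume n M) ^ (((n : ℝ) - 2) / (n : ℝ))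
      ≤ ∫ x, (gradIn (n := n) v v x
        + ((n : ℝ) - 2) / (4 * ((n : ℝ) - 1)) * scal (n := n) x * v x ^ 2) ∂riemVolume n M := by
  have hn3 : (3 : ℝ) ≤ n := by exact_mod_cast hn
  have hn2 : (0 : ℝ) < n - 2 := by linarith
  by_cases h0 : v = 0
  · have e1 : ∀ x, gradIn (n := n) v v x = 0 := fun x =>
      gradIn_eq_zero_of_notMem_tsupport (by rw [h0, tsupport_zero]; simp)
    have e2 : (∫ x, |v x| ^ (2 * (n : ℝ) / ((n : ℝ) - 2)) ∂riemVolume n M) = 0 := by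
      have : ∀ x, |v x| ^ (2 * (n : ℝ) / ((n : ℝ) - 2)) = 0 := fun x => by
        rw [h0]; simp [Real.zero_rpow (show 2 * (n : ℝ) / ((n : ℝ) - 2) ≠ 0 by positivity)]
      simp [this]
    rw [e2, Real.zero_rpow (by positivity)]
    simp only [e1]
    simp [h0]
  · have h1 : (Λ : EReal) ≤ ((sobolevQuotient n M v : ℝ) : EReal) :=
      hS.trans ((iInf_le _ v).trans ((iInf_le _ hv).trans ((iInf_le _ hvc).trans (iInf_le _ h0))))
    rw [EReal.coe_le_coe_iff, sobolevQuotient] at h1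
    have hD : 0 ≤ (∫ x, |v x| ^ (2 * (n : ℝ) / ((n : ℝ) - 2)) ∂riemVolume n M)
        ^ (((n : ℝ) - 2) / (n : ℝ)) :=
      Real.rpow_nonneg (integral_nonneg fun x => by positivity) _
    rcases hD.eq_or_lt with hD0 | hD0
    · rw [← hD0, div_zero] at h1
      linarith
    · exact (le_div_iff₀ hD0).1 h1

/-- The main estimate, from the weak Bochner inequality tested with `φ²`, the Sobolev inequality
for `φ √(|E|² + ε²)` with weight `κ`, and Hölder's inequality. -/
lemma sobolev_norm_le (hn : 3 ≤ n) {Λ : ℝ} (hΛ : 0 < Λ) (hS : (Λ : EReal) ≤ sobolevConst n M)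
    (hH : HasHarmonicCurvature n M) {R : ℝ} (hR : ∀ x : M, scal (n := n) x = R) {κ : ℝ}
    (hκ0 : 0 < κ) (hκ1 : κ < 1 + 2 / n)
    (hκ2 : κ * (((n : ℝ) - 2) / (4 * ((n : ℝ) - 1))) * R ≤ R / (n - 1))
    (hc : ∫⁻ x : M, ENNReal.ofReal ((normW (n := n) x + normE (n := n) x) ^ ((n : ℝ) / 2))
      ∂riemVolume n M ≤ ENNReal.ofReal ((κ * Λ / 6) ^ ((n : ℝ) / 2)))
    {φ : M → ℝ} (hφ : ContMDiff (𝓡 n) 𝓘(ℝ) ∞ φ) (hφc : HasCompactSupport φ) {ε : ℝ} (hε : 0 < ε) :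
    κ * Λ / 2 * (∫ x, |φ x * regE n ε x| ^ (2 * (n : ℝ) / ((n : ℝ) - 2)) ∂riemVolume n M)
        ^ (((n : ℝ) - 2) / (n : ℝ))
      ≤ (κ + (κ - 1) ^ 2 / (1 + 2 / n - κ))
          * ∫ x, regE n ε x ^ 2 * gradIn (n := n) φ φ x ∂riemVolume n M
        + κ * (((n : ℝ) - 2) / (4 * ((n : ℝ) - 1))) * R * ε ^ 2 * ∫ x, φ x ^ 2 ∂riemVolume n M := by
  have hn3 : (3 : ℝ) ≤ n := by exact_mod_cast hn
  have hn0 : (0 : ℝ) < n := by linarith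
  have hn2 : (0 : ℝ) < n - 2 := by linarith
  set a : ℝ := ((n : ℝ) - 2) / (4 * ((n : ℝ) - 1)) with ha
  set b : ℝ := 1 + 2 / n - κ with hb
  have hb0 : 0 < b := by linarith
  set μ := riemVolume n M with hμ
  set u : M → ℝ := regE n ε with hu
  have hus : ContMDiff (𝓡 n) 𝓘(ℝ) ∞ u := contMDiff_regE hε
  set f : M → ℝ := fun x => normE (n := n) x ^ 2 with hf
  have hfs : ContMDiff (𝓡 n) 𝓘(ℝ) ∞ f := contMDiff_normE_sq
  have hu2 : ∀ x, u x ^ 2 = f x + ε ^ 2 := fun x => Real.sq_sqrt (by positivity)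
  have hvs : ContMDiff (𝓡 n) 𝓘(ℝ) ∞ (fun x => φ x * u x) := hφ.mul hus
  have hvc : HasCompactSupport (fun x => φ x * u x) := hφc.mul_right
  have hψs : ContMDiff (𝓡 n) 𝓘(ℝ) ∞ (fun x => φ x * φ x) := hφ.mul hφ
  have hψc : HasCompactSupport (fun x => φ x * φ x) := hφc.mul_right
  have hint : ∀ g : M → ℝ, Continuous g → Integrable (fun x => φ x * φ x * g x) μ := fun g hg =>
    (hψs.continuous.mul hg).integrable_of_hasCompactSupport hψc.mul_right
  have hcE := continuous_normE (n := n) (M := M)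
  have hcW := continuous_normW (n := n) (M := M)
  have hcu := continuous_gradIn (n := n) hus hus
  have iA := hint _ hcu
  have iF := hint _ hfs.continuous
  have iw : Integrable (fun x => φ x * φ x
      * ((n / (n - 2) * normE (n := n) x + normW (n := n) x) * f x)) μ :=
    hint _ (((continuous_const.mul hcE).add hcW).mul hfs.continuous)
  have i1 := hint _ (continuous_const (y := (1 : ℝ)))
  have iX : Integrable (fun x => φ x * (u x * gradIn (n := n) φ u x)) μ :=
    (hφ.continuous.mul (hus.continuous.mul (continuous_gradIn hφ hus))).integrable_of_hasCompactSupport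
      hφc.mul_right
  have iG : Integrable (fun x => u x ^ 2 * gradIn (n := n) φ φ x) μ :=
    ((hus.continuous.pow 2).mul (continuous_gradIn hφ hφ)).integrable_of_hasCompactSupport
      (hasCompactSupport_gradIn hφc).mul_left
  set A := ∫ x, φ x * φ x * gradIn (n := n) u u x ∂μ with hA
  set X := ∫ x, φ x * (u x * gradIn (n := n) φ u x) ∂μ with hX
  set G := ∫ x, u x ^ 2 * gradIn (n := n) φ φ x ∂μ with hG
  set I := ∫ x, φ x * φ x * f x ∂μ with hI
  set J := ∫ x, φ x * φ x * 1 ∂μ with hJ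
  set Wt := ∫ x, φ x * φ x * ((n / (n - 2) * normE (n := n) x + normW (n := n) x) * f x) ∂μ with hWt
  set S := (∫ x, |φ x * u x| ^ (2 * (n : ℝ) / ((n : ℝ) - 2)) ∂μ) ^ (((n : ℝ) - 2) / (n : ℝ)) with hSd
  have hS0 : 0 ≤ S := Real.rpow_nonneg (integral_nonneg fun x => by positivity) _
  have hI0 : 0 ≤ I := integral_nonneg fun x => mul_nonneg (mul_self_nonneg _) (sq_nonneg _)
  have hgu : ∀ x, gradIn (n := n) φ f x = 2 * u x * gradIn (n := n) φ u x := by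
    intro x
    have e : f = fun z => u z * u z - ε ^ 2 := by
      funext z; rw [← sq, hu2]; ring
    have e1 := gradIn_comp_real (n := n) (u := fun z => u z * u z) (x := x)
      (φ := fun t => t - ε ^ 2) (φ' := 1) (hus.mul hus) ((hasDerivAt_id _).sub_const _) φ
    rw [gradIn_comm, e, e1, gradIn_mul hus hus, gradIn_comm u φ]
    ring
  have hgψ : ∀ x, gradIn (n := n) (fun z => φ z * φ z) f x
      = 4 * (φ x * (u x * gradIn (n := n) φ u x)) := by
    intro x
    rw [gradIn_mul hφ hφ, hgu]; ring
  have hgv : ∀ x, gradIn (n := n) (fun z => φ z * u z) (fun z => φ z * u z) x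
      = φ x * φ x * gradIn (n := n) u u x + 2 * (φ x * (u x * gradIn (n := n) φ u x))
        + u x ^ 2 * gradIn (n := n) φ φ x := by
    intro x
    rw [gradIn_mul hφ hus, gradIn_comm u, gradIn_comm φ, gradIn_mul hφ hus, gradIn_mul hφ hus,
      gradIn_comm u φ]
    ring
  -- half the weak Bochner inequality; `∇(φ²) · ∇f = 4 φ u ∇φ · ∇u` produces the mixed term `X`
  have hweak : 2 * X + (1 + 2 / n) * A + R / (n - 1) * I - Wt ≤ 0 := by
    have hF : Continuous (lapLower n ε : M → ℝ) := by
      have : (lapLower n ε : M → ℝ) = fun x => 2 * ((1 + 2 / n) * gradIn (n := n) u u x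
          + (R / (n - 1) - (n / (n - 2) * normE (n := n) x + normW (n := n) x)) * f x) := by
        funext x; rw [lapLower, hR x]
      rw [this]
      exact continuous_const.mul ((continuous_const.mul hcu).add
        ((continuous_const.sub ((continuous_const.mul hcE).add hcW)).mul hfs.continuous))
    have h1 := integral_gradIn_le hfs hF (fun x₀ y hy => lapLower_le hn hH hε hy) hψs hψc
      (fun x => mul_self_nonneg _)
    simp only [hgψ] at h1
    rw [integral_const_mul] at h1
    have e : ∀ x, φ x * φ x * lapLower n ε x = 2 * ((1 + 2 / n) * (φ x * φ x * gradIn (n := n) u u x)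
        + R / (n - 1) * (φ x * φ x * f x)
        - φ x * φ x * ((n / (n - 2) * normE (n := n) x + normW (n := n) x) * f x)) := by
      intro x; rw [lapLower, hR x]; ring
    simp only [e] at h1
    have iAF : Integrable (fun x => (1 + 2 / n) * (φ x * φ x * gradIn (n := n) u u x)
        + R / (n - 1) * (φ x * φ x * f x)) μ := (iA.const_mul _).add (iF.const_mul _)
    rw [integral_const_mul, integral_sub iAF iw,
      integral_add (iA.const_mul _) (iF.const_mul _), integral_const_mul, integral_const_mul] at h1
    linarith
  -- the Sobolev inequality for `φ u`, with `(φ u)² = φ² f + ε² φ²`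
  have hsob : Λ * S ≤ A + 2 * X + G + a * R * (I + ε ^ 2 * J) := by
    have h1 : Λ * S ≤ ∫ x, (gradIn (n := n) (fun z => φ z * u z) (fun z => φ z * u z) x
        + a * scal (n := n) x * (φ x * u x) ^ 2) ∂μ := sobolev_inequality hn hΛ hS hvs hvc
    have e : ∀ x, gradIn (n := n) (fun z => φ z * u z) (fun z => φ z * u z) x
        + a * scal (n := n) x * (φ x * u x) ^ 2
        = φ x * φ x * gradIn (n := n) u u x + 2 * (φ x * (u x * gradIn (n := n) φ u x))
          + u x ^ 2 * gradIn (n := n) φ φ x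
          + a * R * (φ x * φ x * f x + ε ^ 2 * (φ x * φ x * 1)) := by
      intro x
      rw [hgv, hR x, mul_pow, hu2]; ring
    simp only [e] at h1
    have iAX : Integrable (fun x => φ x * φ x * gradIn (n := n) u u x
        + 2 * (φ x * (u x * gradIn (n := n) φ u x))) μ := iA.add (iX.const_mul _)
    have iAXG : Integrable (fun x => φ x * φ x * gradIn (n := n) u u x
        + 2 * (φ x * (u x * gradIn (n := n) φ u x)) + u x ^ 2 * gradIn (n := n) φ φ x) μ :=
      iAX.add iG
    have iF1 : Integrable (fun x => φ x * φ x * f x + ε ^ 2 * (φ x * φ x * 1)) μ :=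
      iF.add (i1.const_mul _)
    rw [integral_add iAXG (iF1.const_mul _), integral_add iAX iG, integral_add iA (iX.const_mul _),
      integral_const_mul, integral_const_mul, integral_add iF (i1.const_mul _),
      integral_const_mul] at h1
    exact h1
  -- the coefficients `n / (n - 2)` and `1` are at most `3`, whence the `6 = 2 · 3` in `hc`
  have hhol : Wt ≤ κ * Λ / 2 * S := by
    have hw0 : ∀ x : M, 0 ≤ normW (n := n) x + normE (n := n) x := fun x =>
      add_nonneg (normW_nonneg x) (normE_nonneg x)
    have h1 := integral_mul_sq_le (μ := μ) (w := fun x => normW (n := n) x + normE (n := n) x)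
      hn (hcW.add hcE) hw0 hvs.continuous hvc
      (by positivity : 0 ≤ κ * Λ / 6) hc
    have iv : Integrable (fun x => (normW (n := n) x + normE (n := n) x) * (φ x * u x) ^ 2) μ := by
      have : Integrable (fun x => φ x * φ x
          * ((normW (n := n) x + normE (n := n) x) * u x ^ 2)) μ :=
        hint _ ((hcW.add hcE).mul (hus.continuous.pow 2))
      refine this.congr (Filter.Eventually.of_forall fun x => ?_)
      ring
    have h2 : Wt ≤ ∫ x, 3 * ((normW (n := n) x + normE (n := n) x) * (φ x * u x) ^ 2) ∂μ := by
      refine integral_mono iw (iv.const_mul 3) fun x => ?_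
      have hE0 := normE_nonneg (n := n) x
      have hW0 := normW_nonneg (n := n) x
      have h3 : (n : ℝ) / (n - 2) ≤ 3 := by rw [div_le_iff₀ hn2]; linarith
      have h4 : n / (n - 2) * normE (n := n) x + normW (n := n) x
          ≤ 3 * (normW (n := n) x + normE (n := n) x) := by nlinarith
      have h5 : f x ≤ u x ^ 2 := by rw [hu2]; nlinarith
      calc φ x * φ x * ((n / (n - 2) * normE (n := n) x + normW (n := n) x) * f x)
          ≤ φ x * φ x * (3 * (normW (n := n) x + normE (n := n) x) * u x ^ 2) :=
            mul_le_mul_of_nonneg_left (mul_le_mul h4 h5 (sq_nonneg _) (by positivity))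
              (mul_self_nonneg _)
        _ = _ := by ring
    rw [integral_const_mul] at h2
    linarith
  -- `b` is what is left of the coefficient of `A` after `κ` times the Sobolev inequality
  have hmix : 2 * (κ - 1) * X ≤ b * A + (κ - 1) ^ 2 / b * G := by
    rw [hX, hA, hG, ← integral_const_mul, ← integral_const_mul, ← integral_const_mul,
      ← integral_add (iA.const_mul _) (iG.const_mul _)]
    refine integral_mono (iX.const_mul _) ((iA.const_mul _).add (iG.const_mul _)) fun x => ?_
    have h1 := two_mul_mul_le (gradIn_self_nonneg (n := n) u x) (gradIn_self_nonneg (n := n) φ x)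
      (x := gradIn (n := n) φ u x) (by rw [mul_comm]; exact gradIn_sq_le φ u x)
      (b * φ x) ((κ - 1) * u x)
    have e : b * (φ x * φ x * gradIn (n := n) u u x) + (κ - 1) ^ 2 / b * (u x ^ 2 * gradIn (n := n) φ φ x)
        = ((b * φ x) ^ 2 * gradIn (n := n) u u x + ((κ - 1) * u x) ^ 2 * gradIn (n := n) φ φ x) / b := by
      field_simp
    rw [e, le_div_iff₀ hb0]
    linarith
  have hRI : κ * a * R * I ≤ R / (n - 1) * I := mul_le_mul_of_nonneg_right hκ2 hI0
  have hJ' : J = ∫ x, φ x ^ 2 ∂μ := by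
    rw [hJ]; exact integral_congr_ae (Filter.Eventually.of_forall fun x => by simp only; ring)
  rw [← hJ']
  have h5 := mul_le_mul_of_nonneg_left hsob hκ0.le
  -- `κ · hsob + hweak + hhol + hmix`: the terms in `A` and `X` cancel, and `κ a R I` is absorbed
  have h6 : b * A = (1 + 2 / n) * A - κ * A := by rw [hb]; ring
  have h7 : (κ + (κ - 1) ^ 2 / b) * G = κ * G + (κ - 1) ^ 2 / b * G := by ring
  nlinarith

end Estimate

/-! ### Rigidity -/

section Rigidity

open Matrix Metric

lemma add_rpow_le {a b q : ℝ} (ha : 0 ≤ a) (hb : 0 ≤ b) (hq : 0 ≤ q) :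
    (a + b) ^ q ≤ 2 ^ q * (a ^ q + b ^ q) := by
  have h1 : (a + b) ^ q ≤ (2 * max a b) ^ q :=
    Real.rpow_le_rpow (by positivity) (by linarith [le_max_left a b, le_max_right a b]) hq
  refine h1.trans ?_
  rw [Real.mul_rpow zero_le_two (le_max_of_le_left ha)]
  refine mul_le_mul_of_nonneg_left ?_ (by positivity)
  have := Real.rpow_nonneg ha q
  have := Real.rpow_nonneg hb q
  rcases max_choice a b with h | h <;> rw [h] <;> linarith

/-- The weight `κ` of the Sobolev inequality.  For `κ = 4 / (n - 2)` the scalar curvature terms of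
the Bochner and Sobolev inequalities cancel, but `κ < 1 + 2 / n` then requires `n ≥ 5`; for `R ≥ 0`
a cancellation is not needed and `κ = 1` serves. -/
lemma exists_weight {n : ℕ} (hn : 3 ≤ n) : ∃ κ : ℝ, 0 < κ ∧ κ < 1 + 2 / n ∧
    ∀ R : ℝ, (0 ≤ R ∨ (R < 0 ∧ 5 ≤ n)) →
      κ * (((n : ℝ) - 2) / (4 * ((n : ℝ) - 1))) * R ≤ R / (n - 1) := by
  have hn3 : (3 : ℝ) ≤ n := by exact_mod_cast hn
  have hn0 : (0 : ℝ) < n := by linarith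
  have hn1 : (0 : ℝ) < n - 1 := by linarith
  have hn2 : (0 : ℝ) < n - 2 := by linarith
  by_cases h5 : 5 ≤ n
  · have h5' : (5 : ℝ) ≤ n := by exact_mod_cast h5
    refine ⟨4 / (n - 2), by positivity, ?_, fun R _ => le_of_eq (by field_simp)⟩
    rw [← sub_pos, show 1 + 2 / (n : ℝ) - 4 / (n - 2) = ((n : ℝ) * (n - 4) - 4) / (n * (n - 2)) by
      field_simp; ring]
    exact div_pos (by nlinarith) (by positivity)
  · refine ⟨1, one_pos, by linarith [div_pos two_pos hn0], fun R hR => ?_⟩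
    have hR0 : 0 ≤ R := by
      rcases hR with h | h
      · exact h
      · exact absurd h.2 h5
    have h4 : (n : ℝ) ≤ 4 := by exact_mod_cast (by omega : n ≤ 4)
    rw [one_mul, div_mul_eq_mul_div, div_le_div_iff₀ (by positivity) hn1]
    nlinarith [mul_nonneg hR0 hn1.le]

variable {n : ℕ} {M : Type*} [EMetricSpace M] [ChartedSpace (Coord n) M] [IsManifold (𝓡 n) ∞ M]
  [RiemannianBundle (fun x : M => TangentSpace (𝓡 n) x)]
  [IsContMDiffRiemannianBundle (𝓡 n) ∞ (Coord n) (fun x : M => TangentSpace (𝓡 n) x)]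
  [SecondCountableTopology M] [MeasurableSpace M] [BorelSpace M]

/-- A lower bound, uniform in the cutoff function, for the Sobolev norm of `φ √(|E|² + ε²)` when
`E` does not vanish at `x`. -/
lemma exists_le_norm {x : M} (hx : normE (n := n) x ≠ 0) {p : ℝ} (hp : 0 < p) :
    ∃ K : Set M, IsCompact K ∧ ∃ s : ℝ, 0 < s ∧ ∀ φ : M → ℝ, ContMDiff (𝓡 n) 𝓘(ℝ) ∞ φ →
      HasCompactSupport φ → (∀ z ∈ K, 1 / 2 ≤ φ z) → ∀ ε : ℝ, 0 < ε →
        s ≤ ∫ z, |φ z * regE n ε z| ^ p ∂riemVolume n M := by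
  have : LocallyCompactSpace M := ChartedSpace.locallyCompactSpace (Coord n) M
  obtain ⟨K, hK, hKx⟩ := exists_compact_mem_nhds x
  have hx0 : 0 < normE (n := n) x := (normE_nonneg x).lt_of_ne' hx
  set e := normE (n := n) x / 2 with he
  have he0 : 0 < e := by positivity
  set O : Set M := interior K ∩ {z | e < normE (n := n) z} with hO
  have hOo : IsOpen O :=
    isOpen_interior.inter (isOpen_lt continuous_const continuous_normE)
  have hxO : x ∈ O := ⟨mem_interior_iff_mem_nhds.2 hKx, show e < normE (n := n) x by linarith⟩
  have hOK : O ⊆ K := Set.inter_subset_left.trans interior_subset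
  have hpos : 0 < riemVolume n M O := hOo.measure_pos _ ⟨x, hxO⟩
  have hfin : riemVolume n M O < ⊤ := (measure_mono hOK).trans_lt hK.measure_lt_top
  refine ⟨K, hK, (riemVolume n M).real O * (e / 2) ^ p,
    mul_pos (ENNReal.toReal_pos hpos.ne' hfin.ne) (by positivity), fun φ hφ hφc hφK ε hε => ?_⟩
  have hc : Continuous fun z => |φ z * regE n ε z| ^ p :=
    (hφ.continuous.mul (contMDiff_regE hε).continuous).abs.rpow_const fun z => Or.inr hp.le
  have hcs : HasCompactSupport fun z => |φ z * regE n ε z| ^ p :=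
    hφc.mono fun z hz h0 => hz (by simp [h0, Real.zero_rpow hp.ne'])
  rw [← smul_eq_mul, ← integral_indicator_const _ hOo.measurableSet]
  refine integral_mono ((integrable_indicator_iff hOo.measurableSet).2
    (integrableOn_const hfin.ne)) (hc.integrable_of_hasCompactSupport hcs) fun z => ?_
  by_cases hz : z ∈ O
  · rw [Set.indicator_of_mem hz]
    refine Real.rpow_le_rpow (by positivity) ?_ hp.le
    have h1 : e ≤ regE n ε z :=
      hz.2.le.trans (Real.le_sqrt_of_sq_le (le_add_of_nonneg_right (sq_nonneg ε)))
    have h2 := mul_le_mul (hφK z (hOK hz)) h1 he0.le (by linarith [hφK z (hOK hz)])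
    exact (by linarith : e / 2 ≤ φ z * regE n ε z).trans (le_abs_self _)
  · rw [Set.indicator_of_notMem hz]
    positivity

omit [SecondCountableTopology M] in
/-- The gradient term of the main estimate: `|E|²` is integrable and `|∇φ|²` is small. -/
lemma integral_regE_sq_mul_le {f φ : M → ℝ} (hf : f = fun x => normE (n := n) x ^ 2)
    (hfi : Integrable f (riemVolume n M)) (hφ : ContMDiff (𝓡 n) 𝓘(ℝ) ∞ φ)
    (hφc : HasCompactSupport φ) {η : ℝ} (hη : ∀ x, gradIn (n := n) φ φ x ≤ η) (ε : ℝ) :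
    ∫ x, regE n ε x ^ 2 * gradIn (n := n) φ φ x ∂riemVolume n M
      ≤ η * ∫ x, f x ∂riemVolume n M + ε ^ 2 * ∫ x, gradIn (n := n) φ φ x ∂riemVolume n M := by
  have hu2 : ∀ x : M, regE n ε x ^ 2 = f x + ε ^ 2 := fun x => by
    rw [hf]; exact Real.sq_sqrt (by positivity)
  have hcg := continuous_gradIn (n := n) hφ hφ
  have hgc := hasCompactSupport_gradIn (n := n) (v := φ) hφc
  have hf0 : ∀ x, 0 ≤ f x := fun x => by rw [hf]; positivity
  have hfc : Continuous f := by rw [hf]; exact continuous_normE.pow 2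
  have hgi : Integrable (gradIn (n := n) φ φ) (riemVolume n M) :=
    hcg.integrable_of_hasCompactSupport hgc
  rw [← integral_const_mul, ← integral_const_mul,
    ← integral_add (hfi.const_mul _) (hgi.const_mul _)]
  simp only [hu2]
  refine integral_mono (((hfc.add continuous_const).mul hcg).integrable_of_hasCompactSupport
    hgc.mul_left) ((hfi.const_mul _).add (hgi.const_mul _)) fun x => ?_
  have := mul_le_mul_of_nonneg_left (hη x) (hf0 x)
  simp only
  linarith

/-- On a complete manifold, the cutoff functions of small gradient turn the integral estimate into
the vanishing of `E`. -/
lemma normE_eq_zero [IsRiemannianManifold (𝓡 n) M] [CompleteSpace M] (hn : 3 ≤ n) {Λ : ℝ}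
    (hΛ : 0 < Λ) (hS : (Λ : EReal) ≤ sobolevConst n M)
    (hH : HasHarmonicCurvature n M) {R : ℝ} (hR : ∀ x : M, scal (n := n) x = R) {κ : ℝ}
    (hκ0 : 0 < κ) (hκ1 : κ < 1 + 2 / n)
    (hκ2 : κ * (((n : ℝ) - 2) / (4 * ((n : ℝ) - 1))) * R ≤ R / (n - 1))
    (hc : ∫⁻ x : M, ENNReal.ofReal ((normW (n := n) x + normE (n := n) x) ^ ((n : ℝ) / 2))
      ∂riemVolume n M ≤ ENNReal.ofReal ((κ * Λ / 6) ^ ((n : ℝ) / 2)))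
    (hfi : Integrable (fun x : M => normE (n := n) x ^ 2) (riemVolume n M)) (x : M) :
    normE (n := n) x = 0 := by
  by_contra hx
  have hn3 : (3 : ℝ) ≤ n := by exact_mod_cast hn
  have hn2 : (0 : ℝ) < n - 2 := by linarith
  have hb0 : 0 < 1 + 2 / n - κ := by linarith
  obtain ⟨K, hK, s, hs0, hs⟩ :=
    exists_le_norm hx (p := 2 * (n : ℝ) / ((n : ℝ) - 2)) (by positivity)
  set q : ℝ := ((n : ℝ) - 2) / (n : ℝ) with hq
  have hq0 : 0 ≤ q := by positivity
  set D : ℝ := κ + (κ - 1) ^ 2 / (1 + 2 / n - κ) with hD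
  have hD0 : 0 < D := add_pos_of_pos_of_nonneg hκ0 (by positivity)
  set F : ℝ := ∫ x : M, normE (n := n) x ^ 2 ∂riemVolume n M with hF
  have hF0 : 0 ≤ F := integral_nonneg fun x => sq_nonneg _
  set t : ℝ := κ * Λ / 2 * s ^ q with ht
  have ht0 : 0 < t := by positivity
  clear_value t F D
  have hη0 : 0 < t / (2 * D * (F + 1)) := by positivity
  obtain ⟨φ, hφ, hφc, hφK, hφη⟩ := exists_cutoff (n := n) hK hη0
  set B : ℝ := D * (∫ x, gradIn (n := n) φ φ x ∂riemVolume n M)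
    + κ * (((n : ℝ) - 2) / (4 * ((n : ℝ) - 1))) * R * ∫ x, φ x ^ 2 ∂riemVolume n M with hB
  have key : ∀ ε : ℝ, 0 < ε → t ≤ t / 2 + ε ^ 2 * B := by
    intro ε hε
    have h1 := sobolev_norm_le hn hΛ hS hH hR hκ0 hκ1 hκ2 hc hφ hφc hε
    have h2 := Real.rpow_le_rpow hs0.le (hs φ hφ hφc hφK ε hε) hq0
    have h3 := mul_le_mul_of_nonneg_left h2 (by positivity : 0 ≤ κ * Λ / 2)
    have h4 := mul_le_mul_of_nonneg_left
      (integral_regE_sq_mul_le rfl hfi hφ hφc hφη ε) hD0.le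
    have h5 : D * (t / (2 * D * (F + 1)) * F) ≤ t / 2 := by
      rw [show D * (t / (2 * D * (F + 1)) * F) = t / 2 * (F / (F + 1)) by field_simp]
      exact mul_le_of_le_one_right (by positivity) ((div_le_one (by positivity)).2 (by linarith))
    rw [← hD] at h1
    rw [← ht] at h3
    rw [← hF] at h4
    linear_combination h3 + h1 + h4 + h5 - ε ^ 2 * hB
  -- this `ε` makes `ε² B` at most `t / 4`
  have h1 := key √(t / (4 * (|B| + 1))) (Real.sqrt_pos.2 (by positivity))
  rw [Real.sq_sqrt (by positivity)] at h1
  have h2 : t / (4 * (|B| + 1)) * B ≤ t / 4 := by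
    calc t / (4 * (|B| + 1)) * B ≤ t / (4 * (|B| + 1)) * (|B| + 1) :=
          mul_le_mul_of_nonneg_left (by linarith [le_abs_self B]) (by positivity)
      _ = t / 4 := by field_simp
  linarith

omit [SecondCountableTopology M] [MeasurableSpace M] [BorelSpace M] in
/-- With `E = 0` the Ricci tensor is `R / n` times the metric. -/
lemma ric_eq_of_normE_eq_zero {R : ℝ} (hR : ∀ x : M, scal (n := n) x = R)
    (hE : ∀ x : M, normE (n := n) x = 0) {x₀ : M} {y : Coord n} (hy : y ∈ tgt n x₀)
    (i j : Fin n) : ric x₀ i j y = R / n * gLow x₀ y i j := by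
  have H := isLocalMetric_gLow (n := n) x₀
  obtain ⟨P, hP⟩ := exists_isFrame (H.posDef y hy)
  have h0 : sqE (riemF (gLow x₀) P y) = 0 := by
    rw [← H.sqEM_eq hP hy, ← normE_sq_chartPt hy, hE, zero_pow two_ne_zero]
  have htf : Matrix.of (tfF (riemF (gLow x₀) P y)) = 0 := by
    ext a b
    have h1 := (Finset.sum_eq_zero_iff_of_nonneg
      fun a _ => Finset.sum_nonneg fun b _ => sq_nonneg _).1 h0 a (Finset.mem_univ a)
    exact pow_eq_zero_iff two_ne_zero |>.1
      ((Finset.sum_eq_zero_iff_of_nonneg fun b _ => sq_nonneg _).1 h1 b (Finset.mem_univ b))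
  set E := Matrix.of fun i j => tracelessRic x₀ i j y with hEdef
  have hPE : Pᵀ * E * P = 0 := (frame_tracelessRic hP hy).trans htf
  have hE0 : E = 0 := by
    have h1 : gLow x₀ y * (P * Pᵀ) = 1 := by rw [← hP.inv_eq]; exact H.mul_inv hy
    have h2 : P * Pᵀ * gLow x₀ y = 1 := mul_eq_one_comm.1 h1
    calc E = gLow x₀ y * (P * Pᵀ) * E * (P * Pᵀ * gLow x₀ y) := by
          rw [h1, h2, Matrix.one_mul, Matrix.mul_one]
      _ = gLow x₀ y * P * (Pᵀ * E * P) * Pᵀ * gLow x₀ y := by simp only [Matrix.mul_assoc]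
      _ = 0 := by rw [hPE]; simp
  have h3 : tracelessRic x₀ i j y = 0 := congrFun (congrFun hE0 i) j
  rw [tracelessRic, scalCoord_eq hy, ← scal_chartPt hy, hR] at h3
  linarith

end Rigidity

end RiemGeom

end

theorem theorem1 (n : ℕ) (hn : 3 ≤ n) (Λ : ℝ) (hΛ : 0 < Λ) :
    ∃ c₀ : ℝ, 0 < c₀ ∧
      ∀ (M : Type u) [EMetricSpace M] [ConnectedSpace M] [SecondCountableTopology M]
        [MeasurableSpace M] [BorelSpace M]
        [ChartedSpace (EuclideanSpace ℝ (Fin n)) M] [IsManifold (𝓡 n) ∞ M]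
        [RiemannianBundle (fun x : M => TangentSpace (𝓡 n) x)]
        [IsContMDiffRiemannianBundle (𝓡 n) ∞ (EuclideanSpace ℝ (Fin n))
          (fun x : M => TangentSpace (𝓡 n) x)]
        [IsRiemannianManifold (𝓡 n) M] [NoncompactSpace M] [CompleteSpace M],
        RiemGeom.HasHarmonicCurvature n M →
        (Λ : EReal) ≤ RiemGeom.sobolevConst n M →
        ∫⁻ x : M, ENNReal.ofReal
          (RiemGeom.normW (n := n) x ^ 2 + RiemGeom.normE (n := n) x ^ 2)
            ∂(RiemGeom.riemVolume n M) < ⊤ →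
        ((∀ x : M, 0 ≤ RiemGeom.scal (n := n) x) ∨
          ((∀ x : M, RiemGeom.scal (n := n) x < 0) ∧ 5 ≤ n)) →
        ∫⁻ x : M, ENNReal.ofReal
          (RiemGeom.normW (n := n) x ^ ((n : ℝ) / 2) + RiemGeom.normE (n := n) x ^ ((n : ℝ) / 2))
            ∂(RiemGeom.riemVolume n M) ≤ ENNReal.ofReal c₀ →
        RiemGeom.IsEinstein n M := by
  obtain ⟨κ, hκ0, hκ1, hκ2⟩ := RiemGeom.exists_weight hn
  set q : ℝ := (n : ℝ) / 2 with hq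
  refine ⟨(κ * Λ / 12) ^ q, by positivity, ?_⟩
  intro M _ _ _ _ _ _ _ _ _ _ _ _ hH hS hL2 hR hLn
  obtain ⟨R, hRc⟩ := RiemGeom.exists_scal_eq (n := n) hH
  obtain ⟨x₀⟩ : Nonempty M := inferInstance
  have hR' : 0 ≤ R ∨ (R < 0 ∧ 5 ≤ n) := by
    rcases hR with h | h
    · exact Or.inl (hRc x₀ ▸ h x₀)
    · exact Or.inr ⟨hRc x₀ ▸ h.1 x₀, h.2⟩
  have hfi : Integrable (fun x : M => RiemGeom.normE (n := n) x ^ 2) (RiemGeom.riemVolume n M) := by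
    refine ⟨(RiemGeom.continuous_normE.pow 2).aestronglyMeasurable, ?_⟩
    rw [hasFiniteIntegral_iff_ofReal (Filter.Eventually.of_forall fun x => sq_nonneg _)]
    exact (lintegral_mono fun x => ENNReal.ofReal_le_ofReal
      (le_add_of_nonneg_left (sq_nonneg _))).trans_lt hL2
  have hc : ∫⁻ x : M, ENNReal.ofReal ((RiemGeom.normW (n := n) x + RiemGeom.normE (n := n) x) ^ q)
      ∂(RiemGeom.riemVolume n M) ≤ ENNReal.ofReal ((κ * Λ / 6) ^ q) := by
    calc ∫⁻ x : M, ENNReal.ofReal ((RiemGeom.normW (n := n) x + RiemGeom.normE (n := n) x) ^ q)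
          ∂(RiemGeom.riemVolume n M)
        ≤ ∫⁻ x : M, ENNReal.ofReal (2 ^ q) * ENNReal.ofReal
            (RiemGeom.normW (n := n) x ^ q + RiemGeom.normE (n := n) x ^ q)
            ∂(RiemGeom.riemVolume n M) := by
          refine lintegral_mono fun x => ?_
          rw [← ENNReal.ofReal_mul (by positivity)]
          exact ENNReal.ofReal_le_ofReal (RiemGeom.add_rpow_le (RiemGeom.normW_nonneg x)
            (RiemGeom.normE_nonneg x) (by positivity))
      _ = ENNReal.ofReal (2 ^ q) * ∫⁻ x : M, ENNReal.ofReal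
            (RiemGeom.normW (n := n) x ^ q + RiemGeom.normE (n := n) x ^ q)
            ∂(RiemGeom.riemVolume n M) := lintegral_const_mul' _ _ ENNReal.ofReal_ne_top
      _ ≤ ENNReal.ofReal (2 ^ q) * ENNReal.ofReal ((κ * Λ / 12) ^ q) := by gcongr
      _ = ENNReal.ofReal ((κ * Λ / 6) ^ q) := by
          rw [← ENNReal.ofReal_mul (by positivity), ← Real.mul_rpow zero_le_two (by positivity)]
          congr 2
          ring
  have hE : ∀ x : M, RiemGeom.normE (n := n) x = 0 :=
    RiemGeom.normE_eq_zero hn hΛ hS hH hRc hκ0 hκ1 (hκ2 R hR') hc hfi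
  exact ⟨R / n, fun x y hy i j => RiemGeom.ric_eq_of_normE_eq_zero hRc hE hy i j⟩
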